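/- Let $\mathbb S^1\subset\mathbb R^2=\mathbb C$ be the unit circle with angle $\theta\in[0,2\pi)$, and let $\mathrm{Diff}^k_+(\mathbb S^1)$ be the group of orientation preserving $C^k$ diffeomorphisms of $\mathbb S^1$, where $\phi'>0$ is defined by $\phi^*d\theta=\phi'\,d\theta$. A point $p$ is a balance point of $\phi$ if $\phi(-p)=-\phi(p)$. Let $\mathrm{BDiff}$ be the set of $\phi\in\mathrm{Diff}^1_+(\mathbb S^1)$ with at least $4$ (possibly infinitely many) balance points, and $\overline{\mathrm{BDiff}}$ its closure in $\mathrm{Diff}^1_+(\mathbb S^1)$ for the $C^1$ topology. Let $\mathrm{M\ddot ob}(\mathbb S^1)$ be the group of maps $x\mapsto Lx/|Lx|$ with $L\in SL(2,\mathbb R)$. For $\tau\in\mathbb R$ let $\psi_\tau:\mathbb S^1\to\mathbb S^1$ be given by $$\theta(\psi_\tau(p))=\cot^{-1}\!\big(\tau+\cot(\theta(p)-\tfrac{\pi}{2})\big)+\tfrac{\pi}{2}\quad\text{if }\tfrac{\pi}{2}<\theta(p)<\tfrac{3\pi}{2},\qquad \psi_\tau(p)=p\quad\text{otherwise},$$ where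 $\cot^{-1}:\mathbb R\to(0,\pi)$. Let $\phi\in\mathrm{Diff}^1_+(\mathbb S^1)$ be such that $u=\log\phi'$ belongs to $H^1(\mathbb S^1)$ and satisfies $\int_{\mathbb S^1}e^{u}\,d\theta=2\pi$, and set $$\mathcal E_G^*[\phi]=\int_{\mathbb S^1}\Big(\tfrac14(u')^2-e^{2u}\Big)\,d\theta+2\pi .$$ If $\phi\in\overline{\mathrm{BDiff}}$, then $\mathcal E_G^*[\phi]\ge 0$, with equality if and only if $\phi=R\circ\psi_\tau\circ\hat\phi$ for some rotation $R$ of $\mathbb S^1$, some $\tau\in\mathbb R$ and some $\hat\phi\in\mathrm{M\ddot ob}(\mathbb S^1)$. If, in addition, $\phi\in\mathrm{Diff}^2_+(\mathbb S^1)$ or $\phi\in\mathrm{BDiff}$, then equality occurs if and only if $\phi\in\mathrm{M\ddot ob}(\mathbb S^1)$. -/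

import Mathlib

open Real MeasureTheory Set
open scoped Manifold ContDiff ComplexConjugate

namespace OvalsBL

noncomputable section

/-! The unit circle is `Circle`, the unit complex numbers; `Circle.exp` is the covering map
`x ↦ e^{ix}`, and the antipodal involution is `p ↦ -p`. -/

/-- The Borel sigma-algebra on the circle. -/
instance instMeasurableSpaceCircle : MeasurableSpace Circle := borel Circle

instance instBorelSpaceCircle : BorelSpace Circle := ⟨rfl⟩

/-- The chart `θ : 𝕊¹ → [0, 2π)` with `θ(1) = 0`. -/
def theta (p : Circle) : ℝ := toIcoMod Real.two_pi_pos 0 (Complex.arg (p : ℂ))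

/-- The arc length measure `dθ` on the circle, of total mass `2π`. -/
def dtheta : Measure Circle := (volume.restrict (Ico (0 : ℝ) (2 * π))).map Circle.exp

/-- The derivative `∂_θ f` of a real function on the circle. -/
def partialTheta (f : Circle → ℝ) (p : Circle) : ℝ :=
  deriv (fun t : ℝ => f (p * Circle.exp t)) 0

/-- The derivative `φ'` of a self-map of the circle, `φ^* dθ = φ' dθ`. At `z ∈ 𝕊¹ ⊆ ℂ` the form
`dθ` sends a tangent vector `v ∈ ℂ` to `Im (conj z * v)`. -/
def angDeriv (φ : Circle → Circle) (p : Circle) : ℝ :=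
  (conj (φ p : ℂ) * deriv (fun t : ℝ => ((φ (p * Circle.exp t) : Circle) : ℂ)) 0).im

/-- `Diff₊^k(𝕊¹)` for `k ≥ 1`: bijections of class `C^k` with inverse of class `C^k` that preserve
the orientation. -/
def DiffPlus (k : ℕ∞) : Set (Equiv.Perm Circle) :=
  {φ | ContMDiff (𝓡 1) (𝓡 1) k φ ∧ ContMDiff (𝓡 1) (𝓡 1) k φ.symm ∧ ∀ p, 0 < angDeriv φ p}

/-- The `C¹` topology on `Diff₊^1(𝕊¹)`: uniform convergence of `φ` and of `φ'`. -/
instance instTopologicalSpaceDiffPlusOne : TopologicalSpace (DiffPlus 1) :=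
  TopologicalSpace.induced
    (fun φ => ((UniformFun.ofFun (φ : Equiv.Perm Circle), UniformFun.ofFun (angDeriv φ.1)) :
      UniformFun Circle Circle × UniformFun Circle ℝ))
    inferInstance

/-- The set of balance points of `φ`. -/
def balancePoints (φ : Equiv.Perm Circle) : Set Circle := {p | φ (-p) = -φ p}

/-- The possibly infinite number `n_B(φ)` of balance points. -/
def nB (φ : Equiv.Perm Circle) : ℕ∞ := (balancePoints φ).encard

/-- The diffeomorphisms of class `C¹` with at least `N` balance points. -/
def BDiff (N : ℕ∞) : Set (DiffPlus 1) := {φ | N ≤ nB φ.1}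

/-- `v` is a weak derivative of `u` on the circle. -/
def IsWeakDeriv (u v : Circle → ℝ) : Prop :=
  ∀ ζ : Circle → ℝ, ContMDiff (𝓡 1) 𝓘(ℝ, ℝ) ∞ ζ →
    ∫ p, u p * partialTheta ζ p ∂dtheta = -∫ p, v p * ζ p ∂dtheta

/-- `u ∈ H¹(𝕊¹)`. -/
def MemH1 (u : Circle → ℝ) : Prop :=
  MemLp u 2 dtheta ∧ ∃ v, MemLp v 2 dtheta ∧ IsWeakDeriv u v

open Classical in
/-- The weak derivative in `L²` of a function in `H¹(𝕊¹)`, which is determined up to a null set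
(and `0` for functions that are not in `H¹(𝕊¹)`). -/
def weakDeriv (u : Circle → ℝ) : Circle → ℝ :=
  if h : MemH1 u then Classical.choose h.2 else 0

/-- `u = log φ'`. -/
def logAngDeriv (φ : Equiv.Perm Circle) (p : Circle) : ℝ := Real.log (angDeriv φ p)

/-- The diffeomorphisms of class `C¹` with `log φ' ∈ H¹(𝕊¹)` and `∫ e^{log φ'} dθ = 2π`. -/
def HDiff : Set (DiffPlus 1) :=
  {φ | MemH1 (logAngDeriv φ.1) ∧ ∫ p, Real.exp (logAngDeriv φ.1 p) ∂dtheta = 2 * π}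

/-- `E[u] = ∫ ¼ (u')² - e^{2u} dθ`. -/
def energy (u : Circle → ℝ) : ℝ :=
  ∫ p, ((1 / 4 : ℝ) * weakDeriv u p ^ 2 - Real.exp (2 * u p)) ∂dtheta

/-- `E_G^*[φ] = E[log φ'] + 2π`. -/
def EGstar (φ : Equiv.Perm Circle) : ℝ := energy (logAngDeriv φ) + 2 * π

/-- The linear action of a matrix `L` on `ℝ² = ℂ`. -/
def linAct (L : Matrix.SpecialLinearGroup (Fin 2) ℝ) (z : ℂ) : ℂ :=
  ⟨L 0 0 * z.re + L 0 1 * z.im, L 1 0 * z.re + L 1 1 * z.im⟩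

/-- The Möbius group of the circle: the maps `x ↦ L x / |L x|` with `L ∈ SL(2, ℝ)`. -/
def Mob : Set (Equiv.Perm Circle) :=
  {φ | ∃ L : Matrix.SpecialLinearGroup (Fin 2) ℝ,
    ∀ p : Circle, (φ p : ℂ) = linAct L p / (‖linAct L p‖ : ℂ)}

/-- The inverse `ℝ → (0, π)` of the cotangent. -/
def arccot (x : ℝ) : ℝ := π / 2 - Real.arctan x

/-- The map `ψ_τ`: it is given by `θ(ψ_τ(p)) = arccot (τ + cot (θ(p) - π/2)) + π/2` on the half
circle `π/2 < θ(p) < 3π/2`, and by the identity on the rest of the circle (the end points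
`θ(p) = π/2, 3π/2`, where the cotangent is infinite, are fixed). -/
def psi (τ : ℝ) (p : Circle) : Circle :=
  if theta p ∈ Ioo (π / 2) (3 * π / 2) then
    Circle.exp (arccot (τ + Real.cot (theta p - π / 2)) + π / 2)
  else p

end

end OvalsBL

open OvalsBL

namespace OvalsBL

open Filter Topology Asymptotics

/-! The proof is a calibration argument. Lift `φ` to `Φ : ℝ → ℝ` with `Φ' = e^u` and `u' = v ∈ L²`;
the quantity to bound is the integral of `¼ v² - e^{2u} + 1` over a period. Let `p`, `q` be balance
points of the lift, so that `Φ (p + π) = Φ p + π`, and likewise for `q`. A Möbius model with `p ↦ Φ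
p`, `q ↦ Φ q` satisfies `e^u = κ sin (Φ t - Φ p) sin (Φ t - Φ q) / (sin (t - p) sin (t - q))`, and
`w` (`calW`) is the logarithm of the ratio of the two sides. There is an explicit `T` (`calT`) for
which the density minus `T'` is `¼ (w')²` plus a term which is at least `e^w - 1 - w`. This is pure
algebra in the four cotangents (`calibration_ineq_simple`, `calibration_eq_double`).

`T` has poles at `p`, `q` and their antipodes. Since `v ∈ L²`, Cauchy-Schwarz gives `(u t - u p)² =
o(t - p)` (`HalfAt`), so that quadratic remainders `e^k - 1 - k` are `o(t - p)` and beat the simple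
pole: `T` has two-sided limits there. Summed over the arcs the boundary terms telescope, by
periodicity, to zero. Balance is what makes the same `T` and the same `κ` work at antipodal points.

There are two cases (`balance_of_mem_closure`). With two distinct pairs of balance points
(`energy_simple`), equality forces `w = 0` on four arcs; the limits match across the poles, so a
single relation `sin (Φ t - Φ p) sin (t - q) = l sin (Φ t - Φ q) sin (t - p)` holds on the whole
circle, and `φ` is Möbius. When pairs collapse in the limit, Rolle's theorem leaves one pair with
`φ'(-p) = φ'(p)`, and the calibration with `q = p` applies (`energy_double`). Now `w = 0` says that
`cot (Φ t - Φ p)` and `κ cot (t - p)` differ by a constant on each half circle, but these two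
constants need not agree: their difference is the parameter `τ` of the shear `psi τ`. If `u` is
differentiable at `p`, the constants agree and `φ` is Möbius. -/

/-! ### Absolutely continuous functions on the line -/

/-- Composing an absolutely continuous function with a Lipschitz function. -/
theorem absolutelyContinuousOnInterval_comp_of_dist_le {f g : ℝ → ℝ} {a b K : ℝ} (hK : 0 ≤ K)
    (hf : AbsolutelyContinuousOnInterval f a b)
    (h : ∀ x ∈ uIcc a b, ∀ y ∈ uIcc a b, dist (g x) (g y) ≤ K * dist (f x) (f y)) :
    AbsolutelyContinuousOnInterval g a b := by
  rw [absolutelyContinuousOnInterval_iff] at hf ⊢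
  intro ε hε
  -- Dividing by `K + 1` covers `K = 0`.
  obtain ⟨δ, hδ, H⟩ := hf (ε / (K + 1)) (by positivity)
  refine ⟨δ, hδ, fun E hE hlen => ?_⟩
  have h1 := H E hE hlen
  calc ∑ i ∈ Finset.range E.1, dist (g (E.2 i).1) (g (E.2 i).2)
      ≤ ∑ i ∈ Finset.range E.1, K * dist (f (E.2 i).1) (f (E.2 i).2) := by
        apply Finset.sum_le_sum
        intro i hi
        have := hE.1 i hi
        exact h _ this.1 _ this.2
    _ = K * ∑ i ∈ Finset.range E.1, dist (f (E.2 i).1) (f (E.2 i).2) := by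
        rw [Finset.mul_sum]
    _ ≤ K * (ε / (K + 1)) := by gcongr
    _ < (K + 1) * (ε / (K + 1)) := by gcongr; linarith
    _ = ε := by field_simp

/-- The exponential of an absolutely continuous function is absolutely continuous. -/
theorem absolutelyContinuousOnInterval_exp {f : ℝ → ℝ} {a b : ℝ}
    (hf : AbsolutelyContinuousOnInterval f a b) :
    AbsolutelyContinuousOnInterval (fun t => rexp (f t)) a b := by
  -- The exponential is only locally Lipschitz; a bound `M` for `f` makes it Lipschitz on the half
  -- line that matters.
  obtain ⟨M, hM⟩ := hf.exists_bound
  have hlip : LipschitzOnWith (Real.toNNReal (rexp M)) rexp (Iic M) := by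
    apply Convex.lipschitzOnWith_of_nnnorm_hasDerivWithin_le (convex_Iic M)
      (fun x _ => (Real.hasDerivAt_exp x).hasDerivWithinAt)
    intro x hx
    rw [← NNReal.coe_le_coe, coe_nnnorm, Real.norm_of_nonneg (exp_pos x).le,
      Real.coe_toNNReal _ (exp_pos M).le]
    exact exp_le_exp.2 hx
  refine absolutelyContinuousOnInterval_comp_of_dist_le (exp_pos M).le hf fun x hx y hy => ?_
  have h1 := hlip.dist_le_mul (f x) ((le_abs_self _).trans (hM x hx)) (f y)
    ((le_abs_self _).trans (hM y hy))
  rwa [Real.coe_toNNReal _ (exp_pos M).le] at h1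

/-- A function with continuous derivative on an interval is absolutely continuous there. -/
theorem absolutelyContinuousOnInterval_of_hasDerivAt {f f' : ℝ → ℝ} {a b : ℝ}
    (hf : ∀ t ∈ uIcc a b, HasDerivAt f (f' t) t) (hf' : ContinuousOn f' (uIcc a b)) :
    AbsolutelyContinuousOnInterval f a b := by
  obtain ⟨K, hK⟩ := isCompact_uIcc.exists_bound_of_continuousOn hf'
  have hlip : LipschitzOnWith (Real.toNNReal K) f (uIcc a b) := by
    apply Convex.lipschitzOnWith_of_nnnorm_hasDerivWithin_le (convex_uIcc a b)
      (fun x hx => (hf x hx).hasDerivWithinAt)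
    intro x hx
    rw [← NNReal.coe_le_coe, coe_nnnorm]
    exact (hK x hx).trans (Real.le_coe_toNNReal K)
  exact hlip.absolutelyContinuousOnInterval

/-! ### Lifts of circle diffeomorphisms -/

/-- `Φ` is a lift to the line of an orientation preserving diffeomorphism of the circle, with
`Φ' = e^u` and `u` an absolutely continuous function with square integrable derivative `v`. -/
structure CircleLift (Φ u v : ℝ → ℝ) : Prop where
  hasDerivAt : ∀ t, HasDerivAt Φ (rexp (u t)) t
  cont : Continuous u
  add_two_pi : ∀ t, Φ (t + 2 * π) = Φ t + 2 * π
  int : ∀ a b, IntervalIntegrable v volume a b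
  int_sq : ∀ a b, IntervalIntegrable (fun t => v t ^ 2) volume a b
  ftc : ∀ a b, ∫ t in a..b, v t = u b - u a
  per : Function.Periodic v (2 * π)

/-- The energy density `¼ (u')² - e^{2u} + 1`. -/
noncomputable def eDensity (u v : ℝ → ℝ) (t : ℝ) : ℝ := 1 / 4 * v t ^ 2 - rexp (2 * u t) + 1

namespace CircleLift

variable {Φ u v : ℝ → ℝ} (H : CircleLift Φ u v)

include H

theorem continuous : Continuous Φ :=
  continuous_iff_continuousAt.2 fun t => (H.hasDerivAt t).continuousAt

theorem strictMono : StrictMono Φ := by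
  apply strictMono_of_deriv_pos
  intro x
  rw [(H.hasDerivAt x).deriv]
  exact exp_pos _

theorem u_periodic : Function.Periodic u (2 * π) := by
  intro t
  have h1 : HasDerivAt (fun x => Φ (x + 2 * π)) (rexp (u (t + 2 * π))) t :=
    (H.hasDerivAt (t + 2 * π)).comp_add_const t (2 * π)
  have h2 : HasDerivAt (fun x => Φ (x + 2 * π)) (rexp (u t)) t := by
    simp_rw [H.add_two_pi]
    exact (H.hasDerivAt t).add_const _
  exact exp_injective (h1.unique h2)

theorem ae_hasDerivAt : ∀ᵐ t, HasDerivAt u (v t) t := by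
  have hl : LocallyIntegrable v volume := by
    intro x
    refine ⟨Ioo (x - 1) (x + 1), Ioo_mem_nhds (by linarith) (by linarith), ?_⟩
    have := (intervalIntegrable_iff_integrableOn_Ioo_of_le (by linarith)).1
      (H.int (x - 1) (x + 1))
    exact this
  filter_upwards [LocallyIntegrable.ae_hasDerivAt_integral hl] with t ht
  have h1 := (ht 0).add_const (u 0)
  have h2 : (fun x => (∫ y in (0 : ℝ)..x, v y) + u 0) = u := by
    funext x
    rw [H.ftc]; ring
  rwa [h2] at h1

/-- `u` has the same increments as the primitive of `v`. -/
theorem absCont (a b : ℝ) : AbsolutelyContinuousOnInterval u a b := by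
  have h1 := (H.int a b).absolutelyContinuousOnInterval_intervalIntegral (c := a) (by simp)
  refine absolutelyContinuousOnInterval_comp_of_dist_le zero_le_one h1 fun x _ y _ => ?_
  rw [H.ftc, H.ftc]
  simp [Real.dist_eq]

theorem eDensity_int (a b : ℝ) : IntervalIntegrable (eDensity u v) volume a b := by
  have h1 : Continuous fun t => -rexp (2 * u t) + 1 := by
    have := H.cont
    fun_prop
  have h2 := ((H.int_sq a b).const_mul (1 / 4)).add (h1.intervalIntegrable a b)
  refine h2.congr (fun t _ => ?_)
  simp only [eDensity]; ring

theorem eDensity_periodic : Function.Periodic (eDensity u v) (2 * π) := by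
  intro t
  simp only [eDensity, H.per t, H.u_periodic t]

/-- Integration of the derivative of `P e^u + Q u + S`. -/
theorem integral_combination {P Q S P' Q' S' : ℝ → ℝ} {a b : ℝ}
    (hP : ∀ t ∈ uIcc a b, HasDerivAt P (P' t) t) (hP' : ContinuousOn P' (uIcc a b))
    (hQ : ∀ t ∈ uIcc a b, HasDerivAt Q (Q' t) t) (hQ' : ContinuousOn Q' (uIcc a b))
    (hS : ∀ t ∈ uIcc a b, HasDerivAt S (S' t) t) (hS' : ContinuousOn S' (uIcc a b)) :
    let T' := fun t => P' t * rexp (u t) + P t * (rexp (u t) * v t) + (Q' t * u t + Q t * v t)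
      + S' t
    let T := fun t => P t * rexp (u t) + Q t * u t + S t
    IntervalIntegrable T' volume a b ∧ ∫ t in a..b, T' t = T b - T a := by
  intro T' T
  have hT : AbsolutelyContinuousOnInterval T a b :=
    (((absolutelyContinuousOnInterval_of_hasDerivAt hP hP').fun_mul
      (absolutelyContinuousOnInterval_exp (H.absCont a b))).fun_add
      ((absolutelyContinuousOnInterval_of_hasDerivAt hQ hQ').fun_mul (H.absCont a b))).fun_add
      (absolutelyContinuousOnInterval_of_hasDerivAt hS hS')
  have hae : ∀ᵐ t, t ∈ uIoc a b → deriv T t = T' t := by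
    filter_upwards [H.ae_hasDerivAt] with t ht hmem
    have hm := uIoc_subset_uIcc hmem
    exact ((((hP t hm).mul ht.exp).add ((hQ t hm).mul ht)).add (hS t hm)).deriv
  refine ⟨hT.intervalIntegrable_deriv.congr_ae ?_, ?_⟩
  · exact (ae_restrict_iff' measurableSet_uIoc).2 hae
  · rw [← hT.integral_deriv_eq_sub]
    exact (intervalIntegral.integral_congr_ae hae).symm

end CircleLift

/-! ### Calibrations on an open arc -/

/-- The derivative of `P e^u + Q u + S` along a lift. -/
noncomputable def dCombination (u v P Q P' Q' S' : ℝ → ℝ) (t : ℝ) : ℝ :=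
  P' t * rexp (u t) + P t * (rexp (u t) * v t) + (Q' t * u t + Q t * v t) + S' t

namespace CircleLift

variable {Φ u v : ℝ → ℝ} (H : CircleLift Φ u v)

include H

theorem continuous_primitive (a : ℝ) : Continuous fun x => ∫ t in a..x, eDensity u v t :=
  intervalIntegral.continuous_primitive H.eDensity_int a

/-- A calibration on an open arc: if the energy density dominates the derivative of
`T = P e^u + Q u + S`, with defect at least `e^w - 1 - w`, then the energy of the arc is at least
the difference of the limits of `T` at the end points, and equality forces `w = 0`. -/
theorem arc_le {P Q S P' Q' S' w : ℝ → ℝ} {p q A B : ℝ} (hpq : p < q)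
    (hP : ∀ t ∈ Ioo p q, HasDerivAt P (P' t) t) (hP' : ContinuousOn P' (Ioo p q))
    (hQ : ∀ t ∈ Ioo p q, HasDerivAt Q (Q' t) t) (hQ' : ContinuousOn Q' (Ioo p q))
    (hS : ∀ t ∈ Ioo p q, HasDerivAt S (S' t) t) (hS' : ContinuousOn S' (Ioo p q))
    (hw : ContinuousOn w (Ioo p q))
    (hge : ∀ t ∈ Ioo p q,
      dCombination u v P Q P' Q' S' t + (rexp (w t) - 1 - w t) ≤ eDensity u v t)
    (hA : Tendsto (fun t => P t * rexp (u t) + Q t * u t + S t) (𝓝[>] p) (𝓝 A))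
    (hB : Tendsto (fun t => P t * rexp (u t) + Q t * u t + S t) (𝓝[<] q) (𝓝 B)) :
    B - A ≤ ∫ t in p..q, eDensity u v t ∧
      (∫ t in p..q, eDensity u v t = B - A → ∀ t ∈ Ioo p q, w t = 0) := by
  set T : ℝ → ℝ := fun t => P t * rexp (u t) + Q t * u t + S t with hT
  set ρ : ℝ → ℝ := fun t => rexp (w t) - 1 - w t with hρ
  have hρ0 : ∀ t, 0 ≤ ρ t := fun t => by
    have := add_one_le_exp (w t)
    simp only [hρ]; linarith
  have hρc : ContinuousOn ρ (Ioo p q) := (hw.rexp.sub continuousOn_const).sub hw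
  have hsub : ∀ {x y}, p < x → x ≤ y → y < q → uIcc x y ⊆ Ioo p q := by
    intro x y hx hxy hy t ht
    rw [uIcc_of_le hxy] at ht
    exact ⟨hx.trans_le ht.1, ht.2.trans_lt hy⟩
  have hρi : ∀ {x y}, p < x → x ≤ y → y < q → IntervalIntegrable ρ volume x y :=
    fun hx hxy hy => (hρc.mono (hsub hx hxy hy)).intervalIntegrable
  have key : ∀ x y, p < x → x ≤ y → y < q →
      T y - T x + ∫ t in x..y, ρ t ≤ ∫ t in x..y, eDensity u v t := by
    intro x y hx hxy hy
    have hs := hsub hx hxy hy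
    obtain ⟨hi, he⟩ := H.integral_combination (fun t ht => hP t (hs ht)) (hP'.mono hs)
      (fun t ht => hQ t (hs ht)) (hQ'.mono hs) (fun t ht => hS t (hs ht)) (hS'.mono hs)
    rw [hT]
    simp only at he hi ⊢
    rw [← he, ← intervalIntegral.integral_add hi (hρi hx hxy hy)]
    refine intervalIntegral.integral_mono_on hxy (hi.add (hρi hx hxy hy)) (H.eDensity_int _ _)
      fun t ht => ?_
    exact hge t (hs (by rwa [uIcc_of_le hxy]))
  set F : ℝ → ℝ := fun x => ∫ t in p..x, eDensity u v t with hF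
  have hFc : Continuous F := H.continuous_primitive p
  have hFs : ∀ x y, F y - F x = ∫ t in x..y, eDensity u v t := fun x y =>
    intervalIntegral.integral_interval_sub_left (H.eDensity_int _ _) (H.eDensity_int _ _)
  -- The defect is kept on a fixed inner interval while the outer end points tend to `p` and `q`, so
  -- that the limit still controls it when equality holds.
  have key2 : ∀ x y, p < x → x ≤ y → y < q →
      B - A + ∫ t in x..y, ρ t ≤ ∫ t in p..q, eDensity u v t := by
    intro x y hx hxy hy
    have e1 : ∀ x' y', p < x' → x' < x → y < y' → y' < q →
        T y' - T x' + ∫ t in x..y, ρ t ≤ F y' - F x' := by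
      intro x' y' hx' hxx hyy hy'
      rw [hFs]
      refine le_trans ?_ (key x' y' hx' (by linarith) hy')
      gcongr
      apply intervalIntegral.integral_mono_interval hxx.le hxy hyy.le
      · exact Eventually.of_forall fun t => hρ0 t
      · exact hρi hx' (by linarith) hy'
    have e2 : ∀ x', p < x' → x' < x → B - T x' + ∫ t in x..y, ρ t ≤ F q - F x' := by
      intro x' hx' hxx
      refine le_of_tendsto_of_tendsto (b := 𝓝[<] q) ((hB.sub_const _).add_const _)
        (((hFc.tendsto q).mono_left nhdsWithin_le_nhds).sub_const _) ?_
      filter_upwards [Ioo_mem_nhdsLT hy] with y' hy'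
      exact e1 x' y' hx' hxx hy'.1 hy'.2
    have e3 : B - A + ∫ t in x..y, ρ t ≤ F q - F p := by
      refine le_of_tendsto_of_tendsto (b := 𝓝[>] p)
        ((tendsto_const_nhds.sub hA).add_const _)
        (tendsto_const_nhds.sub ((hFc.tendsto p).mono_left nhdsWithin_le_nhds)) ?_
      filter_upwards [Ioo_mem_nhdsGT hx] with x' hx'
      exact e2 x' hx'.1 hx'.2
    have : F p = 0 := intervalIntegral.integral_same
    simpa [this] using e3
  constructor
  -- On a degenerate inner interval the defect integral is zero.
  · have := key2 ((p + q) / 2) ((p + q) / 2) (by linarith) le_rfl (by linarith)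
    simpa using this
  · intro heq t ht
    obtain ⟨x, hx1, hx2⟩ := exists_between ht.1
    obtain ⟨y, hy1, hy2⟩ := exists_between ht.2
    have h1 := key2 x y hx1 (hx2.trans hy1).le hy2
    have hxy : x < y := hx2.trans hy1
    have h2 : ∫ t in x..y, ρ t = 0 :=
      le_antisymm (by linarith) (intervalIntegral.integral_nonneg hxy.le fun t _ => hρ0 t)
    by_contra hne
    have hpos : 0 < ρ t := by
      have := add_one_lt_exp hne
      simp only [hρ]; linarith
    have hsx := hsub hx1 hxy.le hy2
    rw [uIcc_of_le hxy.le] at hsx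
    have := intervalIntegral.integral_pos hxy (hρc.mono hsx) (fun t _ => hρ0 t)
      ⟨t, ⟨hx2.le, hy1.le⟩, hpos⟩
    linarith

/-- If the energy density is the derivative of `T = P e^u + Q u + S` on an open arc, then the energy
of the arc is the difference of the limits of `T`. -/
theorem arc_eq {P Q S P' Q' S' : ℝ → ℝ} {p q A B : ℝ} (hpq : p < q)
    (hP : ∀ t ∈ Ioo p q, HasDerivAt P (P' t) t) (hP' : ContinuousOn P' (Ioo p q))
    (hQ : ∀ t ∈ Ioo p q, HasDerivAt Q (Q' t) t) (hQ' : ContinuousOn Q' (Ioo p q))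
    (hS : ∀ t ∈ Ioo p q, HasDerivAt S (S' t) t) (hS' : ContinuousOn S' (Ioo p q))
    (hge : ∀ t ∈ Ioo p q, HasDerivAt u (v t) t →
      dCombination u v P Q P' Q' S' t = eDensity u v t)
    (hA : Tendsto (fun t => P t * rexp (u t) + Q t * u t + S t) (𝓝[>] p) (𝓝 A))
    (hB : Tendsto (fun t => P t * rexp (u t) + Q t * u t + S t) (𝓝[<] q) (𝓝 B)) :
    ∫ t in p..q, eDensity u v t = B - A := by
  set T : ℝ → ℝ := fun t => P t * rexp (u t) + Q t * u t + S t with hT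
  set F : ℝ → ℝ := fun x => ∫ t in p..x, eDensity u v t with hF
  have hFc : Continuous F := H.continuous_primitive p
  have hFs : ∀ x y, F y - F x = ∫ t in x..y, eDensity u v t := fun x y =>
    intervalIntegral.integral_interval_sub_left (H.eDensity_int _ _) (H.eDensity_int _ _)
  have key : ∀ x y, p < x → x ≤ y → y < q → T y - T x = F y - F x := by
    intro x y hx hxy hy
    have hs : uIcc x y ⊆ Ioo p q := by
      intro t ht
      rw [uIcc_of_le hxy] at ht
      exact ⟨hx.trans_le ht.1, ht.2.trans_lt hy⟩
    obtain ⟨hi, he⟩ := H.integral_combination (fun t ht => hP t (hs ht)) (hP'.mono hs)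
      (fun t ht => hQ t (hs ht)) (hQ'.mono hs) (fun t ht => hS t (hs ht)) (hS'.mono hs)
    rw [hT, hFs]
    simp only at he hi ⊢
    rw [← he]
    apply intervalIntegral.integral_congr_ae
    filter_upwards [H.ae_hasDerivAt] with t ht hmem
    exact hge t (hs (uIoc_subset_uIcc hmem)) ht
  have e2 : ∀ x, p < x → x < q → B - T x = F q - F x := by
    intro x hx hxq
    refine tendsto_nhds_unique_of_eventuallyEq (l := 𝓝[<] q) (hB.sub_const _)
      (((hFc.tendsto q).mono_left nhdsWithin_le_nhds).sub_const _) ?_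
    filter_upwards [Ioo_mem_nhdsLT hxq] with y hy
    exact key x y hx hy.1.le hy.2
  have e3 : B - A = F q - F p := by
    refine tendsto_nhds_unique_of_eventuallyEq (l := 𝓝[>] p)
      (tendsto_const_nhds.sub hA)
      (tendsto_const_nhds.sub ((hFc.tendsto p).mono_left nhdsWithin_le_nhds)) ?_
    filter_upwards [Ioo_mem_nhdsGT hpq] with x hx
    exact e2 x hx.1 hx.2
  have : F p = 0 := intervalIntegral.integral_same
  rw [e3, this, sub_zero]

end CircleLift

/-! ### Hölder type continuity at a point -/

/-- `k` tends to `L` at `p`, with `(k - L)² = o(t - p)`. -/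
def HalfAt (k : ℝ → ℝ) (L p : ℝ) : Prop :=
  (fun t => (k t - L) ^ 2) =o[𝓝[≠] p] fun t => t - p

namespace HalfAt

variable {k l : ℝ → ℝ} {L M p : ℝ}

theorem tendsto_sub_nhdsNE (p : ℝ) : Tendsto (fun t : ℝ => t - p) (𝓝[≠] p) (𝓝 0) := by
  have : Tendsto (fun t : ℝ => t - p) (𝓝 p) (𝓝 (p - p)) := by
    apply Continuous.tendsto; fun_prop
  rw [sub_self] at this
  exact this.mono_left nhdsWithin_le_nhds

theorem tendsto (h : HalfAt k L p) : Tendsto k (𝓝[≠] p) (𝓝 L) := by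
  have h1 := h.trans_tendsto (tendsto_sub_nhdsNE p)
  have h2 : Tendsto (fun t => √((k t - L) ^ 2)) (𝓝[≠] p) (𝓝 √0) :=
    (Real.continuous_sqrt.tendsto 0).comp h1
  simp only [Real.sqrt_sq_eq_abs, Real.sqrt_zero] at h2
  have h3 := (tendsto_zero_iff_abs_tendsto_zero _).2 h2
  simpa using h3.add_const L

theorem of_isBigO (h : HalfAt k L p) (hl : (fun t => l t - M) =O[𝓝[≠] p] fun t => k t - L) :
    HalfAt l M p :=
  (hl.pow 2).trans_isLittleO h

theorem congr (h : HalfAt k L p) (hkl : k =ᶠ[𝓝[≠] p] l) : HalfAt l L p :=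
  IsLittleO.congr' h (hkl.mono fun t ht => by simp only [ht]) EventuallyEq.rfl

theorem add (h : HalfAt k L p) (h' : HalfAt l M p) : HalfAt (fun t => k t + l t) (L + M) p := by
  have h1 := (IsLittleO.add h h').const_mul_left 2
  refine IsBigO.trans_isLittleO (IsBigO.of_bound 1 (Eventually.of_forall fun t => ?_)) h1
  rw [Real.norm_of_nonneg (sq_nonneg _), Real.norm_of_nonneg (by positivity)]
  nlinarith [sq_nonneg ((k t - L) - (l t - M))]

theorem comp (h : HalfAt k L p) {f : ℝ → ℝ} {f' : ℝ} (hf : HasDerivAt f f' L) :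
    HalfAt (fun t => f (k t)) (f L) p :=
  h.of_isBigO (hf.isBigO_sub.comp_tendsto h.tendsto)

theorem const_mul (h : HalfAt k L p) (c : ℝ) : HalfAt (fun t => c * k t) (c * L) p :=
  h.comp (f := fun x => c * x) (f' := c * 1) ((hasDerivAt_id L).const_mul c)

theorem sub (h : HalfAt k L p) (h' : HalfAt l M p) : HalfAt (fun t => k t - l t) (L - M) p := by
  have := h.add (h'.const_mul (-1))
  simpa [sub_eq_add_neg] using this

theorem of_hasDerivAt {f : ℝ → ℝ} {f' : ℝ} (hf : HasDerivAt f f' p) : HalfAt f (f p) p := by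
  have h1 : (fun t => f t - f p) =O[𝓝[≠] p] fun t => t - p :=
    hf.isBigO_sub.mono nhdsWithin_le_nhds
  refine (h1.pow 2).trans_isLittleO ?_
  have h2 : (fun t : ℝ => t - p) =o[𝓝[≠] p] fun _ => (1 : ℝ) :=
    (isLittleO_one_iff ℝ).2 (tendsto_sub_nhdsNE p)
  have h3 := h2.mul_isBigO (isBigO_refl (fun t : ℝ => t - p) (𝓝[≠] p))
  simpa [sq] using h3

/-- Split `k l - L M` as `(k - L) l + L (l - M)`, with `l` bounded near `p`. -/
theorem mul (h : HalfAt k L p) (h' : HalfAt l M p) : HalfAt (fun t => k t * l t) (L * M) p := by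
  have h1 : HalfAt (fun t => (k t - L) * l t) 0 p := by
    have hb : l =O[𝓝[≠] p] fun _ => (1 : ℝ) := h'.tendsto.isBigO_one ℝ
    have : HalfAt (fun t => k t - L) 0 p := by
      simpa [HalfAt] using h
    refine this.of_isBigO ?_
    simpa using (isBigO_refl (fun t => k t - L) (𝓝[≠] p)).mul hb
  have h2 := h1.add (h'.const_mul L)
  rw [zero_add] at h2
  refine h2.congr (Eventually.of_forall fun t => ?_)
  ring

/-- The quadratic remainder of the exponential. -/
theorem exp_remainder (h : HalfAt k 0 p) :
    (fun t => rexp (k t) - 1 - k t) =o[𝓝[≠] p] fun t => t - p := by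
  have h1 : (fun t => rexp (k t) - 1 - k t) =O[𝓝[≠] p] fun t => (k t - 0) ^ 2 := by
    refine IsBigO.of_bound 1 ?_
    have : ∀ᶠ t in 𝓝[≠] p, |k t| ≤ 1 := by
      have := (h.tendsto.abs).eventually (gt_mem_nhds (show |(0 : ℝ)| < 1 by simp))
      exact this.mono fun t ht => le_of_lt ht
    filter_upwards [this] with t ht
    rw [one_mul, sub_zero, Real.norm_eq_abs, norm_pow, Real.norm_eq_abs, sq_abs]
    exact Real.abs_exp_sub_one_sub_id_le ht
  exact h1.trans_isLittleO h

end HalfAt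

namespace CircleLift

variable {Φ u v : ℝ → ℝ} (H : CircleLift Φ u v)

include H

/-- Cauchy-Schwarz for the increment of `u`, obtained by expanding `∫ (v - m)² ≥ 0` with `m` the
mean slope. -/
theorem sq_sub_le (a b : ℝ) : (u b - u a) ^ 2 ≤ |b - a| * |∫ t in a..b, v t ^ 2| := by
  wlog hab : a ≤ b generalizing a b
  · have := this b a (le_of_not_ge hab)
    rw [intervalIntegral.integral_symm, abs_neg, abs_sub_comm]
    nlinarith
  rw [abs_of_nonneg (sub_nonneg.2 hab),
    abs_of_nonneg (intervalIntegral.integral_nonneg hab fun t _ => sq_nonneg _)]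
  rcases hab.eq_or_lt with rfl | hlt
  · simp
  set m := (u b - u a) / (b - a) with hm
  have hba : 0 < b - a := sub_pos.2 hlt
  have h1 : 0 ≤ ∫ t in a..b, (v t - m) ^ 2 :=
    intervalIntegral.integral_nonneg hab fun t _ => sq_nonneg _
  have h2 : ∫ t in a..b, (v t - m) ^ 2
      = (∫ t in a..b, v t ^ 2) - 2 * m * (u b - u a) + m ^ 2 * (b - a) := by
    have e : ∀ t, (v t - m) ^ 2 = v t ^ 2 - 2 * m * v t + m ^ 2 := fun t => by ring
    simp_rw [e]
    rw [intervalIntegral.integral_add ((H.int_sq a b).sub ((H.int a b).const_mul _))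
      (by simp), intervalIntegral.integral_sub (H.int_sq a b) ((H.int a b).const_mul _),
      intervalIntegral.integral_const_mul, H.ftc, intervalIntegral.integral_const, smul_eq_mul]
    ring
  have h3 : m * (b - a) = u b - u a := by rw [hm]; field_simp
  rw [h2] at h1
  have h4 : (∫ t in a..b, v t ^ 2) - m * (u b - u a) ≥ 0 := by
    have : m ^ 2 * (b - a) = m * (u b - u a) := by rw [sq, mul_assoc, h3]
    linarith
  calc (u b - u a) ^ 2 = (b - a) * (m * (u b - u a)) := by rw [← h3]; ring
    _ ≤ (b - a) * ∫ t in a..b, v t ^ 2 := by gcongr; linarith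

/-- The integral of `v²` over the interval from `p` to `t` tends to zero, which improves the Hölder
bound from `O` to `o`. The whole boundary analysis rests on this gain. -/
theorem halfAt_u (p : ℝ) : HalfAt u (u p) p := by
  have h1 : Tendsto (fun t => ∫ x in p..t, v x ^ 2) (𝓝[≠] p) (𝓝 0) := by
    have hc : Continuous fun t => ∫ x in p..t, v x ^ 2 :=
      intervalIntegral.continuous_primitive H.int_sq p
    have := hc.tendsto p
    rw [intervalIntegral.integral_same] at this
    exact this.mono_left nhdsWithin_le_nhds
  have h2 : (fun t => (t - p) * ∫ x in p..t, v x ^ 2) =o[𝓝[≠] p] fun t => t - p := by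
    have := (isBigO_refl (fun t : ℝ => t - p) (𝓝[≠] p)).mul_isLittleO
      ((isLittleO_one_iff ℝ).2 h1)
    simpa using this
  refine IsBigO.trans_isLittleO (IsBigO.of_bound 1 (Eventually.of_forall fun t => ?_)) h2
  rw [norm_mul, Real.norm_eq_abs, Real.norm_eq_abs, Real.norm_eq_abs, one_mul,
    abs_of_nonneg (sq_nonneg _)]
  exact H.sq_sub_le p t

/-- The quotient `sin (Φ t - Φ p) / sin (t - p)` near `p`. -/
theorem halfAt_sin_div_sin (p : ℝ) :
    HalfAt (fun t => sin (Φ t - Φ p) / sin (t - p)) (rexp (u p)) p := by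
  -- By Cauchy's mean value theorem the quotient at `t` equals this ratio of derivatives at some `ξ`
  -- between `p` and `t`. The `o(ξ - p)` estimate for `k` therefore passes to the quotient.
  set k : ℝ → ℝ := fun t => cos (Φ t - Φ p) / cos (t - p) * rexp (u t) with hk
  have hkh : HalfAt k (rexp (u p)) p := by
    have h1 : HasDerivAt (fun t => cos (Φ t - Φ p) / cos (t - p)) _ p :=
      ((H.hasDerivAt p).sub_const (Φ p)).cos.div (((hasDerivAt_id p).sub_const p).cos) (by simp)
    have h2 := (HalfAt.of_hasDerivAt h1).mul ((H.halfAt_u p).comp (Real.hasDerivAt_exp _))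
    simpa using h2
  have hcos : ∀ᶠ t in 𝓝 p, |t - p| < 1 := by
    have : Tendsto (fun t => |t - p|) (𝓝 p) (𝓝 |p - p|) := by
      apply Continuous.tendsto; fun_prop
    exact this.eventually (gt_mem_nhds (by simp))
  have hpi := Real.pi_gt_three
  have hξ : ∀ t, ∃ ξ, t ≠ p → |t - p| < 1 →
      (ξ ≠ p ∧ |ξ - p| ≤ |t - p| ∧ sin (Φ t - Φ p) / sin (t - p) = k ξ) := by
    intro t
    by_cases h : t ≠ p ∧ |t - p| < 1
    · obtain ⟨h1, h2⟩ := h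
      have hs : ∀ x, |x - p| < 1 → 0 < cos (x - p) := fun x hx => by
        rw [abs_lt] at hx
        exact cos_pos_of_mem_Ioo ⟨by linarith, by linarith⟩
      have hf : ∀ x, HasDerivAt (fun x => sin (Φ x - Φ p)) (cos (Φ x - Φ p) * rexp (u x)) x :=
        fun x => ((H.hasDerivAt x).sub_const (Φ p)).sin
      have hg : ∀ x, HasDerivAt (fun x => sin (x - p)) (cos (x - p) * 1) x :=
        fun x => ((hasDerivAt_id x).sub_const p).sin
      have hsin : sin (t - p) ≠ 0 := by
        rw [abs_lt] at h2
        rcases lt_or_gt_of_ne h1 with h | h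
        · exact (sin_neg_of_neg_of_neg_pi_lt (by linarith) (by linarith)).ne
        · exact (sin_pos_of_pos_of_lt_pi (by linarith) (by linarith)).ne'
      have key : ∃ ξ, ξ ≠ p ∧ |ξ - p| ≤ |t - p| ∧
          sin (t - p) * (cos (Φ ξ - Φ p) * rexp (u ξ)) =
            sin (Φ t - Φ p) * (cos (ξ - p) * 1) := by
        rcases lt_or_gt_of_ne h1 with h | h
        · obtain ⟨ξ, hξ, e⟩ := exists_ratio_hasDerivAt_eq_ratio_slope _ _ h
            (fun x _ => (hf x).continuousAt.continuousWithinAt) (fun x _ => hf x) _ _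
            (fun x _ => (hg x).continuousAt.continuousWithinAt) (fun x _ => hg x)
          refine ⟨ξ, hξ.2.ne, ?_, ?_⟩
          · rw [abs_of_neg (by linarith [hξ.2]), abs_of_neg (by linarith)]
            linarith [hξ.1]
          · simp only [sub_self, sin_zero, zero_sub] at e
            linarith
        · obtain ⟨ξ, hξ, e⟩ := exists_ratio_hasDerivAt_eq_ratio_slope _ _ h
            (fun x _ => (hf x).continuousAt.continuousWithinAt) (fun x _ => hf x) _ _
            (fun x _ => (hg x).continuousAt.continuousWithinAt) (fun x _ => hg x)
          refine ⟨ξ, hξ.1.ne', ?_, ?_⟩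
          · rw [abs_of_pos (by linarith [hξ.1]), abs_of_pos (by linarith)]
            linarith [hξ.2]
          · simp only [sub_self, sin_zero, sub_zero] at e
            linarith
      obtain ⟨ξ, e1, e2, e3⟩ := key
      refine ⟨ξ, fun _ _ => ⟨e1, e2, ?_⟩⟩
      have := (hs ξ (e2.trans_lt h2)).ne'
      simp only [hk]
      field_simp
      linarith
    · exact ⟨p, fun a b => absurd ⟨a, b⟩ h⟩
  choose ξ hξ using hξ
  have hev : ∀ᶠ t in 𝓝[≠] p, t ≠ p ∧ |t - p| < 1 :=
    eventually_mem_nhdsWithin.and (hcos.filter_mono nhdsWithin_le_nhds)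
  have hO : (fun t => ξ t - p) =O[𝓝[≠] p] fun t => t - p := by
    refine IsBigO.of_bound 1 (hev.mono fun t ht => ?_)
    rw [one_mul]
    exact (hξ t ht.1 ht.2).2.1
  have hT : Tendsto ξ (𝓝[≠] p) (𝓝[≠] p) := by
    refine tendsto_nhdsWithin_iff.2 ⟨?_, hev.mono fun t ht => (hξ t ht.1 ht.2).1⟩
    have := hO.trans_tendsto (HalfAt.tendsto_sub_nhdsNE p)
    simpa using this.add_const p
  have h1 := (IsLittleO.comp_tendsto hkh hT).trans_isBigO hO
  refine IsLittleO.congr' h1 (hev.mono fun t ht => ?_) EventuallyEq.rfl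
  simp only [Function.comp, (hξ t ht.1 ht.2).2.2]

end CircleLift

/-! ### The calibration and its boundary values -/

/-- The logarithm of the ratio between `e^u` and the derivative of a Möbius model which maps `p`, `q`
to `Φ p`, `Φ q`. -/
noncomputable def calW (Φ u : ℝ → ℝ) (p q κ t : ℝ) : ℝ :=
  u t - log κ - log (sin (Φ t - Φ p)) - log (sin (Φ t - Φ q)) + log (sin (t - p))
    + log (sin (t - q))

/-- The calibrating function, with a free summand `L`. -/
noncomputable def calT (Φ u L : ℝ → ℝ) (p q κ t : ℝ) : ℝ :=
  1 / 2 * ((cos (Φ t - Φ p) / sin (Φ t - Φ p) + cos (Φ t - Φ q) / sin (Φ t - Φ q)) * rexp (u t)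
    - (cos (t - p) / sin (t - p) + cos (t - q) / sin (t - q)) * (1 + calW Φ u p q κ t)) + L t

/-- The summand of the calibrating function for two distinct base points. -/
noncomputable def calLog (Φ : ℝ → ℝ) (p q m t : ℝ) : ℝ :=
  m * (log (sin (Φ t - Φ p)) - log (sin (Φ t - Φ q)) - (log (sin (t - p)) - log (sin (t - q))))

/-- The summand of the calibrating function for a double base point. -/
noncomputable def calCot (Φ : ℝ → ℝ) (p κ t : ℝ) : ℝ :=
  cos (Φ t - Φ p) / sin (Φ t - Φ p) / κ - cos (t - p) / sin (t - p)

theorem tendsto_div_sin (p : ℝ) :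
    Tendsto (fun t : ℝ => (t - p) / sin (t - p)) (𝓝[≠] p) (𝓝 1) := by
  have h1 : HasDerivAt (fun t : ℝ => sin (t - p)) (cos (p - p) * 1) p :=
    ((hasDerivAt_id p).sub_const p).sin
  have h2 := h1.tendsto_slope.inv₀ (by simp)
  simp only [sub_self, cos_zero, mul_one, inv_one] at h2
  refine h2.congr fun t => ?_
  simp [slope_def_field]

theorem tendsto_sub_div {f g : ℝ → ℝ} {f' g' p : ℝ} (hf : HasDerivAt f f' p)
    (hg : HasDerivAt g g' p) (h : f p = g p) :
    Tendsto (fun t : ℝ => (f t - g t) / (t - p)) (𝓝[≠] p) (𝓝 (f' - g')) := by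
  refine (hf.sub hg).tendsto_slope.congr fun t => ?_
  rw [slope_def_field]
  simp [h]

theorem sin_ne_zero_of_div_pos {a b : ℝ} (h : 0 < sin a / sin b) :
    sin a ≠ 0 ∧ sin b ≠ 0 := by
  constructor <;> intro h0 <;> simp [h0] at h

theorem hasDerivAt_sin_id_sub (p q : ℝ) :
    HasDerivAt (fun t : ℝ => sin (t - q)) (cos (p - q)) p := by
  simpa using ((hasDerivAt_id p).sub_const q).sin

theorem hasDerivAt_cos_id_sub (p q : ℝ) :
    HasDerivAt (fun t : ℝ => cos (t - q)) (-sin (p - q)) p := by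
  simpa using ((hasDerivAt_id p).sub_const q).cos

namespace CircleLift

variable {Φ u v : ℝ → ℝ} (H : CircleLift Φ u v)

include H

theorem eventually_sin_div_sin_pos (p : ℝ) :
    ∀ᶠ t in 𝓝[≠] p, 0 < sin (Φ t - Φ p) / sin (t - p) :=
  (H.halfAt_sin_div_sin p).tendsto.eventually (lt_mem_nhds (exp_pos _))

/-- The logarithms stay separate because this is how they enter `calW`. Since `Real.log` ignores
signs, the formula holds on both sides of `p`. -/
theorem halfAt_log_sin_div_sin (p : ℝ) :
    HalfAt (fun t => log (sin (Φ t - Φ p)) - log (sin (t - p)) - u p) 0 p := by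
  have h1 := (H.halfAt_sin_div_sin p).comp (Real.hasDerivAt_log (exp_pos (u p)).ne')
  have h2 := h1.sub (HalfAt.of_hasDerivAt (hasDerivAt_const p (u p)))
  simp only [Real.log_exp, sub_self] at h2
  refine h2.congr ?_
  filter_upwards [H.eventually_sin_div_sin_pos p] with t ht
  obtain ⟨h3, h4⟩ := sin_ne_zero_of_div_pos ht
  rw [Real.log_div h3 h4]

theorem hasDerivAt_cos_sub (p q : ℝ) :
    HasDerivAt (fun t => cos (Φ t - Φ q)) (-sin (Φ p - Φ q) * rexp (u p)) p :=
  ((H.hasDerivAt p).sub_const (Φ q)).cos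

theorem hasDerivAt_sin_sub (p q : ℝ) :
    HasDerivAt (fun t => sin (Φ t - Φ q)) (cos (Φ p - Φ q) * rexp (u p)) p :=
  ((H.hasDerivAt p).sub_const (Φ q)).sin

/-- With `κ = e^{-u p}` both `w` and `y` tend to `0`. Over the common denominator `sin (t - p)`, the
function becomes `cos (Φ t - Φ p) (e^{w+y} + e^{-y}) - cos (t - p) (2 + w)`. The term `calCot`
supplies `e^{-y}`, whose linear part cancels the `y` in `e^{w+y}`; what remains is two quadratic
remainders, which are `o(t - p)`, and a difference of cosines with zero derivative at `p`. -/
theorem tendsto_calT_double (p : ℝ) :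
    Tendsto (calT Φ u (calCot Φ p (rexp (-u p))) p p (rexp (-u p))) (𝓝[≠] p) (𝓝 0) := by
  set y : ℝ → ℝ := fun t => log (sin (Φ t - Φ p)) - log (sin (t - p)) - u p with hy
  set w := calW Φ u p p (rexp (-u p)) with hw
  have hyh : HalfAt y 0 p := H.halfAt_log_sin_div_sin p
  have hwh : HalfAt w 0 p := by
    have h1 := ((H.halfAt_u p).sub (HalfAt.of_hasDerivAt (hasDerivAt_const p (u p)))).sub
      (hyh.const_mul 2)
    simp only [sub_self, mul_zero] at h1
    refine h1.congr (Eventually.of_forall fun t => ?_)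
    simp only [hw, hy, calW, Real.log_exp]; ring
  have hwy := (hwh.add hyh)
  rw [add_zero] at hwy
  have hym := hyh.const_mul (-1)
  rw [mul_zero] at hym
  have l1 := hwy.exp_remainder.tendsto_div_nhds_zero
  have l2 := hym.exp_remainder.tendsto_div_nhds_zero
  have l3 := tendsto_sub_div (H.hasDerivAt_cos_sub p p) (hasDerivAt_cos_id_sub p p) (by simp)
  have l4 : Tendsto (fun t => cos (Φ t - Φ p)) (𝓝[≠] p) (𝓝 (cos (Φ p - Φ p))) :=
    (H.hasDerivAt_cos_sub p p).continuousAt.tendsto.mono_left nhdsWithin_le_nhds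
  have l5 := (tendsto_div_sin p).mul ((l4.mul (l1.add l2)).add (l3.mul (hwh.tendsto.const_add 2)))
  simp only [sub_self, sin_zero, neg_zero, zero_mul, add_zero, mul_zero] at l5
  refine l5.congr' ?_
  filter_upwards [H.eventually_sin_div_sin_pos p, self_mem_nhdsWithin] with t ht htp
  obtain ⟨h3, h4⟩ := sin_ne_zero_of_div_pos ht
  have htp : t - p ≠ 0 := sub_ne_zero.2 htp
  have ey : rexp (y t) = sin (Φ t - Φ p) / sin (t - p) / rexp (u p) := by
    rw [hy, Real.exp_sub, ← Real.log_div h3 h4, Real.exp_log ht]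
  have ewy : rexp (w t + y t) = rexp (u t) * sin (t - p) / sin (Φ t - Φ p) := by
    have : w t + y t = u t - (log (sin (Φ t - Φ p)) - log (sin (t - p))) := by
      simp only [hw, hy, calW, Real.log_exp]; ring
    rw [this, Real.exp_sub, ← Real.log_div h3 h4, Real.exp_log ht]
    field_simp
  have eym : rexp (-1 * y t) = sin (t - p) / sin (Φ t - Φ p) * rexp (u p) := by
    rw [neg_one_mul, Real.exp_neg, ey]
    field_simp
  rw [ewy, eym]
  simp only [calT, calCot, ← hw]
  rw [Real.exp_neg]
  field_simp
  ring

/-- The condition on `κ` is exactly `w → 0` at `p`. The singular part is `(Y cos (Φ t - Φ p) e^w -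
cos (t - p) (1 + w)) / sin (t - p)` with `Y p = 1`: the remainder `e^w - 1 - w` is `o(t - p)`, and
the rest is a difference quotient. The other summands are regular at `p`. Only the existence of a
two-sided limit is needed, because the limits telescope. -/
theorem tendsto_calT_simple {p q κ : ℝ} (m : ℝ) (hκ : 0 < κ) (hpq : sin (p - q) ≠ 0)
    (hκpq : κ * (sin (Φ p - Φ q) / sin (p - q)) = 1) :
    ∃ L, Tendsto (calT Φ u (calLog Φ p q m) p q κ) (𝓝[≠] p) (𝓝 L) := by
  set w := calW Φ u p q κ with hw
  set Y : ℝ → ℝ := fun t => κ * (sin (Φ t - Φ q) / sin (t - q)) with hY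
  have hYd : HasDerivAt Y _ p :=
    ((H.hasDerivAt_sin_sub p q).div (hasDerivAt_sin_id_sub p q) hpq).const_mul κ
  have hYp : Y p = 1 := hκpq
  have hYpos : ∀ᶠ t in 𝓝[≠] p, 0 < Y t :=
    (hYd.continuousAt.tendsto.mono_left nhdsWithin_le_nhds).eventually
      (lt_mem_nhds (by rw [hYp]; exact one_pos))
  have hΦq : sin (Φ p - Φ q) ≠ 0 := by
    intro h0
    rw [h0] at hκpq
    simp at hκpq
  have hYne : ∀ t, 0 < Y t → sin (Φ t - Φ q) ≠ 0 ∧ sin (t - q) ≠ 0 := by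
    intro t ht
    constructor <;> intro h0 <;> simp [hY, h0] at ht
  have hlogY : HalfAt (fun t => log (Y t)) 0 p := by
    have := HalfAt.of_hasDerivAt (hYd.log (by rw [hYp]; exact one_ne_zero))
    rwa [hYp, Real.log_one] at this
  have hlog : ∀ t, 0 < Y t →
      log (Y t) = log κ + (log (sin (Φ t - Φ q)) - log (sin (t - q))) := by
    intro t ht
    obtain ⟨h1, h2⟩ := hYne t ht
    rw [hY, Real.log_mul hκ.ne' (div_ne_zero h1 h2), Real.log_div h1 h2]
  have hyh := H.halfAt_log_sin_div_sin p
  have hwh : HalfAt w 0 p := by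
    have h1 := (((H.halfAt_u p).sub (HalfAt.of_hasDerivAt (hasDerivAt_const p (u p)))).sub
      hyh).sub hlogY
    simp only [sub_self] at h1
    refine h1.congr (hYpos.mono fun t ht => ?_)
    simp only [hw, calW, hlog t ht]; ring
  have hZd : HasDerivAt (fun t => Y t * cos (Φ t - Φ p)) _ p := hYd.mul (H.hasDerivAt_cos_sub p p)
  have l1 := hwh.exp_remainder.tendsto_div_nhds_zero
  have l3 := tendsto_sub_div hZd (hasDerivAt_cos_id_sub p p) (by simp [hYp])
  have l4 := hZd.continuousAt.tendsto.mono_left (nhdsWithin_le_nhds (s := {p}ᶜ))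
  have l5 := (tendsto_div_sin p).mul ((l4.mul l1).add (l3.mul (hwh.tendsto.const_add 1)))
  have l6 : Tendsto (fun t => cos (Φ t - Φ q) / sin (Φ t - Φ q) * rexp (u t)) (𝓝[≠] p) _ :=
    (((H.hasDerivAt_cos_sub p q).continuousAt.div (H.hasDerivAt_sin_sub p q).continuousAt
      hΦq).mul (H.cont.continuousAt.rexp)).tendsto.mono_left nhdsWithin_le_nhds
  have l7 : Tendsto (fun t => cos (t - q) / sin (t - q)) (𝓝[≠] p) _ :=
    ((hasDerivAt_cos_id_sub p q).continuousAt.div (hasDerivAt_sin_id_sub p q).continuousAt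
      hpq).tendsto.mono_left nhdsWithin_le_nhds
  have l8 := l6.sub (l7.mul (hwh.tendsto.const_add 1))
  have l9 := ((hyh.tendsto.sub hlogY.tendsto).add_const (u p + log κ)).const_mul m
  refine ⟨_, (((l5.add l8).const_mul (1 / 2)).add l9).congr' ?_⟩
  filter_upwards [H.eventually_sin_div_sin_pos p, hYpos, self_mem_nhdsWithin] with t ht hYt htp
  obtain ⟨h3, h4⟩ := sin_ne_zero_of_div_pos ht
  obtain ⟨h5, h6⟩ := hYne t hYt
  have htp : t - p ≠ 0 := sub_ne_zero.2 htp
  have ew : Y t * rexp (w t) = rexp (u t) * sin (t - p) / sin (Φ t - Φ p) := by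
    have : w t = u t - (log (sin (Φ t - Φ p)) - log (sin (t - p))) - log (Y t) := by
      simp only [hw, calW, hlog t hYt]; ring
    rw [this, Real.exp_sub, Real.exp_sub, ← Real.log_div h3 h4, Real.exp_log ht, Real.exp_log hYt]
    field_simp
  have e1 : (t - p) / sin (t - p) * (Y t * cos (Φ t - Φ p) * ((rexp (w t) - 1 - w t) / (t - p))
      + (Y t * cos (Φ t - Φ p) - cos (t - p)) / (t - p) * (1 + w t))
      = (cos (Φ t - Φ p) * (Y t * rexp (w t)) - cos (t - p) * (1 + w t)) / sin (t - p) := by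
    field_simp
    ring
  rw [e1, ew, hlog t hYt]
  simp only [calT, calLog, ← hw]
  field_simp
  ring

end CircleLift

/-! ### The pointwise calibration inequalities -/

/-- Here `c`, `d` are the cotangents in the target, `C`, `D` those in the source, and `E = e^u`. The
expression `v - (c + d) E + (C + D)` is `w'`; the difference of the two sides is `¼ (w')²` plus
nonnegative multiples of `(e^w - 1)²` and of `e^w - 1 - w`. -/
theorem calibration_ineq_simple {c d C D E w v m : ℝ} (hG : (c - d) * E = (C - D) * rexp w)
    (hm : 1 + C * D = -(C - D) * m) :
    1 / 2 * (-(1 + c ^ 2) + -(1 + d ^ 2)) * E * E + 1 / 2 * (c + d) * (E * v)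
      + (1 / 2 * ((1 + C ^ 2) + (1 + D ^ 2)) * (1 + w) - 1 / 2 * (C + D) * v
      - 1 / 2 * (C + D) * (-(c + d) * E + (C + D))) + m * ((c - d) * E - (C - D))
      + (rexp w - 1 - w) ≤ 1 / 4 * v ^ 2 - E ^ 2 + 1 := by
  have h1 : 0 ≤ rexp w - 1 - w := by linarith [add_one_le_exp w]
  set W := rexp w
  set G := C - D with hGdef
  have key : (1 / 4 * v ^ 2 - E ^ 2 + 1) - (1 / 2 * (-(1 + c ^ 2) + -(1 + d ^ 2)) * E * E
      + 1 / 2 * (c + d) * (E * v)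
      + (1 / 2 * ((1 + C ^ 2) + (1 + D ^ 2)) * (1 + w) - 1 / 2 * (C + D) * v
      - 1 / 2 * (C + D) * (-(c + d) * E + (C + D))) + m * ((c - d) * E - (C - D))
      + (W - 1 - w)) = 1 / 4 * (v - (c + d) * E + (C + D)) ^ 2
      + (1 / 4 * G ^ 2 * (W - 1) ^ 2 + (1 / 4 * G ^ 2 - 1 - G * m) * (W - 1 - w)
        + 1 / 4 * G ^ 2 * (W - 1 - w)) := by
    have e : ((c - d) * E) ^ 2 = (G * W) ^ 2 := by rw [hG]
    rw [hG]
    linear_combination 1 / 4 * e - hm * w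
  -- By `hm` this quantity is `¼ (C + D)²`; the value of `m` is chosen for this.
  have h2 : 0 ≤ 1 / 4 * G ^ 2 - 1 - G * m := by
    nlinarith [sq_nonneg (C + D)]
  have : 0 ≤ 1 / 4 * (v - (c + d) * E + (C + D)) ^ 2
      + (1 / 4 * G ^ 2 * (W - 1) ^ 2 + (1 / 4 * G ^ 2 - 1 - G * m) * (W - 1 - w)
        + 1 / 4 * G ^ 2 * (W - 1 - w)) := by positivity
  linarith

/-- The confluent case `q = p`, where the difference of cotangents is replaced by the derivative `1
+ cot²`. It is an identity, so `w = 0` is also sufficient for sharpness once `w' = 0`; `k` stands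
for `κ⁻¹`. -/
theorem calibration_eq_double {c C E w v k : ℝ} (hG : (1 + c ^ 2) * E * k = (1 + C ^ 2) * rexp w) :
    1 / 4 * v ^ 2 - E ^ 2 + 1 - (1 / 2 * (-(1 + c ^ 2) + -(1 + c ^ 2)) * E * E
      + 1 / 2 * (c + c) * (E * v)
      + (1 / 2 * ((1 + C ^ 2) + (1 + C ^ 2)) * (1 + w) - 1 / 2 * (C + C) * v
      - 1 / 2 * (C + C) * (-(c + c) * E + (C + C))) + (-(1 + c ^ 2) * E * k + (1 + C ^ 2)))
      = 1 / 4 * (v - (2 * c * E - 2 * C)) ^ 2 + (1 + C ^ 2) * (rexp w - 1 - w) := by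
  linear_combination hG

theorem hasDerivAt_cot_sub {t q : ℝ} (h : sin (t - q) ≠ 0) :
    HasDerivAt (fun t : ℝ => cos (t - q) / sin (t - q))
      (-(1 + (cos (t - q) / sin (t - q)) ^ 2)) t := by
  convert! (hasDerivAt_cos_id_sub t q).div (hasDerivAt_sin_id_sub t q) h using 1
  field_simp
  ring

theorem hasDerivAt_log_sin_sub {t q : ℝ} (h : sin (t - q) ≠ 0) :
    HasDerivAt (fun t : ℝ => log (sin (t - q))) (cos (t - q) / sin (t - q)) t :=
  (hasDerivAt_sin_id_sub t q).log h

/-- The derivative of the calibrating function along a lift. -/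
noncomputable def dCalT (Φ u v L' : ℝ → ℝ) (p q κ t : ℝ) : ℝ :=
  1 / 2 * (-(1 + (cos (Φ t - Φ p) / sin (Φ t - Φ p)) ^ 2)
      + -(1 + (cos (Φ t - Φ q) / sin (Φ t - Φ q)) ^ 2)) * rexp (u t) * rexp (u t)
    + 1 / 2 * (cos (Φ t - Φ p) / sin (Φ t - Φ p) + cos (Φ t - Φ q) / sin (Φ t - Φ q))
      * (rexp (u t) * v t)
    + (1 / 2 * ((1 + (cos (t - p) / sin (t - p)) ^ 2) + (1 + (cos (t - q) / sin (t - q)) ^ 2))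
        * (1 + calW Φ u p q κ t)
      - 1 / 2 * (cos (t - p) / sin (t - p) + cos (t - q) / sin (t - q)) * v t
      - 1 / 2 * (cos (t - p) / sin (t - p) + cos (t - q) / sin (t - q))
        * (-(cos (Φ t - Φ p) / sin (Φ t - Φ p) + cos (Φ t - Φ q) / sin (Φ t - Φ q)) * rexp (u t)
          + (cos (t - p) / sin (t - p) + cos (t - q) / sin (t - q)))) + L' t

/-! ### The calibrating function along a lift -/

namespace CircleLift

variable {Φ u v : ℝ → ℝ} (H : CircleLift Φ u v)

include H

theorem hasDerivAt_cot_comp {t q : ℝ} (h : sin (Φ t - Φ q) ≠ 0) :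
    HasDerivAt (fun t : ℝ => cos (Φ t - Φ q) / sin (Φ t - Φ q))
      (-(1 + (cos (Φ t - Φ q) / sin (Φ t - Φ q)) ^ 2) * rexp (u t)) t := by
  convert! (H.hasDerivAt_cos_sub t q).div (H.hasDerivAt_sin_sub t q) h using 1
  field_simp
  ring

theorem hasDerivAt_log_sin_comp {t q : ℝ} (h : sin (Φ t - Φ q) ≠ 0) :
    HasDerivAt (fun t : ℝ => log (sin (Φ t - Φ q)))
      (cos (Φ t - Φ q) / sin (Φ t - Φ q) * rexp (u t)) t := by
  convert! (H.hasDerivAt_sin_sub t q).log h using 1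
  ring

-- The sines may be negative on some arcs. Since `Real.log` is the logarithm of the absolute value,
-- only the quotients in `hp` and `hq` need to be positive.
omit H in
theorem exp_calW {p q κ t : ℝ} (hκ : 0 < κ) (hp : 0 < sin (Φ t - Φ p) / sin (t - p))
    (hq : 0 < sin (Φ t - Φ q) / sin (t - q)) :
    rexp (calW Φ u p q κ t) = rexp (u t) / κ / (sin (Φ t - Φ p) / sin (t - p))
      / (sin (Φ t - Φ q) / sin (t - q)) := by
  obtain ⟨h1, h2⟩ := sin_ne_zero_of_div_pos hp
  obtain ⟨h3, h4⟩ := sin_ne_zero_of_div_pos hq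
  have : calW Φ u p q κ t = u t - log κ - (log (sin (Φ t - Φ p)) - log (sin (t - p)))
      - (log (sin (Φ t - Φ q)) - log (sin (t - q))) := by
    simp only [calW]; ring
  rw [this, ← Real.log_div h1 h2, ← Real.log_div h3 h4, Real.exp_sub, Real.exp_sub, Real.exp_sub,
    Real.exp_log hκ, Real.exp_log hp, Real.exp_log hq]

section arcs

variable {p q κ a b A B : ℝ} {L L' : ℝ → ℝ} (hab : a < b)
    (hp : ∀ t ∈ Ioo a b, sin (Φ t - Φ p) ≠ 0 ∧ sin (t - p) ≠ 0)
    (hq : ∀ t ∈ Ioo a b, sin (Φ t - Φ q) ≠ 0 ∧ sin (t - q) ≠ 0)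
    (hL : ∀ t ∈ Ioo a b, HasDerivAt L (L' t) t) (hL' : ContinuousOn L' (Ioo a b))
    (hA : Tendsto (calT Φ u L p q κ) (𝓝[>] a) (𝓝 A))
    (hB : Tendsto (calT Φ u L p q κ) (𝓝[<] b) (𝓝 B))

include hp hL hL' hq

/-- The calibrating function in the form `P e^u + Q u + S`. -/
theorem exists_combination :
    ∃ P Q S P' Q' S' : ℝ → ℝ,
      (∀ t ∈ Ioo a b, HasDerivAt P (P' t) t) ∧ ContinuousOn P' (Ioo a b) ∧
      (∀ t ∈ Ioo a b, HasDerivAt Q (Q' t) t) ∧ ContinuousOn Q' (Ioo a b) ∧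
      (∀ t ∈ Ioo a b, HasDerivAt S (S' t) t) ∧ ContinuousOn S' (Ioo a b) ∧
      (∀ t, dCombination u v P Q P' Q' S' t = dCalT Φ u v L' p q κ t) ∧
      (fun t => P t * rexp (u t) + Q t * u t + S t) = calT Φ u L p q κ := by
  have c1 : ContinuousOn (fun t => cos (Φ t - Φ p) / sin (Φ t - Φ p)) (Ioo a b) :=
    fun t ht => (H.hasDerivAt_cot_comp (hp t ht).1).continuousAt.continuousWithinAt
  have c2 : ContinuousOn (fun t => cos (Φ t - Φ q) / sin (Φ t - Φ q)) (Ioo a b) :=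
    fun t ht => (H.hasDerivAt_cot_comp (hq t ht).1).continuousAt.continuousWithinAt
  have c3 : ContinuousOn (fun t => cos (t - p) / sin (t - p)) (Ioo a b) :=
    fun t ht => (hasDerivAt_cot_sub (hp t ht).2).continuousAt.continuousWithinAt
  have c4 : ContinuousOn (fun t => cos (t - q) / sin (t - q)) (Ioo a b) :=
    fun t ht => (hasDerivAt_cot_sub (hq t ht).2).continuousAt.continuousWithinAt
  have cu : ContinuousOn (fun t => rexp (u t)) (Ioo a b) := H.cont.rexp.continuousOn
  have hW : ∀ t ∈ Ioo a b, HasDerivAt (fun t => calW Φ u p q κ t - u t)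
      (-(cos (Φ t - Φ p) / sin (Φ t - Φ p) + cos (Φ t - Φ q) / sin (Φ t - Φ q)) * rexp (u t)
          + (cos (t - p) / sin (t - p) + cos (t - q) / sin (t - q))) t := by
    intro t ht
    have := ((((hasDerivAt_const t (-log κ)).sub (H.hasDerivAt_log_sin_comp (hp t ht).1)).sub
      (H.hasDerivAt_log_sin_comp (hq t ht).1)).add (hasDerivAt_log_sin_sub (hp t ht).2)).add
      (hasDerivAt_log_sin_sub (hq t ht).2)
    refine (this.congr_of_eventuallyEq (Eventually.of_forall fun x => ?_)).congr_deriv ?_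
    · simp [calW]; ring
    · ring
  have c5 : ContinuousOn (fun t => calW Φ u p q κ t - u t) (Ioo a b) :=
    fun t ht => (hW t ht).continuousAt.continuousWithinAt
  -- `calW` contains `u`, which is only absolutely continuous. The `u` is moved into `Q u`, so that
  -- `P`, `Q`, `S` are continuously differentiable.
  refine ⟨fun t => 1 / 2 * (cos (Φ t - Φ p) / sin (Φ t - Φ p)
      + cos (Φ t - Φ q) / sin (Φ t - Φ q)),
    fun t => -(1 / 2) * (cos (t - p) / sin (t - p) + cos (t - q) / sin (t - q)),
    fun t => -(1 / 2) * (cos (t - p) / sin (t - p) + cos (t - q) / sin (t - q))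
      * (1 + (calW Φ u p q κ t - u t)) + L t, _, _, _,
    fun t ht => ((H.hasDerivAt_cot_comp (hp t ht).1).add
      (H.hasDerivAt_cot_comp (hq t ht).1)).const_mul _, ?_,
    fun t ht => ((hasDerivAt_cot_sub (hp t ht).2).add
      (hasDerivAt_cot_sub (hq t ht).2)).const_mul _, ?_,
    fun t ht => ((((hasDerivAt_cot_sub (hp t ht).2).add
      (hasDerivAt_cot_sub (hq t ht).2)).const_mul _).mul ((hW t ht).const_add 1)).add (hL t ht),
    ?_, ?_, ?_⟩
  · fun_prop
  · fun_prop
  · fun_prop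
  · intro t
    simp only [dCombination, dCalT, Pi.add_apply]
    ring
  · funext t
    simp only [calT]
    ring

omit hL hL' in
theorem continuousOn_calW : ContinuousOn (calW Φ u p q κ) (Ioo a b) := by
  have cu := H.cont
  have cΦ := H.continuous
  unfold calW
  refine ((((cu.continuousOn.sub continuousOn_const).sub (ContinuousOn.log ?_ ?_)).sub
    (ContinuousOn.log ?_ ?_)).add (ContinuousOn.log ?_ ?_)).add (ContinuousOn.log ?_ ?_)
  any_goals fun_prop
  exacts [fun t ht => (hp t ht).1, fun t ht => (hq t ht).1, fun t ht => (hp t ht).2,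
    fun t ht => (hq t ht).2]

include hab hA hB

theorem calT_arc_le
    (hge : ∀ t ∈ Ioo a b, dCalT Φ u v L' p q κ t
      + (rexp (calW Φ u p q κ t) - 1 - calW Φ u p q κ t) ≤ eDensity u v t) :
    B - A ≤ ∫ t in a..b, eDensity u v t ∧
      (∫ t in a..b, eDensity u v t = B - A → ∀ t ∈ Ioo a b, calW Φ u p q κ t = 0) := by
  obtain ⟨P, Q, S, P', Q', S', h1, h2, h3, h4, h5, h6, h7, h8⟩ :=
    H.exists_combination (κ := κ) hp hq hL hL'
  refine H.arc_le hab h1 h2 h3 h4 h5 h6 (H.continuousOn_calW hp hq) ?_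
    (by rw [h8]; exact hA) (by rw [h8]; exact hB)
  intro t ht
  rw [h7]
  exact hge t ht

theorem calT_arc_eq
    (hge : ∀ t ∈ Ioo a b, HasDerivAt u (v t) t → dCalT Φ u v L' p q κ t = eDensity u v t) :
    ∫ t in a..b, eDensity u v t = B - A := by
  obtain ⟨P, Q, S, P', Q', S', h1, h2, h3, h4, h5, h6, h7, h8⟩ :=
    H.exists_combination (κ := κ) hp hq hL hL'
  refine H.arc_eq hab h1 h2 h3 h4 h5 h6 ?_
    (by rw [h8]; exact hA) (by rw [h8]; exact hB)
  intro t ht hu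
  rw [h7]
  exact hge t ht hu

end arcs

end CircleLift

/-! ### Lifts with two pairs of balance points -/

theorem sin_sub_ne_zero_of_mem {p t : ℝ} (h1 : p - π < t) (h2 : t < p + 2 * π) (h3 : t ≠ p)
    (h4 : t ≠ p + π) : sin (t - p) ≠ 0 := by
  rcases lt_or_gt_of_ne h3 with h | h
  · exact (sin_neg_of_neg_of_neg_pi_lt (by linarith) (by linarith)).ne
  rcases lt_or_gt_of_ne h4 with h' | h'
  · exact (sin_pos_of_pos_of_lt_pi (by linarith) (by linarith)).ne'
  · have := sin_pos_of_pos_of_lt_pi (x := t - p - π) (by linarith) (by linarith)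
    rw [Real.sin_sub_pi] at this
    linarith

theorem sin_add_pi_sub (x y : ℝ) : sin (x - (y + π)) = -sin (x - y) := by
  rw [← sub_sub, Real.sin_sub_pi]

theorem cos_add_pi_sub (x y : ℝ) : cos (x - (y + π)) = -cos (x - y) := by
  rw [← sub_sub, Real.cos_sub_pi]

/-- At a balance point both sines only change sign, which `Real.log` does not see. Together with the
shift and swap lemmas below, this shows that one calibrating function serves all base points and
their antipodes. -/
theorem calLog_shift {Φ : ℝ → ℝ} {p : ℝ} (hp : Φ (p + π) = Φ p + π) (q m : ℝ) :
    calLog Φ (p + π) q m = calLog Φ p q m := by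
  funext t
  simp only [calLog, hp, sin_add_pi_sub, Real.log_neg_eq_log]

theorem calW_shift {Φ : ℝ → ℝ} {p : ℝ} (hp : Φ (p + π) = Φ p + π) (u : ℝ → ℝ) (q κ : ℝ) :
    calW Φ u (p + π) q κ = calW Φ u p q κ := by
  funext t
  simp only [calW, hp, sin_add_pi_sub, Real.log_neg_eq_log]

theorem calW_swap (Φ u : ℝ → ℝ) (p q κ : ℝ) : calW Φ u q p κ = calW Φ u p q κ := by
  funext t
  simp only [calW]
  ring

theorem calLog_swap (Φ : ℝ → ℝ) (p q m : ℝ) : calLog Φ q p (-m) = calLog Φ p q m := by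
  funext t
  simp only [calLog]
  ring

theorem calT_shift {Φ : ℝ → ℝ} {p : ℝ} (hp : Φ (p + π) = Φ p + π) (u L : ℝ → ℝ) (q κ : ℝ) :
    calT Φ u L (p + π) q κ = calT Φ u L p q κ := by
  funext t
  simp only [calT, calW_shift hp, hp, sin_add_pi_sub, cos_add_pi_sub, neg_div_neg_eq]

theorem calT_swap (Φ u L : ℝ → ℝ) (p q κ : ℝ) : calT Φ u L q p κ = calT Φ u L p q κ := by
  funext t
  simp only [calT, calW_swap Φ u p q]
  ring

namespace CircleLift

variable {Φ u v : ℝ → ℝ} (H : CircleLift Φ u v)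

include H

theorem balance_add_pi {p : ℝ} (hp : Φ (p + π) = Φ p + π) :
    Φ (p + π + π) = Φ (p + π) + π := by
  have := H.add_two_pi p
  rw [hp, show p + π + π = p + 2 * π by ring, this]
  ring

/-- Balance and monotonicity make `Φ` map each half circle cut out by `p` and `p + π` to the
corresponding half circle at `Φ p`, so the two sines have equal sign. -/
theorem sin_div_sin_pos {p : ℝ} (hp : Φ (p + π) = Φ p + π) {t : ℝ} (ht : sin (t - p) ≠ 0) :
    0 < sin (Φ t - Φ p) / sin (t - p) := by
  have hper : Function.Periodic (fun t => (sin (Φ t - Φ p), sin (t - p))) (2 * π) := by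
    intro t
    simp only [H.add_two_pi, add_sub_right_comm, Real.sin_add_two_pi]
  obtain ⟨s, hs, e⟩ := hper.exists_mem_Ico Real.two_pi_pos t p
  simp only [Prod.mk.injEq] at e
  rw [e.2] at ht
  rw [e.1, e.2]
  have hmono := H.strictMono
  have hs1 : s ≠ p := by rintro rfl; simp at ht
  have hs2 : s ≠ p + π := by rintro rfl; simp at ht
  have h1 : p < s := lt_of_le_of_ne hs.1 hs1.symm
  rcases lt_or_gt_of_ne hs2 with h | h
  · have a1 := hmono h1
    have a2 := hmono h
    rw [hp] at a2
    exact div_pos (sin_pos_of_pos_of_lt_pi (by linarith) (by linarith))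
      (sin_pos_of_pos_of_lt_pi (by linarith) (by linarith))
  · have a1 := hmono h
    have a2 := hmono hs.2
    rw [H.add_two_pi] at a2
    rw [hp] at a1
    have b1 := sin_pos_of_pos_of_lt_pi (x := s - p - π) (by linarith) (by linarith [hs.2])
    have b2 := sin_pos_of_pos_of_lt_pi (x := Φ s - Φ p - π) (by linarith) (by linarith)
    rw [Real.sin_sub_pi] at b1 b2
    exact div_pos_of_neg_of_neg (by linarith) (by linarith)

theorem tendsto_calLog {p q : ℝ} (m : ℝ) (hpq : sin (p - q) ≠ 0) (hΦ : sin (Φ p - Φ q) ≠ 0) :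
    ∃ L, Tendsto (calLog Φ p q m) (𝓝[≠] p) (𝓝 L) := by
  have l1 := (H.halfAt_log_sin_div_sin p).tendsto.add_const (u p)
  have l2 : Tendsto (fun t => log (sin (Φ t - Φ q)) - log (sin (t - q))) (𝓝[≠] p) _ :=
    (((H.hasDerivAt_sin_sub p q).continuousAt.log hΦ).sub
      ((hasDerivAt_sin_id_sub p q).continuousAt.log hpq)).tendsto.mono_left nhdsWithin_le_nhds
  refine ⟨_, ((l1.sub l2).const_mul m).congr fun t => ?_⟩
  simp only [calLog]
  ring

section

variable {p q : ℝ} (hp : Φ (p + π) = Φ p + π) (hq : Φ (q + π) = Φ q + π)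

include hp hq

/-- Both relations are subtraction formulas: `cot x - cot y` is `sin (y - x) / (sin x sin y)`, and
the second one is the formula for `cot (q - p)`. They are the hypotheses of
`calibration_ineq_simple`. -/
theorem calibration_simple {κ m t : ℝ} (hκ : 0 < κ) (hpq : sin (p - q) ≠ 0)
    (hκpq : κ * (sin (Φ p - Φ q) / sin (p - q)) = 1) (hm : m = cos (q - p) / sin (q - p))
    (h1 : sin (t - p) ≠ 0) (h2 : sin (t - q) ≠ 0) :
    (cos (Φ t - Φ p) / sin (Φ t - Φ p) - cos (Φ t - Φ q) / sin (Φ t - Φ q)) * rexp (u t)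
      = (cos (t - p) / sin (t - p) - cos (t - q) / sin (t - q)) * rexp (calW Φ u p q κ t) ∧
    1 + cos (t - p) / sin (t - p) * (cos (t - q) / sin (t - q))
      = -(cos (t - p) / sin (t - p) - cos (t - q) / sin (t - q)) * m := by
  have hX := H.sin_div_sin_pos hp h1
  have hY := H.sin_div_sin_pos hq h2
  rw [exp_calW hκ hX hY, hm]
  have hX' := (sin_ne_zero_of_div_pos hX).1
  have hY' := (sin_ne_zero_of_div_pos hY).1
  have hqp : sin (q - p) ≠ 0 := by
    rw [← neg_sub, Real.sin_neg]
    exact neg_ne_zero.2 hpq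
  have e1 : sin (q - p) = sin (t - p) * cos (t - q) - cos (t - p) * sin (t - q) := by
    rw [← Real.sin_sub]; congr 1; ring
  have e2 : cos (q - p) = cos (t - p) * cos (t - q) + sin (t - p) * sin (t - q) := by
    rw [← Real.cos_sub]; congr 1; ring
  have e3 : sin (Φ q - Φ p)
      = sin (Φ t - Φ p) * cos (Φ t - Φ q) - cos (Φ t - Φ p) * sin (Φ t - Φ q) := by
    rw [← Real.sin_sub]; congr 1; ring
  have e4 : κ * sin (Φ q - Φ p) = sin (q - p) := by
    rw [← neg_sub (Φ p), ← neg_sub p, Real.sin_neg, Real.sin_neg]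
    field_simp at hκpq
    linarith
  have e5 : cos (t - p) / sin (t - p) - cos (t - q) / sin (t - q)
      = -sin (q - p) / (sin (t - p) * sin (t - q)) := by
    rw [e1]; field_simp; ring
  have e6 : cos (Φ t - Φ p) / sin (Φ t - Φ p) - cos (Φ t - Φ q) / sin (Φ t - Φ q)
      = -sin (Φ q - Φ p) / (sin (Φ t - Φ p) * sin (Φ t - Φ q)) := by
    rw [e3]; field_simp; ring
  constructor
  · rw [e5, e6, ← e4]
    field_simp
  · rw [e5]
    field_simp
    rw [e2]
    ring

/-- In the equality case `w = 0`, so the derivative `(c - d) e^u - (C - D)` of `calLog Φ p q 1`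
vanishes. This function is then constant on the arc and equal to both of its end limits, which is
how adjacent arcs are compared. -/
theorem simple_arc {κ m a b A B A' B' : ℝ} (hκ : 0 < κ) (hpq : sin (p - q) ≠ 0)
    (hκpq : κ * (sin (Φ p - Φ q) / sin (p - q)) = 1) (hm : m = cos (q - p) / sin (q - p))
    (hab : a < b) (hs : ∀ t ∈ Ioo a b, sin (t - p) ≠ 0 ∧ sin (t - q) ≠ 0)
    (hA : Tendsto (calT Φ u (calLog Φ p q m) p q κ) (𝓝[≠] a) (𝓝 A))
    (hB : Tendsto (calT Φ u (calLog Φ p q m) p q κ) (𝓝[≠] b) (𝓝 B))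
    (hA' : Tendsto (calLog Φ p q 1) (𝓝[≠] a) (𝓝 A'))
    (hB' : Tendsto (calLog Φ p q 1) (𝓝[≠] b) (𝓝 B')) :
    B - A ≤ ∫ t in a..b, eDensity u v t ∧
      (∫ t in a..b, eDensity u v t = B - A →
        A' = B' ∧ ∀ t ∈ Ioo a b, calLog Φ p q 1 t = A') := by
  have hp' : ∀ t ∈ Ioo a b, sin (Φ t - Φ p) ≠ 0 ∧ sin (t - p) ≠ 0 := fun t ht =>
    sin_ne_zero_of_div_pos (H.sin_div_sin_pos hp (hs t ht).1)
  have hq' : ∀ t ∈ Ioo a b, sin (Φ t - Φ q) ≠ 0 ∧ sin (t - q) ≠ 0 := fun t ht =>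
    sin_ne_zero_of_div_pos (H.sin_div_sin_pos hq (hs t ht).2)
  have hL : ∀ n : ℝ, ∀ t ∈ Ioo a b, HasDerivAt (calLog Φ p q n)
      (n * ((cos (Φ t - Φ p) / sin (Φ t - Φ p) - cos (Φ t - Φ q) / sin (Φ t - Φ q)) * rexp (u t)
      - (cos (t - p) / sin (t - p) - cos (t - q) / sin (t - q)))) t := by
    intro n t ht
    refine ((((H.hasDerivAt_log_sin_comp (hp' t ht).1).sub
      (H.hasDerivAt_log_sin_comp (hq' t ht).1)).sub ((hasDerivAt_log_sin_sub (hp' t ht).2).sub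
      (hasDerivAt_log_sin_sub (hq' t ht).2))).const_mul n).congr_deriv ?_
    ring
  have cΦ := H.continuous
  have cu := H.cont
  have hL' : ContinuousOn (fun t => m * ((cos (Φ t - Φ p) / sin (Φ t - Φ p)
      - cos (Φ t - Φ q) / sin (Φ t - Φ q)) * rexp (u t)
      - (cos (t - p) / sin (t - p) - cos (t - q) / sin (t - q)))) (Ioo a b) := by
    refine continuousOn_const.mul ((ContinuousOn.mul (ContinuousOn.sub (ContinuousOn.div ?_ ?_ ?_)
      (ContinuousOn.div ?_ ?_ ?_)) ?_).sub (ContinuousOn.sub (ContinuousOn.div ?_ ?_ ?_)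
      (ContinuousOn.div ?_ ?_ ?_)))
    any_goals fun_prop
    exacts [fun t ht => (hp' t ht).1, fun t ht => (hq' t ht).1, fun t ht => (hp' t ht).2,
      fun t ht => (hq' t ht).2]
  have hgt : 𝓝[>] a ≤ 𝓝[≠] a := nhdsWithin_mono a fun x hx => ne_of_gt hx
  have hlt : 𝓝[<] b ≤ 𝓝[≠] b := nhdsWithin_mono b fun x hx => ne_of_lt hx
  obtain ⟨h1, h2⟩ := H.calT_arc_le hab hp' hq' (hL m) hL' (hA.mono_left hgt) (hB.mono_left hlt)
    (fun t ht => by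
      obtain ⟨e1, e2⟩ := H.calibration_simple hp hq hκ hpq hκpq hm (hs t ht).1 (hs t ht).2
      have := calibration_ineq_simple (v := v t) e1 e2
      have e3 : rexp (2 * u t) = rexp (u t) ^ 2 := by rw [← Real.exp_nat_mul]; norm_num
      simp only [eDensity, dCalT, e3]
      exact this)
  refine ⟨h1, fun heq => ?_⟩
  have hw := h2 heq
  have hconst : ∀ x ∈ Ioo a b, ∀ y ∈ Ioo a b, calLog Φ p q 1 x = calLog Φ p q 1 y := by
    intro x hx y hy
    refine (convex_Ioo a b).is_const_of_fderivWithin_eq_zero (𝕜 := ℝ)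
      (fun t ht => (hL 1 t ht).differentiableAt.differentiableWithinAt) (fun t ht => ?_) hx hy
    obtain ⟨e1, -⟩ := H.calibration_simple hp hq hκ hpq hκpq hm (hs t ht).1 (hs t ht).2
    rw [hw t ht, Real.exp_zero, mul_one] at e1
    have h0 := hL 1 t ht
    rw [e1, sub_self, mul_zero] at h0
    rw [fderivWithin_of_isOpen isOpen_Ioo ht]
    have := h0.hasFDerivAt.fderiv
    rw [this]
    ext; simp
  have hcA : ∀ t ∈ Ioo a b, calLog Φ p q 1 t = A' := by
    intro t ht
    refine tendsto_nhds_unique_of_eventuallyEq (l := 𝓝[>] a) tendsto_const_nhds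
      (hA'.mono_left hgt) ?_
    filter_upwards [Ioo_mem_nhdsGT hab] with x hx
    exact hconst t ht x hx
  have hcB : ∀ t ∈ Ioo a b, calLog Φ p q 1 t = B' := by
    intro t ht
    refine tendsto_nhds_unique_of_eventuallyEq (l := 𝓝[<] b) tendsto_const_nhds
      (hB'.mono_left hlt) ?_
    filter_upwards [Ioo_mem_nhdsLT hab] with x hx
    exact hconst t ht x hx
  obtain ⟨c, hc⟩ := exists_between hab
  exact ⟨by rw [← hcA c hc, hcB c hc], hcA⟩

/-- The points `p`, `q`, `p + π`, `q + π` cut the circle into four arcs on which the same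
calibration applies. The two-sided limits of `calT` cancel in the sum, and those of `calLog` force
one constant on all arcs in the equality case. -/
theorem energy_simple (h1 : p < q) (h2 : q < p + π) :
    0 ≤ ∫ t in (0 : ℝ)..(2 * π), eDensity u v t ∧
      (∫ t in (0 : ℝ)..(2 * π), eDensity u v t = 0 → ∃ l : ℝ, 0 < l ∧
        ∀ t, sin (Φ t - Φ p) * sin (t - q) = l * (sin (Φ t - Φ q) * sin (t - p))) := by
  have hpi := Real.pi_pos
  have hmono := H.strictMono
  have m1 := hmono h1
  have m2 := hmono h2
  rw [hp] at m2
  have s1 : 0 < sin (q - p) := sin_pos_of_pos_of_lt_pi (by linarith) (by linarith)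
  have s2 : 0 < sin (Φ q - Φ p) := sin_pos_of_pos_of_lt_pi (by linarith) (by linarith)
  have s1' : sin (p - q) = -sin (q - p) := by rw [← neg_sub, Real.sin_neg]
  have s2' : sin (Φ p - Φ q) = -sin (Φ q - Φ p) := by rw [← neg_sub, Real.sin_neg]
  obtain ⟨κ, hκdef⟩ : ∃ κ, κ = sin (q - p) / sin (Φ q - Φ p) := ⟨_, rfl⟩
  obtain ⟨m, hm⟩ : ∃ m, m = cos (q - p) / sin (q - p) := ⟨_, rfl⟩
  have hκ : 0 < κ := by rw [hκdef]; exact div_pos s1 s2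
  have hpq : sin (p - q) ≠ 0 := by rw [s1']; linarith
  have hqp : sin (q - p) ≠ 0 := s1.ne'
  have hκpq : κ * (sin (Φ p - Φ q) / sin (p - q)) = 1 := by
    rw [s1', s2', hκdef]; field_simp
  have hκqp : κ * (sin (Φ q - Φ p) / sin (q - p)) = 1 := by
    rw [hκdef]; field_simp
  have sh : ∀ x y : ℝ, sin (x + π - y) = -sin (x - y) := fun x y => by
    rw [add_sub_right_comm, Real.sin_add_pi]
  have hpπ := H.balance_add_pi hp
  have hΦpq : sin (Φ p - Φ q) ≠ 0 := by rw [s2']; linarith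
  -- limits of the calibrating function
  obtain ⟨A1, hA1⟩ := H.tendsto_calT_simple m hκ hpq hκpq
  obtain ⟨A2, hA2⟩ := H.tendsto_calT_simple (-m) hκ hqp hκqp
  obtain ⟨A3, hA3⟩ := H.tendsto_calT_simple (p := p + π) (q := q) m hκ
    (by rw [sh]; exact neg_ne_zero.2 hpq) (by rw [hp, sh, sh, neg_div_neg_eq]; exact hκpq)
  obtain ⟨A4, hA4⟩ := H.tendsto_calT_simple (p := q + π) (q := p) (-m) hκ
    (by rw [sh]; exact neg_ne_zero.2 hqp) (by rw [hq, sh, sh, neg_div_neg_eq]; exact hκqp)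
  rw [calT_swap, calLog_swap] at hA2
  rw [calT_shift hp, calLog_shift hp] at hA3
  rw [calT_shift hq, calLog_shift hq, calT_swap, calLog_swap] at hA4
  obtain ⟨B1, hB1⟩ := H.tendsto_calLog 1 hpq hΦpq
  obtain ⟨B2, hB2⟩ := H.tendsto_calLog (-1) hqp s2.ne'
  obtain ⟨B3, hB3⟩ := H.tendsto_calLog (p := p + π) (q := q) 1
    (by rw [sh]; exact neg_ne_zero.2 hpq) (by rw [hp, sh]; exact neg_ne_zero.2 hΦpq)
  obtain ⟨B4, hB4⟩ := H.tendsto_calLog (p := q + π) (q := p) (-1)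
    (by rw [sh]; exact neg_ne_zero.2 hqp) (by rw [hq, sh]; exact neg_ne_zero.2 s2.ne')
  rw [calLog_swap] at hB2
  rw [calLog_shift hp] at hB3
  rw [calLog_shift hq, calLog_swap] at hB4
  have htr : Tendsto (fun t => t - 2 * π) (𝓝[≠] (p + 2 * π)) (𝓝[≠] p) := by
    refine tendsto_nhdsWithin_iff.2 ⟨?_, ?_⟩
    · have : Tendsto (fun t : ℝ => t - 2 * π) (𝓝 (p + 2 * π)) (𝓝 (p + 2 * π - 2 * π)) :=
        (continuous_id.sub continuous_const).tendsto _
      rw [add_sub_cancel_right] at this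
      exact this.mono_left nhdsWithin_le_nhds
    · filter_upwards [self_mem_nhdsWithin] with t ht h
      exact ht (by simp only [mem_singleton_iff] at h ⊢; linarith)
  have hΦm : ∀ t, Φ (t - 2 * π) = Φ t - 2 * π := fun t => by
    have := H.add_two_pi (t - 2 * π)
    rw [sub_add_cancel] at this
    linarith
  have hum : ∀ t, u (t - 2 * π) = u t := H.u_periodic.sub_eq
  have rs : ∀ x y : ℝ, x - 2 * π - y = x - y - 2 * π := fun x y => by ring
  have hA5 : Tendsto (calT Φ u (calLog Φ p q m) p q κ) (𝓝[≠] (p + 2 * π)) (𝓝 A1) := by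
    refine (hA1.comp htr).congr fun t => ?_
    simp only [Function.comp, calT, calW, calLog, hΦm, hum, rs, Real.sin_sub_two_pi,
      Real.cos_sub_two_pi]
  have hB5 : Tendsto (calLog Φ p q 1) (𝓝[≠] (p + 2 * π)) (𝓝 B1) := by
    refine (hB1.comp htr).congr fun t => ?_
    simp only [Function.comp, calLog, hΦm, rs, Real.sin_sub_two_pi]
  -- the four arcs
  obtain ⟨a1, e1⟩ := H.simple_arc hp hq hκ hpq hκpq hm h1 (fun t ht =>
    ⟨sin_sub_ne_zero_of_mem (by linarith [ht.1]) (by linarith [ht.2]) (by linarith [ht.1])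
      (by linarith [ht.2]),
    sin_sub_ne_zero_of_mem (by linarith [ht.1]) (by linarith [ht.2]) (by linarith [ht.2])
      (by linarith [ht.2])⟩) hA1 hA2 hB1 hB2
  obtain ⟨a2, e2⟩ := H.simple_arc hp hq hκ hpq hκpq hm h2 (fun t ht =>
    ⟨sin_sub_ne_zero_of_mem (by linarith [ht.1]) (by linarith [ht.2]) (by linarith [ht.1])
      (by linarith [ht.2]),
    sin_sub_ne_zero_of_mem (by linarith [ht.1]) (by linarith [ht.2]) (by linarith [ht.1])
      (by linarith [ht.2])⟩) hA2 hA3 hB2 hB3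
  obtain ⟨a3, e3⟩ := H.simple_arc hp hq hκ hpq hκpq hm (a := p + π) (b := q + π) (by linarith)
    (fun t ht => ⟨sin_sub_ne_zero_of_mem (by linarith [ht.1]) (by linarith [ht.2])
      (by linarith [ht.1]) (by linarith [ht.1]),
    sin_sub_ne_zero_of_mem (by linarith [ht.1]) (by linarith [ht.2]) (by linarith [ht.1])
      (by linarith [ht.2])⟩) hA3 hA4 hB3 hB4
  obtain ⟨a4, e4⟩ := H.simple_arc hp hq hκ hpq hκpq hm (a := q + π) (b := p + 2 * π) (by linarith)
    (fun t ht => ⟨sin_sub_ne_zero_of_mem (by linarith [ht.1]) (by linarith [ht.2])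
      (by linarith [ht.1]) (by linarith [ht.1]),
    sin_sub_ne_zero_of_mem (by linarith [ht.1]) (by linarith [ht.2]) (by linarith [ht.1])
      (by linarith [ht.1])⟩) hA4 hA5 hB4 hB5
  have hsum : ∫ t in (0 : ℝ)..(2 * π), eDensity u v t
      = (∫ t in p..q, eDensity u v t) + (∫ t in q..(p + π), eDensity u v t)
        + (∫ t in (p + π)..(q + π), eDensity u v t)
        + ∫ t in (q + π)..(p + 2 * π), eDensity u v t := by
    have := H.eDensity_periodic.intervalIntegral_add_eq 0 p
    rw [zero_add] at this
    rw [this, intervalIntegral.integral_add_adjacent_intervals (H.eDensity_int _ _)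
      (H.eDensity_int _ _), intervalIntegral.integral_add_adjacent_intervals (H.eDensity_int _ _)
      (H.eDensity_int _ _), intervalIntegral.integral_add_adjacent_intervals (H.eDensity_int _ _)
      (H.eDensity_int _ _)]
  rw [hsum]
  -- The lower bounds `A2 - A1`, `A3 - A2`, `A4 - A3`, `A1 - A4` add up to zero, so a vanishing
  -- total makes each arc sharp.
  refine ⟨by linarith, fun h0 => ?_⟩
  obtain ⟨f1, g1⟩ := e1 (by linarith)
  obtain ⟨f2, g2⟩ := e2 (by linarith)
  obtain ⟨f3, g3⟩ := e3 (by linarith)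
  obtain ⟨f4, g4⟩ := e4 (by linarith)
  have hlog : ∀ t, sin (t - p) ≠ 0 → sin (t - q) ≠ 0 → calLog Φ p q 1 t = B1 →
      sin (Φ t - Φ p) * sin (t - q) = rexp B1 * (sin (Φ t - Φ q) * sin (t - p)) := by
    intro t ht1 ht2 ht3
    have hX := H.sin_div_sin_pos hp ht1
    have hY := H.sin_div_sin_pos hq ht2
    obtain ⟨hX', -⟩ := sin_ne_zero_of_div_pos hX
    obtain ⟨hY', -⟩ := sin_ne_zero_of_div_pos hY
    have : calLog Φ p q 1 t = log (sin (Φ t - Φ p) / sin (t - p))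
        - log (sin (Φ t - Φ q) / sin (t - q)) := by
      rw [Real.log_div hX' ht1, Real.log_div hY' ht2]
      simp only [calLog]; ring
    rw [← ht3, this, Real.exp_sub, Real.exp_log hX, Real.exp_log hY]
    field_simp
  refine ⟨rexp B1, exp_pos _, fun t => ?_⟩
  have hper : Function.Periodic (fun t => sin (Φ t - Φ p) * sin (t - q)
      - rexp B1 * (sin (Φ t - Φ q) * sin (t - p))) (2 * π) := by
    intro t
    simp only [H.add_two_pi, add_sub_right_comm, Real.sin_add_two_pi]
  obtain ⟨s, hs, e⟩ := hper.exists_mem_Ico Real.two_pi_pos t p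
  refine sub_eq_zero.1 (e.trans (sub_eq_zero.2 ?_))
  -- At the four base points both sides of the relation vanish.
  by_cases hs1 : s = p
  · simp [hs1]
  by_cases hs2 : s = p + π
  · simp [hs2, hp]
  by_cases hs3 : s = q
  · simp [hs3]
  by_cases hs4 : s = q + π
  · simp [hs4, hq]
  have hps : p < s := lt_of_le_of_ne hs.1 (Ne.symm hs1)
  refine hlog s (sin_sub_ne_zero_of_mem (by linarith) hs.2 hs1 hs2)
    (sin_sub_ne_zero_of_mem (by linarith) (by linarith [hs.2]) hs3 hs4) ?_
  rcases lt_or_gt_of_ne hs3 with h | h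
  · exact g1 s ⟨hps, h⟩
  rcases lt_or_gt_of_ne hs2 with h' | h'
  · rw [g2 s ⟨h, h'⟩]; linarith
  rcases lt_or_gt_of_ne hs4 with h'' | h''
  · rw [g3 s ⟨h', h''⟩]; linarith
  · rw [g4 s ⟨h'', hs.2⟩]; linarith

end

end CircleLift

/-! ### Lifts with a double pair of balance points -/

theorem nhdsGT_le_nhdsNE (a : ℝ) : 𝓝[>] a ≤ 𝓝[≠] a := nhdsWithin_mono a fun _ hx => ne_of_gt hx

theorem nhdsLT_le_nhdsNE (a : ℝ) : 𝓝[<] a ≤ 𝓝[≠] a := nhdsWithin_mono a fun _ hx => ne_of_lt hx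

theorem calCot_shift {Φ : ℝ → ℝ} {p : ℝ} (hp : Φ (p + π) = Φ p + π) (κ : ℝ) :
    calCot Φ (p + π) κ = calCot Φ p κ := by
  funext t
  simp only [calCot, hp, sin_add_pi_sub, cos_add_pi_sub, neg_div_neg_eq]

namespace CircleLift

variable {Φ u v : ℝ → ℝ} (H : CircleLift Φ u v) {p : ℝ} (hp : Φ (p + π) = Φ p + π)

include H hp

theorem calW_double_eq_zero_iff {κ t : ℝ} (hκ : 0 < κ) (ht : sin (t - p) ≠ 0) :
    calW Φ u p p κ t = 0 ↔ rexp (u t) * sin (t - p) ^ 2 = κ * sin (Φ t - Φ p) ^ 2 := by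
  have hX := H.sin_div_sin_pos hp ht
  obtain ⟨hX', -⟩ := sin_ne_zero_of_div_pos hX
  rw [← Real.exp_eq_one_iff, exp_calW hκ hX hX]
  field_simp

/-- Equality means `w = 0`. Conversely `w = 0` on the arc gives `w' = 0` almost everywhere, and then
`calibration_eq_double` has no defect. -/
theorem double_arc {κ a b A B : ℝ} (hκ : 0 < κ) (hab : a < b)
    (hs : ∀ t ∈ Ioo a b, sin (t - p) ≠ 0)
    (hA : Tendsto (calT Φ u (calCot Φ p κ) p p κ) (𝓝[≠] a) (𝓝 A))
    (hB : Tendsto (calT Φ u (calCot Φ p κ) p p κ) (𝓝[≠] b) (𝓝 B)) :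
    B - A ≤ ∫ t in a..b, eDensity u v t ∧
      (∫ t in a..b, eDensity u v t = B - A ↔
        ∀ t ∈ Ioo a b, rexp (u t) * sin (t - p) ^ 2 = κ * sin (Φ t - Φ p) ^ 2) := by
  have hp' : ∀ t ∈ Ioo a b, sin (Φ t - Φ p) ≠ 0 ∧ sin (t - p) ≠ 0 := fun t ht =>
    sin_ne_zero_of_div_pos (H.sin_div_sin_pos hp (hs t ht))
  have hL : ∀ t ∈ Ioo a b, HasDerivAt (calCot Φ p κ)
      (-(1 + (cos (Φ t - Φ p) / sin (Φ t - Φ p)) ^ 2) * rexp (u t) * κ⁻¹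
        + (1 + (cos (t - p) / sin (t - p)) ^ 2)) t := by
    intro t ht
    refine (((H.hasDerivAt_cot_comp (hp' t ht).1).div_const κ).sub
      (hasDerivAt_cot_sub (hp' t ht).2)).congr_deriv ?_
    ring
  have cΦ := H.continuous
  have cu := H.cont
  have hL' : ContinuousOn (fun t => -(1 + (cos (Φ t - Φ p) / sin (Φ t - Φ p)) ^ 2) * rexp (u t)
      * κ⁻¹ + (1 + (cos (t - p) / sin (t - p)) ^ 2)) (Ioo a b) := by
    have c1 : ContinuousOn (fun t => cos (Φ t - Φ p) / sin (Φ t - Φ p)) (Ioo a b) :=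
      ContinuousOn.div (by fun_prop) (by fun_prop) fun t ht => (hp' t ht).1
    have c2 : ContinuousOn (fun t => cos (t - p) / sin (t - p)) (Ioo a b) :=
      ContinuousOn.div (by fun_prop) (by fun_prop) fun t ht => (hp' t ht).2
    fun_prop
  have hG : ∀ t ∈ Ioo a b, (1 + (cos (Φ t - Φ p) / sin (Φ t - Φ p)) ^ 2) * rexp (u t) * κ⁻¹
      = (1 + (cos (t - p) / sin (t - p)) ^ 2) * rexp (calW Φ u p p κ t) := by
    intro t ht
    have hX := H.sin_div_sin_pos hp (hs t ht)
    obtain ⟨h1, h2⟩ := hp' t ht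
    rw [exp_calW hκ hX hX]
    have e1 := Real.sin_sq_add_cos_sq (Φ t - Φ p)
    have e2 := Real.sin_sq_add_cos_sq (t - p)
    have e3 : 1 + (cos (Φ t - Φ p) / sin (Φ t - Φ p)) ^ 2 = 1 / sin (Φ t - Φ p) ^ 2 := by
      field_simp; exact e1
    have e4 : 1 + (cos (t - p) / sin (t - p)) ^ 2 = 1 / sin (t - p) ^ 2 := by
      field_simp; exact e2
    rw [e3, e4]
    field_simp
  have e3 : ∀ t, rexp (2 * u t) = rexp (u t) ^ 2 := fun t => by
    rw [← Real.exp_nat_mul]; norm_num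
  obtain ⟨h1, h2⟩ := H.calT_arc_le hab hp' hp' hL hL' (hA.mono_left (nhdsGT_le_nhdsNE a))
    (hB.mono_left (nhdsLT_le_nhdsNE b)) (fun t ht => by
      have := calibration_eq_double (v := v t) (hG t ht)
      simp only [eDensity, dCalT, e3]
      have hw := add_one_le_exp (calW Φ u p p κ t)
      nlinarith [sq_nonneg (v t - (2 * (cos (Φ t - Φ p) / sin (Φ t - Φ p)) * rexp (u t)
        - 2 * (cos (t - p) / sin (t - p)))), mul_nonneg (sq_nonneg (cos (t - p) / sin (t - p)))
        (show 0 ≤ rexp (calW Φ u p p κ t) - 1 - calW Φ u p p κ t by linarith)])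
  refine ⟨h1, fun heq t ht => (H.calW_double_eq_zero_iff hp hκ (hs t ht)).1 (h2 heq t ht),
    fun hform => ?_⟩
  have hw : ∀ t ∈ Ioo a b, calW Φ u p p κ t = 0 := fun t ht =>
    (H.calW_double_eq_zero_iff hp hκ (hs t ht)).2 (hform t ht)
  refine H.calT_arc_eq hab hp' hp' hL hL' (hA.mono_left (nhdsGT_le_nhdsNE a))
    (hB.mono_left (nhdsLT_le_nhdsNE b)) fun t ht hu => ?_
  have hd : HasDerivAt (calW Φ u p p κ) _ t :=
    ((((hu.sub_const (log κ)).sub (H.hasDerivAt_log_sin_comp (hp' t ht).1)).sub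
      (H.hasDerivAt_log_sin_comp (hp' t ht).1)).add (hasDerivAt_log_sin_sub (hp' t ht).2)).add
      (hasDerivAt_log_sin_sub (hp' t ht).2)
  have h0 : HasDerivAt (calW Φ u p p κ) 0 t := by
    refine (hasDerivAt_const t (0 : ℝ)).congr_of_eventuallyEq ?_
    filter_upwards [Ioo_mem_nhds ht.1 ht.2] with x hx
    exact hw x hx
  have hv := hd.unique h0
  have := calibration_eq_double (v := v t) (hG t ht)
  rw [hw t ht, Real.exp_zero] at this
  simp only [eDensity, dCalT, e3]
  rw [hw t ht]
  have hv' : v t - (2 * (cos (Φ t - Φ p) / sin (Φ t - Φ p)) * rexp (u t)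
      - 2 * (cos (t - p) / sin (t - p))) = 0 := by linarith
  rw [hv'] at this
  linarith

theorem sin_comp_eq_zero {t : ℝ} (ht : sin (t - p) = 0) : sin (Φ t - Φ p) = 0 := by
  have hper : Function.Periodic (fun t => (sin (Φ t - Φ p), sin (t - p))) (2 * π) := by
    intro t
    simp only [H.add_two_pi, add_sub_right_comm, Real.sin_add_two_pi]
  obtain ⟨s, hs, e⟩ := hper.exists_mem_Ico Real.two_pi_pos t p
  simp only [Prod.mk.injEq] at e
  rw [e.2] at ht
  rw [e.1]
  by_cases hs1 : s = p
  · simp [hs1]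
  by_cases hs2 : s = p + π
  · simp [hs2, hp]
  · exact absurd ht (sin_sub_ne_zero_of_mem (by linarith [hs.1, Real.pi_pos]) hs.2 hs1 hs2)

/-- By `hu` the constant `κ = e^{-u p}` is right at both `p` and `p + π`, so the calibrating
function tends to `0` at every end of the two half circles. -/
theorem energy_double (hu : u (p + π) = u p) :
    0 ≤ ∫ t in (0 : ℝ)..(2 * π), eDensity u v t ∧
      (∫ t in (0 : ℝ)..(2 * π), eDensity u v t = 0 ↔
        ∀ t, rexp (u t) * sin (t - p) ^ 2 = rexp (-u p) * sin (Φ t - Φ p) ^ 2) := by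
  have hpi := Real.pi_pos
  have hpπ := H.balance_add_pi hp
  have sh : ∀ q, Φ (q + π) = Φ q + π → ∀ κ, calT Φ u (calCot Φ (q + π) κ) (q + π) (q + π) κ
      = calT Φ u (calCot Φ q κ) q q κ := by
    intro q hq κ
    rw [calT_shift hq, calT_swap, calT_shift hq, calCot_shift hq]
  have hA1 := H.tendsto_calT_double p
  have hA2 := H.tendsto_calT_double (p + π)
  have hA3 := H.tendsto_calT_double (p + π + π)
  rw [hu, sh p hp] at hA2
  have hp2 : u (p + π + π) = u p := by
    rw [show p + π + π = p + 2 * π by ring, H.u_periodic]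
  rw [hp2, sh _ hpπ, sh p hp] at hA3
  obtain ⟨a1, e1⟩ := H.double_arc hp (exp_pos _) (by linarith) (fun t ht =>
    sin_sub_ne_zero_of_mem (by linarith [ht.1]) (by linarith [ht.2]) (by linarith [ht.1])
      (by linarith [ht.2])) hA1 hA2
  obtain ⟨a2, e2⟩ := H.double_arc hp (exp_pos _) (by linarith) (fun t ht =>
    sin_sub_ne_zero_of_mem (by linarith [ht.1]) (by linarith [ht.2]) (by linarith [ht.1])
      (by linarith [ht.1])) hA2 hA3
  have hsum : ∫ t in (0 : ℝ)..(2 * π), eDensity u v t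
      = (∫ t in p..(p + π), eDensity u v t) + (∫ t in (p + π)..(p + π + π), eDensity u v t) := by
    have := H.eDensity_periodic.intervalIntegral_add_eq 0 p
    rw [zero_add] at this
    rw [this, intervalIntegral.integral_add_adjacent_intervals (H.eDensity_int _ _)
      (H.eDensity_int _ _), show p + π + π = p + 2 * π by ring]
  rw [hsum]
  refine ⟨by linarith, fun h0 t => ?_, fun hf => ?_⟩
  · have g1 := e1.1 (by linarith)
    have g2 := e2.1 (by linarith)
    have hper : Function.Periodic (fun t => rexp (u t) * sin (t - p) ^ 2
        - rexp (-u p) * sin (Φ t - Φ p) ^ 2) (2 * π) := by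
      intro t
      simp only [H.add_two_pi, H.u_periodic t, add_sub_right_comm, Real.sin_add_two_pi]
    obtain ⟨s, hs, e⟩ := hper.exists_mem_Ico Real.two_pi_pos t p
    refine sub_eq_zero.1 (e.trans (sub_eq_zero.2 ?_))
    by_cases hs1 : s = p
    · simp [hs1]
    by_cases hs2 : s = p + π
    · simp [hs2, hp]
    have hps : p < s := lt_of_le_of_ne hs.1 (Ne.symm hs1)
    rcases lt_or_gt_of_ne hs2 with h | h
    · exact g1 s ⟨hps, h⟩
    · exact g2 s ⟨h, by linarith [hs.2]⟩
  · rw [e1.2 fun t _ => hf t, e2.2 fun t _ => hf t]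
    ring

/-- On an arc where the double calibration is sharp, the cotangents are affinely related. -/
theorem exists_cot_of_sharp {κ a b : ℝ} (hs : ∀ t ∈ Ioo a b, sin (t - p) ≠ 0)
    (hf : ∀ t ∈ Ioo a b, rexp (u t) * sin (t - p) ^ 2 = κ * sin (Φ t - Φ p) ^ 2) :
    ∃ c, ∀ t ∈ Ioo a b, cos (Φ t - Φ p) / sin (Φ t - Φ p)
      = κ * (cos (t - p) / sin (t - p)) + c := by
  have hp' : ∀ t ∈ Ioo a b, sin (Φ t - Φ p) ≠ 0 ∧ sin (t - p) ≠ 0 := fun t ht =>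
    sin_ne_zero_of_div_pos (H.sin_div_sin_pos hp (hs t ht))
  have hd : ∀ t ∈ Ioo a b, HasDerivAt (fun t => cos (Φ t - Φ p) / sin (Φ t - Φ p)
      - κ * (cos (t - p) / sin (t - p))) 0 t := by
    intro t ht
    obtain ⟨h1, h2⟩ := hp' t ht
    refine ((H.hasDerivAt_cot_comp h1).sub ((hasDerivAt_cot_sub h2).const_mul κ)).congr_deriv ?_
    have e1 := Real.sin_sq_add_cos_sq (Φ t - Φ p)
    have e2 := Real.sin_sq_add_cos_sq (t - p)
    have e3 : 1 + (cos (Φ t - Φ p) / sin (Φ t - Φ p)) ^ 2 = 1 / sin (Φ t - Φ p) ^ 2 := by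
      field_simp; exact e1
    have e4 : 1 + (cos (t - p) / sin (t - p)) ^ 2 = 1 / sin (t - p) ^ 2 := by
      field_simp; exact e2
    rw [e3, e4]
    have := hf t ht
    field_simp
    linarith
  rcases le_or_gt b a with hab | hab
  · exact ⟨0, fun t ht => absurd (ht.1.trans ht.2) (not_lt.2 hab)⟩
  obtain ⟨c, hc⟩ := exists_between hab
  refine ⟨cos (Φ c - Φ p) / sin (Φ c - Φ p) - κ * (cos (c - p) / sin (c - p)), fun t ht => ?_⟩
  have := (convex_Ioo a b).is_const_of_fderivWithin_eq_zero (𝕜 := ℝ)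
      (fun t ht => (hd t ht).differentiableAt.differentiableWithinAt) (fun t ht => by
        rw [fderivWithin_of_isOpen isOpen_Ioo ht, (hd t ht).hasFDerivAt.fderiv]
        ext; simp) ht hc
  linarith

/-- Affinely related cotangents on an arc determine `u`. -/
theorem sharp_of_cot {κ c a b : ℝ} (hs : ∀ t ∈ Ioo a b, sin (t - p) ≠ 0)
    (hf : ∀ t ∈ Ioo a b, cos (Φ t - Φ p) / sin (Φ t - Φ p)
      = κ * (cos (t - p) / sin (t - p)) + c) :
    ∀ t ∈ Ioo a b, rexp (u t) * sin (t - p) ^ 2 = κ * sin (Φ t - Φ p) ^ 2 := by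
  intro t ht
  obtain ⟨h1, h2⟩ := sin_ne_zero_of_div_pos (H.sin_div_sin_pos hp (hs t ht))
  have hd := ((hasDerivAt_cot_sub h2).const_mul κ).add_const c
  have hd' := H.hasDerivAt_cot_comp h1
  have e := hd'.unique (hd.congr_of_eventuallyEq (by
    filter_upwards [Ioo_mem_nhds ht.1 ht.2] with x hx
    exact hf x hx))
  have e1 := Real.sin_sq_add_cos_sq (Φ t - Φ p)
  have e2 := Real.sin_sq_add_cos_sq (t - p)
  have e3 : 1 + (cos (Φ t - Φ p) / sin (Φ t - Φ p)) ^ 2 = 1 / sin (Φ t - Φ p) ^ 2 := by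
    field_simp; exact e1
  have e4 : 1 + (cos (t - p) / sin (t - p)) ^ 2 = 1 / sin (t - p) ^ 2 := by
    field_simp; exact e2
  rw [e3, e4] at e
  field_simp at e
  linarith

theorem tendsto_sin_div_sin_add_pi :
    Tendsto (fun t => sin (Φ t - Φ p) / sin (t - p)) (𝓝[≠] (p + π)) (𝓝 (rexp (u (p + π)))) := by
  refine (H.halfAt_sin_div_sin (p + π)).tendsto.congr fun t => ?_
  rw [hp, sin_add_pi_sub, sin_add_pi_sub, neg_div_neg_eq]

/-- If the cotangents are affinely related on the two half circles, then the energy vanishes. -/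
theorem energy_eq_zero_of_cot {κ c₁ c₂ : ℝ}
    (h1 : ∀ t ∈ Ioo p (p + π), cos (Φ t - Φ p) / sin (Φ t - Φ p)
      = κ * (cos (t - p) / sin (t - p)) + c₁)
    (h2 : ∀ t ∈ Ioo (p + π) (p + 2 * π), cos (Φ t - Φ p) / sin (Φ t - Φ p)
      = κ * (cos (t - p) / sin (t - p)) + c₂) :
    ∫ t in (0 : ℝ)..(2 * π), eDensity u v t = 0 := by
  have hpi := Real.pi_pos
  have s1 : ∀ t ∈ Ioo p (p + π), sin (t - p) ≠ 0 := fun t ht =>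
    sin_sub_ne_zero_of_mem (by linarith [ht.1]) (by linarith [ht.2]) (by linarith [ht.1])
      (by linarith [ht.2])
  have s2 : ∀ t ∈ Ioo (p + π) (p + 2 * π), sin (t - p) ≠ 0 := fun t ht =>
    sin_sub_ne_zero_of_mem (by linarith [ht.1]) (by linarith [ht.2]) (by linarith [ht.1])
      (by linarith [ht.1])
  have f1 := H.sharp_of_cot hp s1 h1
  have f2 := H.sharp_of_cot hp s2 h2
  -- Letting `t` tend to `p` and to `p + π` in this formula gives `κ e^u = 1` at both ends. This
  -- identifies `κ` and yields the equality `u (p + π) = u p` needed for `energy_double`.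
  have key : ∀ t ∈ Ioo p (p + π), rexp (u t) = κ * (sin (Φ t - Φ p) / sin (t - p)) ^ 2 := by
    intro t ht
    have := s1 t ht
    have := f1 t ht
    field_simp
    linarith
  have k1 : rexp (u p) = κ * rexp (u p) ^ 2 := by
    refine tendsto_nhds_unique_of_eventuallyEq (l := 𝓝[>] p)
      (H.cont.rexp.continuousAt.tendsto.mono_left nhdsWithin_le_nhds)
      ((((H.halfAt_sin_div_sin p).tendsto.mono_left (nhdsGT_le_nhdsNE p)).pow 2).const_mul κ) ?_
    filter_upwards [Ioo_mem_nhdsGT (show p < p + π by linarith)] with t ht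
    exact key t ht
  have k2 : rexp (u (p + π)) = κ * rexp (u (p + π)) ^ 2 := by
    refine tendsto_nhds_unique_of_eventuallyEq (l := 𝓝[<] (p + π))
      (H.cont.rexp.continuousAt.tendsto.mono_left nhdsWithin_le_nhds)
      ((((H.tendsto_sin_div_sin_add_pi hp).mono_left (nhdsLT_le_nhdsNE _)).pow 2).const_mul κ) ?_
    filter_upwards [Ioo_mem_nhdsLT (show p < p + π by linarith)] with t ht
    exact key t ht
  have e1 := exp_pos (u p)
  have e2 := exp_pos (u (p + π))
  have k1' : κ * rexp (u p) = 1 := by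
    have : rexp (u p) * (κ * rexp (u p) - 1) = 0 := by linarith
    rcases mul_eq_zero.1 this with h | h <;> linarith
  have k2' : κ * rexp (u (p + π)) = 1 := by
    have : rexp (u (p + π)) * (κ * rexp (u (p + π)) - 1) = 0 := by linarith
    rcases mul_eq_zero.1 this with h | h <;> linarith
  have hκ : κ ≠ 0 := by rintro rfl; simp at k1'
  have hu : u (p + π) = u p :=
    exp_injective (mul_left_cancel₀ hκ (k2'.trans k1'.symm))
  have hκ' : κ = rexp (-u p) := by
    rw [Real.exp_neg]; exact eq_inv_of_mul_eq_one_left k1'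
  refine (H.energy_double hp hu).2.2 fun t => ?_
  rw [← hκ']
  have hper : Function.Periodic (fun t => rexp (u t) * sin (t - p) ^ 2
      - κ * sin (Φ t - Φ p) ^ 2) (2 * π) := by
    intro t
    simp only [H.add_two_pi, H.u_periodic t, add_sub_right_comm, Real.sin_add_two_pi]
  obtain ⟨s, hs, e⟩ := hper.exists_mem_Ico Real.two_pi_pos t p
  refine sub_eq_zero.1 (e.trans (sub_eq_zero.2 ?_))
  by_cases hs1 : s = p
  · simp [hs1]
  by_cases hs2 : s = p + π
  · simp [hs2, hp]
  have hps : p < s := lt_of_le_of_ne hs.1 (Ne.symm hs1)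
  rcases lt_or_gt_of_ne hs2 with h | h
  · exact f1 s ⟨hps, h⟩
  · exact f2 s ⟨h, hs.2⟩

omit hp in
/-- If `u` is differentiable at `p`, then the additive constants on both sides of `p` agree. -/
theorem cot_const_unique (hu : DifferentiableAt ℝ u p)
    (hf : ∀ t, rexp (u t) * sin (t - p) ^ 2 = rexp (-u p) * sin (Φ t - Φ p) ^ 2) {c₁ c₂ : ℝ}
    (h1 : ∀ t ∈ Ioo p (p + π), cos (Φ t - Φ p) / sin (Φ t - Φ p)
      = rexp (-u p) * (cos (t - p) / sin (t - p)) + c₁)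
    (h2 : ∀ t ∈ Ioo (p + π) (p + 2 * π), cos (Φ t - Φ p) / sin (Φ t - Φ p)
      = rexp (-u p) * (cos (t - p) / sin (t - p)) + c₂) : c₁ = c₂ := by
  have hpi := Real.pi_pos
  -- Sharpness says that `sin (Φ t - Φ p) / sin (t - p)` is `e^{(u t + u p) / 2}`. So the difference
  -- of the two cotangents is a difference quotient of functions differentiable at `p`, and has one
  -- limit from both sides.
  have hd : HasDerivAt (fun t => cos (Φ t - Φ p) * rexp (-(u t + u p) / 2)) _ p :=
    (H.hasDerivAt_cos_sub p p).mul (((hu.hasDerivAt.add_const (u p)).neg.div_const 2).exp)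
  have l := (tendsto_div_sin p).mul (tendsto_sub_div hd
    ((hasDerivAt_cos_id_sub p p).const_mul (rexp (-u p))) (by
      simp only [sub_self, cos_zero, one_mul, mul_one]; congr 1; ring))
  have key : ∀ᶠ t in 𝓝[≠] p, (t - p) / sin (t - p) * ((cos (Φ t - Φ p) * rexp (-(u t + u p) / 2)
      - rexp (-u p) * cos (t - p)) / (t - p))
      = cos (Φ t - Φ p) / sin (Φ t - Φ p) - rexp (-u p) * (cos (t - p) / sin (t - p)) := by
    filter_upwards [H.eventually_sin_div_sin_pos p, self_mem_nhdsWithin] with t ht htp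
    obtain ⟨h3, h4⟩ := sin_ne_zero_of_div_pos ht
    have htp : t - p ≠ 0 := sub_ne_zero.2 htp
    have hX : sin (Φ t - Φ p) / sin (t - p) = rexp ((u t + u p) / 2) := by
      rw [← abs_of_pos ht, ← abs_of_pos (exp_pos ((u t + u p) / 2)), ← sq_eq_sq_iff_abs_eq_abs,
        ← Real.exp_nat_mul]
      have := hf t
      rw [Real.exp_neg] at this
      have e : rexp (u t + u p) * sin (t - p) ^ 2 = sin (Φ t - Φ p) ^ 2 := by
        rw [Real.exp_add]
        field_simp at this
        linarith
      rw [div_pow, ← e]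
      field_simp
      congr 1
      push_cast
      ring
    have hX2 : rexp (-(u t + u p) / 2) = sin (t - p) / sin (Φ t - Φ p) := by
      rw [neg_div, Real.exp_neg, ← hX, inv_div]
    rw [hX2]
    field_simp
  have l' := l.congr' key
  have r1 := tendsto_nhds_unique_of_eventuallyEq (l'.mono_left (nhdsGT_le_nhdsNE p))
    (tendsto_const_nhds (x := c₁)) (by
      filter_upwards [Ioo_mem_nhdsGT (show p < p + π by linarith)] with t ht
      rw [h1 t ht]; ring)
  have r2 := tendsto_nhds_unique_of_eventuallyEq (l'.mono_left (nhdsLT_le_nhdsNE p))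
    (tendsto_const_nhds (x := c₂)) (by
      filter_upwards [Ioo_mem_nhdsLT (show p - π < p by linarith)] with t ht
      -- The left neighbourhood of `p` is the end of the second half circle, translated by a period.
      have := h2 (t + 2 * π) ⟨by linarith [ht.1], by linarith [ht.2]⟩
      simp only [H.add_two_pi, add_sub_right_comm, Real.sin_add_two_pi,
        Real.cos_add_two_pi] at this
      rw [this]; ring)
  exact r1.symm.trans r2

end CircleLift

/-! ### From the circle to the line -/

theorem isQuotientMap_circleExp : IsQuotientMap Circle.exp :=
  Circle.isCoveringMap_exp.isLocalHomeomorph.isOpenMap.isQuotientMap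
    Circle.exp.continuous Circle.exp_surjective

theorem contMDiff_circle_coe {n : ℕ∞ω} : ContMDiff (𝓡 1) 𝓘(ℝ, ℂ) n fun p : Circle => (p : ℂ) := by
  have : Fact (Module.finrank ℝ ℂ = 1 + 1) := ⟨Complex.finrank_real_complex⟩
  exact contMDiff_coe_sphere

theorem contDiff_comp_exp {n : ℕ∞ω} {φ : Circle → Circle} (h : ContMDiff (𝓡 1) (𝓡 1) n φ) :
    ContDiff ℝ n fun t : ℝ => (φ (Circle.exp t) : ℂ) := by
  rw [← contMDiff_iff_contDiff]
  exact contMDiff_circle_coe.comp (h.comp contMDiff_circleExp)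

theorem angDeriv_exp (φ : Circle → Circle) (t : ℝ) :
    angDeriv φ (Circle.exp t)
      = (conj (φ (Circle.exp t) : ℂ) * deriv (fun s : ℝ => (φ (Circle.exp s) : ℂ)) t).im := by
  simp only [angDeriv, ← Circle.exp_add]
  rw [deriv_comp_const_add (f := fun s : ℝ => (φ (Circle.exp s) : ℂ)), add_zero]

theorem contDiff_angDeriv_exp {n : ℕ∞ω} {φ : Circle → Circle}
    (h : ContMDiff (𝓡 1) (𝓡 1) (n + 1) φ) :
    ContDiff ℝ n fun t : ℝ => angDeriv φ (Circle.exp t) := by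
  simp_rw [angDeriv_exp]
  have h1 := contDiff_comp_exp h
  have h2 : ContDiff ℝ n (deriv fun s : ℝ => (φ (Circle.exp s) : ℂ)) :=
    (contDiff_succ_iff_deriv.1 h1).2.2
  have h3 : ContDiff ℝ n fun s : ℝ => conj (φ (Circle.exp s) : ℂ) :=
    Complex.conjCLE.contDiff.comp (h1.of_le le_self_add)
  exact Complex.imCLM.contDiff.comp (h3.mul h2)

/-- Differentiating `conj z * z = 1` shows that `conj z * z'` is purely imaginary, so the imaginary
part recorded by `angDeriv` determines `z'`. -/
theorem deriv_comp_exp {φ : Circle → Circle} (h : ContMDiff (𝓡 1) (𝓡 1) 1 φ) (t : ℝ) :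
    deriv (fun s : ℝ => (φ (Circle.exp s) : ℂ)) t
      = Complex.I * angDeriv φ (Circle.exp t) * φ (Circle.exp t) := by
  have hd : ∀ s, HasDerivAt (fun s : ℝ => (φ (Circle.exp s) : ℂ))
      (deriv (fun s : ℝ => (φ (Circle.exp s) : ℂ)) s) s := fun s =>
    ((contDiff_comp_exp h).differentiable one_ne_zero s).hasDerivAt
  have hn : ∀ z : Circle, conj (z : ℂ) * z = 1 := fun z => by
    rw [Complex.conj_mul', Circle.norm_coe]; simp
  have hre : (conj (φ (Circle.exp t) : ℂ)
      * deriv (fun s : ℝ => (φ (Circle.exp s) : ℂ)) t).re = 0 := by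
    have h1 := ((Complex.conjCLE : ℂ →L[ℝ] ℂ).hasFDerivAt.comp_hasDerivAt t (hd t)).mul (hd t)
    have h2 : HasDerivAt (fun _ : ℝ => (1 : ℂ)) 0 t := hasDerivAt_const t 1
    have h3 := h1.unique (h2.congr_of_eventuallyEq (Eventually.of_forall fun s => by
      simp [hn]))
    simp only [ContinuousLinearEquiv.coe_coe, Function.comp, Complex.conjCLE_apply] at h3
    have h4 := congrArg Complex.re h3
    simp only [Complex.add_re, Complex.mul_re, Complex.conj_re, Complex.conj_im,
      Complex.zero_re] at h4 ⊢
    linarith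
  have him := angDeriv_exp φ t
  set z := (φ (Circle.exp t) : ℂ) with hz
  set z' := deriv (fun s : ℝ => (φ (Circle.exp s) : ℂ)) t
  have e : conj z * z' = Complex.I * angDeriv φ (Circle.exp t) := by
    apply Complex.ext
    · rw [hre]; simp
    · rw [← him]; simp
  calc z' = (conj z * z) * z' := by rw [hz, hn, one_mul]
    _ = conj z * z' * z := by ring
    _ = _ := by rw [e]

/-- A map of the circle lifts to a primitive of its angular derivative. -/
theorem exists_lift {φ : Circle → Circle} (h : ContMDiff (𝓡 1) (𝓡 1) 1 φ) :
    ∃ Φ : ℝ → ℝ, (∀ t, HasDerivAt Φ (angDeriv φ (Circle.exp t)) t) ∧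
      ∀ t, φ (Circle.exp t) = Circle.exp (Φ t) := by
  have hc : Continuous fun t : ℝ => angDeriv φ (Circle.exp t) :=
    (contDiff_angDeriv_exp (n := 0) (by simpa using h)).continuous
  set Φ : ℝ → ℝ := fun t =>
    Complex.arg (φ (Circle.exp 0)) + ∫ s in (0 : ℝ)..t, angDeriv φ (Circle.exp s) with hΦ
  have hd : ∀ t, HasDerivAt Φ (angDeriv φ (Circle.exp t)) t := fun t =>
    (intervalIntegral.integral_hasDerivAt_right (hc.intervalIntegrable _ _)
      (hc.stronglyMeasurableAtFilter _ _) hc.continuousAt).const_add _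
  refine ⟨Φ, hd, fun t => ?_⟩
  have hz : ∀ s, HasDerivAt (fun s : ℝ => (φ (Circle.exp s) : ℂ))
      (Complex.I * angDeriv φ (Circle.exp s) * φ (Circle.exp s)) s := fun s => by
    rw [← deriv_comp_exp h]
    exact ((contDiff_comp_exp h).differentiable one_ne_zero s).hasDerivAt
  -- The map and `e^{iΦ}` solve the same linear equation, so their quotient is constant; it is `1`
  -- at `0` by the choice of the initial argument.
  have hg : ∀ s, HasDerivAt (fun s : ℝ => (φ (Circle.exp s) : ℂ)
      * Complex.exp (-((Φ s : ℂ) * Complex.I))) 0 s := by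
    intro s
    refine ((hz s).mul (((hd s).ofReal_comp.mul_const Complex.I).neg.cexp)).congr_deriv ?_
    ring
  have hconst := is_const_of_deriv_eq_zero (fun s => (hg s).differentiableAt)
    (fun s => (hg s).deriv) t 0
  have h0 : Circle.exp (Φ 0) = φ (Circle.exp 0) := by
    simp only [hΦ, intervalIntegral.integral_same, add_zero]
    exact Circle.exp_arg _
  have e0 : (φ (Circle.exp 0) : ℂ) * Complex.exp (-((Φ 0 : ℂ) * Complex.I)) = 1 := by
    rw [← h0, Circle.coe_exp, ← Complex.exp_add]; simp
  simp only [e0] at hconst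
  apply Circle.ext
  rw [Circle.coe_exp]
  rw [Complex.exp_neg] at hconst
  exact (mul_inv_eq_one₀ (Complex.exp_ne_zero _)).1 hconst

theorem integral_dtheta {f : Circle → ℝ} (hf : AEStronglyMeasurable f dtheta) :
    ∫ p, f p ∂dtheta = ∫ t in (0 : ℝ)..(2 * π), f (Circle.exp t) := by
  rw [dtheta, integral_map Circle.exp.continuous.measurable.aemeasurable hf,
    intervalIntegral.integral_of_le Real.two_pi_pos.le, integral_Ico_eq_integral_Ioc]

theorem intervalIntegrable_exp {f : Circle → ℝ} (hf : Integrable f dtheta) (a b : ℝ) :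
    IntervalIntegrable (fun t => f (Circle.exp t)) volume a b := by
  have h1 : IntegrableOn (fun t => f (Circle.exp t)) (Ico 0 (2 * π)) :=
    (integrable_map_measure hf.1 Circle.exp.continuous.measurable.aemeasurable).1 hf
  have hper : Function.Periodic (fun t => f (Circle.exp t)) (2 * π) := fun t => by
    simp only [Circle.exp_add_two_pi]
  refine hper.intervalIntegrable₀ Real.two_pi_pos.ne' ?_ a b
  rw [intervalIntegrable_iff_integrableOn_Ico_of_le Real.two_pi_pos.le]
  exact h1

instance isFiniteMeasure_dtheta : IsFiniteMeasure dtheta := by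
  unfold dtheta
  infer_instance

/-! ### Weak derivatives -/

/-- The zero coefficient sequence is summable, so the Fourier series converges pointwise to the
continuous function itself. -/
theorem eq_zero_of_fourier {g : ℝ → ℝ} (hg : Continuous g) (hper : Function.Periodic g (2 * π))
    (hc : ∀ n : ℤ, ∫ t in (0 : ℝ)..(2 * π), g t * cos (n * t) = 0)
    (hs : ∀ n : ℤ, ∫ t in (0 : ℝ)..(2 * π), g t * sin (n * t) = 0) (t : ℝ) : g t = 0 := by
  have : Fact (0 < 2 * π) := ⟨Real.two_pi_pos⟩
  have hperC : Function.Periodic (fun t => (g t : ℂ)) (2 * π) := fun t => by simp only [hper t]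
  let f : C(AddCircle (2 * π), ℂ) := ⟨hperC.lift, by
    refine continuous_coinduced_dom.2 ?_
    exact Complex.continuous_ofReal.comp hg⟩
  have hcoeff : fourierCoeff f = 0 := by
    funext n
    rw [fourierCoeff_eq_intervalIntegral _ _ 0, zero_add]
    have : ∀ x : ℝ, fourier (-n) (x : AddCircle (2 * π)) • f x
        = ((g x * cos (n * x) : ℝ) : ℂ) - ((g x * sin (n * x) : ℝ) : ℂ) * Complex.I := by
      intro x
      have e1 : f x = (g x : ℂ) := rfl
      rw [e1, fourier_coe_apply, show (2 * (π : ℂ) * Complex.I * ((-n : ℤ) : ℂ) * x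
        / ((2 * π : ℝ) : ℂ)) = ((-(n * x) : ℝ) : ℂ) * Complex.I by
          have := Complex.ofReal_ne_zero.2 Real.pi_ne_zero
          push_cast; field_simp, Complex.exp_mul_I, ← Complex.ofReal_cos,
        ← Complex.ofReal_sin, Real.cos_neg, Real.sin_neg]
      push_cast
      rw [smul_eq_mul]; ring
    simp_rw [this]
    rw [intervalIntegral.integral_sub, intervalIntegral.integral_mul_const,
      intervalIntegral.integral_ofReal, intervalIntegral.integral_ofReal, hc, hs]
    · simp
    · exact Continuous.intervalIntegrable (by fun_prop) _ _
    · exact Continuous.intervalIntegrable (by fun_prop) _ _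
  have hsum : Summable (fourierCoeff f) := by rw [hcoeff]; exact summable_zero
  have h1 := has_pointwise_sum_fourier_series_of_summable hsum (t : AddCircle (2 * π))
  simp only [hcoeff, Pi.zero_apply, zero_smul] at h1
  have h2 : f (t : AddCircle (2 * π)) = 0 := h1.unique hasSum_zero
  have e1 : f (t : AddCircle (2 * π)) = (g t : ℂ) := rfl
  rw [e1] at h2
  exact_mod_cast h2

theorem contMDiff_zpow (n : ℤ) : ContMDiff (𝓡 1) (𝓡 1) ∞ fun p : Circle => p ^ n := by
  have hI : LieGroup (𝓡 1) ∞ Circle := LieGroup.of_le (n := ω) le_top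
  cases n with
  | ofNat n => simpa using contMDiff_pow (I := 𝓡 1) (G := Circle) (n := ∞) n
  | negSucc n =>
    simp only [zpow_negSucc]
    exact (contMDiff_pow (I := 𝓡 1) (G := Circle) (n := ∞) (n + 1)).inv

theorem coe_zpow_exp (n : ℤ) (t : ℝ) :
    ((Circle.exp t ^ n : Circle) : ℂ) = ⟨cos (n * t), sin (n * t)⟩ := by
  rw [Circle.coe_zpow, Circle.coe_exp, ← Complex.exp_int_mul, ← mul_assoc,
    show (n : ℂ) * t = ((n * t : ℝ) : ℂ) by push_cast; rfl]
  exact Complex.ext (Complex.exp_ofReal_mul_I_re _) (Complex.exp_ofReal_mul_I_im _)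

theorem partialTheta_exp (f : Circle → ℝ) (t : ℝ) :
    partialTheta f (Circle.exp t) = deriv (fun s => f (Circle.exp s)) t := by
  simp only [partialTheta, ← Circle.exp_add]
  rw [deriv_comp_const_add (f := fun s : ℝ => f (Circle.exp s)), add_zero]

/-- Testing a weak derivative against a smooth function. -/
theorem IsWeakDeriv.integral_eq {u v : Circle → ℝ} (hu : AEStronglyMeasurable u dtheta)
    (hv : AEStronglyMeasurable v dtheta) (h : IsWeakDeriv u v) {ζ : Circle → ℝ}
    (hζ : ContMDiff (𝓡 1) 𝓘(ℝ, ℝ) ∞ ζ) {z z' : ℝ → ℝ} (hz : ∀ t, ζ (Circle.exp t) = z t)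
    (hz' : ∀ t, HasDerivAt z (z' t) t) (hzc : Continuous z') :
    ∫ t in (0 : ℝ)..(2 * π), u (Circle.exp t) * z' t
      = -∫ t in (0 : ℝ)..(2 * π), v (Circle.exp t) * z t := by
  have hp : ∀ t, partialTheta ζ (Circle.exp t) = z' t := fun t => by
    rw [partialTheta_exp, ← (hz' t).deriv]
    congr 1; funext s; exact hz s
  have hpc : Continuous (partialTheta ζ) := by
    rw [isQuotientMap_circleExp.continuous_iff]
    convert! hzc using 1
    funext t; exact hp t
  have h1 := h ζ hζ
  rw [integral_dtheta (f := fun p => u p * partialTheta ζ p) (hu.mul hpc.aestronglyMeasurable),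
    integral_dtheta (f := fun p => v p * ζ p)
      (hv.mul hζ.continuous.aestronglyMeasurable)] at h1
  simpa only [hp, hz] using h1

/-- A continuous function on the circle is the primitive of its weak derivative. -/
theorem IsWeakDeriv.ftc {u v : Circle → ℝ} (hu : Continuous u) (hv : MemLp v 2 dtheta)
    (h : IsWeakDeriv u v) (a b : ℝ) :
    ∫ t in a..b, v (Circle.exp t) = u (Circle.exp b) - u (Circle.exp a) := by
  have hvi : ∀ a b, IntervalIntegrable (fun t => v (Circle.exp t)) volume a b :=
    intervalIntegrable_exp (hv.integrable one_le_two)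
  -- Only trigonometric test functions are used: the real and imaginary parts of `p ^ n`.
  have hcos : ∀ n : ℤ, ∫ t in (0 : ℝ)..(2 * π), u (Circle.exp t) * (-(sin (n * t) * n))
      = -∫ t in (0 : ℝ)..(2 * π), v (Circle.exp t) * cos (n * t) := fun n =>
    h.integral_eq hu.aestronglyMeasurable hv.1
      (ζ := fun p => ((p ^ n : Circle) : ℂ).re)
      (Complex.reCLM.contDiff.contMDiff.comp (contMDiff_circle_coe.comp (contMDiff_zpow n)))
      (fun t => by rw [coe_zpow_exp])
      (fun t => by simpa using ((hasDerivAt_id t).const_mul (n : ℝ)).cos) (by fun_prop)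
  have hsin : ∀ n : ℤ, ∫ t in (0 : ℝ)..(2 * π), u (Circle.exp t) * (cos (n * t) * n)
      = -∫ t in (0 : ℝ)..(2 * π), v (Circle.exp t) * sin (n * t) := fun n =>
    h.integral_eq hu.aestronglyMeasurable hv.1
      (ζ := fun p => ((p ^ n : Circle) : ℂ).im)
      (Complex.imCLM.contDiff.contMDiff.comp (contMDiff_circle_coe.comp (contMDiff_zpow n)))
      (fun t => by rw [coe_zpow_exp])
      (fun t => by simpa using ((hasDerivAt_id t).const_mul (n : ℝ)).sin) (by fun_prop)
  -- Testing against the constant `1` gives mean zero, which makes the primitive `U` periodic.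
  have hmean : ∫ t in (0 : ℝ)..(2 * π), v (Circle.exp t) = 0 := by
    have := hcos 0
    simp only [Int.cast_zero, zero_mul, mul_zero, Real.cos_zero, mul_one, neg_zero,
      intervalIntegral.integral_zero] at this
    linarith
  have hvper : Function.Periodic (fun t => v (Circle.exp t)) (2 * π) := fun t => by
    simp only [Circle.exp_add_two_pi]
  set U : ℝ → ℝ := fun x => ∫ t in (0 : ℝ)..x, v (Circle.exp t) with hU
  have hUc : Continuous U := intervalIntegral.continuous_primitive hvi 0
  have hUper : Function.Periodic U (2 * π) := by
    intro x
    have h1 : U (x + 2 * π) - U x = ∫ t in x..(x + 2 * π), v (Circle.exp t) :=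
      intervalIntegral.integral_interval_sub_left (hvi _ _) (hvi _ _)
    have h2 := hvper.intervalIntegral_add_eq 0 x
    rw [zero_add] at h2
    rw [← h2, hmean] at h1
    linarith
  have hUac : AbsolutelyContinuousOnInterval U 0 (2 * π) :=
    (hvi 0 (2 * π)).absolutelyContinuousOnInterval_intervalIntegral (by simp)
  have hUd : ∀ᵐ t, t ∈ uIoc (0 : ℝ) (2 * π) → deriv U t = v (Circle.exp t) := by
    filter_upwards [(hvi 0 (2 * π)).ae_hasDerivAt_integral] with t ht hm
    exact (ht (uIoc_subset_uIcc hm) 0 (by simp)).deriv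
  have hparts : ∀ z z' : ℝ → ℝ, (∀ t, HasDerivAt z (z' t) t) → Continuous z' →
      z 0 = z (2 * π) → ∫ t in (0 : ℝ)..(2 * π), U t * z' t
        = -∫ t in (0 : ℝ)..(2 * π), v (Circle.exp t) * z t := by
    intro z z' hz hz' h0
    have hzac : AbsolutelyContinuousOnInterval z 0 (2 * π) :=
      absolutelyContinuousOnInterval_of_hasDerivAt (fun t _ => hz t) hz'.continuousOn
    have h1 := hUac.integral_mul_deriv_eq_deriv_mul hzac
    have h2 : U (2 * π) = 0 := hmean
    have h3 : U 0 = 0 := intervalIntegral.integral_same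
    have h4 : ∫ t in (0 : ℝ)..(2 * π), deriv U t * z t
        = ∫ t in (0 : ℝ)..(2 * π), v (Circle.exp t) * z t := by
      refine intervalIntegral.integral_congr_ae ?_
      filter_upwards [hUd] with t ht hm
      rw [ht hm]
    have h5 : deriv z = z' := funext fun t => (hz t).deriv
    rw [h2, h3, h4, h5] at h1
    linarith
  have huc : Continuous fun t => u (Circle.exp t) := hu.comp Circle.exp.continuous
  -- Both `u` and `U` have weak derivative `v`, so every nonconstant Fourier coefficient of `g`
  -- vanishes and `g` equals its mean.
  set g : ℝ → ℝ := fun t => u (Circle.exp t) - U t with hg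
  have hgc : Continuous g := huc.sub hUc
  have hgper : Function.Periodic g (2 * π) := fun t => by
    simp only [hg, Circle.exp_add_two_pi, hUper t]
  have hgz : ∀ z : ℝ → ℝ, Continuous z → ∫ t in (0 : ℝ)..(2 * π), g t * z t
      = (∫ t in (0 : ℝ)..(2 * π), u (Circle.exp t) * z t)
        - ∫ t in (0 : ℝ)..(2 * π), U t * z t := by
    intro z hz
    rw [← intervalIntegral.integral_sub (f := fun t => u (Circle.exp t) * z t)
      (g := fun t => U t * z t) ((huc.mul hz).intervalIntegrable _ _)
      ((hUc.mul hz).intervalIntegrable _ _)]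
    simp only [hg, sub_mul]
  have gs : ∀ n : ℤ, n ≠ 0 → ∫ t in (0 : ℝ)..(2 * π), g t * sin (n * t) = 0 := by
    intro n hn
    have h1 := hparts (fun t => cos (n * t)) (fun t => -(sin (n * t) * n))
      (fun t => by simpa using ((hasDerivAt_id t).const_mul (n : ℝ)).cos) (by fun_prop)
      (by simp [Real.cos_int_mul_two_pi])
    have h2 := hgz (fun t => -(sin (n * t) * n)) (by fun_prop)
    rw [h1, hcos, sub_self] at h2
    have h3 : ∀ t, g t * -(sin (n * t) * n) = -n * (g t * sin (n * t)) := fun t => by ring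
    simp_rw [h3] at h2
    rw [intervalIntegral.integral_const_mul] at h2
    exact (mul_eq_zero.1 h2).resolve_left (neg_ne_zero.2 (Int.cast_ne_zero.2 hn))
  have gc : ∀ n : ℤ, n ≠ 0 → ∫ t in (0 : ℝ)..(2 * π), g t * cos (n * t) = 0 := by
    intro n hn
    have h1 := hparts (fun t => sin (n * t)) (fun t => cos (n * t) * n)
      (fun t => by simpa using ((hasDerivAt_id t).const_mul (n : ℝ)).sin) (by fun_prop)
      (by have := Real.sin_int_mul_pi (2 * n)
          push_cast at this
          simp only [mul_zero, Real.sin_zero]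
          rw [← this]; congr 1; ring)
    have h2 := hgz (fun t => cos (n * t) * n) (by fun_prop)
    rw [h1, hsin, sub_self] at h2
    have h3 : ∀ t, g t * (cos (n * t) * n) = n * (g t * cos (n * t)) := fun t => by ring
    simp_rw [h3] at h2
    rw [intervalIntegral.integral_const_mul] at h2
    exact (mul_eq_zero.1 h2).resolve_left (Int.cast_ne_zero.2 hn)
  set c : ℝ := (∫ t in (0 : ℝ)..(2 * π), g t) / (2 * π) with hc
  have hgconst : ∀ t, g t - c = 0 := by
    have hsub : ∀ z : ℝ → ℝ, Continuous z → ∫ t in (0 : ℝ)..(2 * π), (g t - c) * z t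
      = (∫ t in (0 : ℝ)..(2 * π), g t * z t) - c * ∫ t in (0 : ℝ)..(2 * π), z t := by
      intro z hz
      rw [← intervalIntegral.integral_const_mul,
        ← intervalIntegral.integral_sub (f := fun t => g t * z t) (g := fun t => c * z t)
        ((hgc.mul hz).intervalIntegrable _ _) ((continuous_const.mul hz).intervalIntegrable _ _)]
      simp only [sub_mul]
    have hi0 : ∀ z z' : ℝ → ℝ, (∀ t, HasDerivAt z (z' t) t) → Continuous z' →
        ∫ t in (0 : ℝ)..(2 * π), z' t = z (2 * π) - z 0 := fun z z' hz hz' =>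
      intervalIntegral.integral_eq_sub_of_hasDerivAt (fun t _ => hz t)
        (hz'.intervalIntegrable _ _)
    refine eq_zero_of_fourier (hgc.sub continuous_const) (fun t => by simp only [hgper t]) ?_ ?_
    · intro n
      rw [hsub _ (by fun_prop)]
      by_cases hn : n = 0
      · have := Real.pi_ne_zero
        simp only [hn, Int.cast_zero, zero_mul, Real.cos_zero, mul_one,
          intervalIntegral.integral_const, sub_zero, smul_eq_mul, hc]
        field_simp
        simp
      · have hn' : (n : ℝ) ≠ 0 := Int.cast_ne_zero.2 hn
        rw [gc n hn, hi0 (fun t => sin (n * t) / n) _ (fun t => by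
          simpa [hn'] using (((hasDerivAt_id t).const_mul (n : ℝ)).sin.div_const (n : ℝ)))
          (by fun_prop)]
        have := Real.sin_int_mul_pi (2 * n)
        push_cast at this
        rw [show (n : ℝ) * (2 * π) = 2 * n * π by ring, this]
        simp
    · intro n
      rw [hsub _ (by fun_prop)]
      by_cases hn : n = 0
      · simp [hn]
      · have hn' : (n : ℝ) ≠ 0 := Int.cast_ne_zero.2 hn
        rw [gs n hn, hi0 (fun t => -cos (n * t) / n) _ (fun t => by
          simpa [hn'] using (((hasDerivAt_id t).const_mul (n : ℝ)).cos.neg.div_const (n : ℝ)))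
          (by fun_prop)]
        simp [Real.cos_int_mul_two_pi]
  have e1 : U b - U a = ∫ t in a..b, v (Circle.exp t) :=
    intervalIntegral.integral_interval_sub_left (hvi _ _) (hvi _ _)
  have e2 := hgconst a
  have e3 := hgconst b
  simp only [hg] at e2 e3
  linarith

theorem contMDiff_of_diffPlus (φ : DiffPlus 1) : ContMDiff (𝓡 1) (𝓡 1) 1 φ.1 := φ.2.1

theorem continuous_angDeriv (φ : DiffPlus 1) : Continuous (angDeriv φ.1) := by
  rw [isQuotientMap_circleExp.continuous_iff]
  exact (contDiff_angDeriv_exp (n := 0) (by simpa using (contMDiff_of_diffPlus φ))).continuous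

/-- The lift of a diffeomorphism in `HDiff`, and its energy. -/
theorem exists_circleLift {φ : DiffPlus 1} (hH : φ ∈ HDiff) :
    ∃ Φ : ℝ → ℝ, CircleLift Φ (fun t => logAngDeriv φ.1 (Circle.exp t))
        (fun t => weakDeriv (logAngDeriv φ.1) (Circle.exp t)) ∧
      (∀ t, φ.1 (Circle.exp t) = Circle.exp (Φ t)) ∧
      EGstar φ.1 = ∫ t in (0 : ℝ)..(2 * π), eDensity (fun t => logAngDeriv φ.1 (Circle.exp t))
        (fun t => weakDeriv (logAngDeriv φ.1) (Circle.exp t)) t := by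
  obtain ⟨h1, h2⟩ := hH
  have hpos := φ.2.2.2
  have hexp : ∀ p, rexp (logAngDeriv φ.1 p) = angDeriv φ.1 p := fun p => Real.exp_log (hpos p)
  have huc : Continuous (logAngDeriv φ.1) :=
    (continuous_angDeriv φ).log fun p => (hpos p).ne'
  have hw : MemLp (weakDeriv (logAngDeriv φ.1)) 2 dtheta ∧
      IsWeakDeriv (logAngDeriv φ.1) (weakDeriv (logAngDeriv φ.1)) := by
    simp only [weakDeriv, dif_pos h1]
    exact Classical.choose_spec h1.2
  obtain ⟨Φ, hd, hΦ⟩ := exists_lift (contMDiff_of_diffPlus φ)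
  have hdc : Continuous fun t => angDeriv φ.1 (Circle.exp t) :=
    (continuous_angDeriv φ).comp Circle.exp.continuous
  have htot : ∫ t in (0 : ℝ)..(2 * π), angDeriv φ.1 (Circle.exp t) = 2 * π := by
    have := integral_dtheta huc.rexp.aestronglyMeasurable
    simp only [hexp] at this h2
    rw [← this, h2]
  have H : CircleLift Φ (fun t => logAngDeriv φ.1 (Circle.exp t))
      (fun t => weakDeriv (logAngDeriv φ.1) (Circle.exp t)) :=
    { hasDerivAt := fun t => by rw [hexp]; exact hd t
      cont := huc.comp Circle.exp.continuous
      -- The constraint `∫ e^u = 2π` says that the lift advances by one full turn.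
      add_two_pi := fun t => by
        have e1 : ∫ s in t..(t + 2 * π), angDeriv φ.1 (Circle.exp s) = Φ (t + 2 * π) - Φ t :=
          intervalIntegral.integral_eq_sub_of_hasDerivAt (fun s _ => hd s)
            (hdc.intervalIntegrable _ _)
        have hper : Function.Periodic (fun s => angDeriv φ.1 (Circle.exp s)) (2 * π) := fun s => by
          simp only [Circle.exp_add_two_pi]
        have e2 := hper.intervalIntegral_add_eq 0 t
        rw [zero_add, htot] at e2
        linarith
      int := intervalIntegrable_exp (hw.1.integrable one_le_two)
      int_sq := intervalIntegrable_exp hw.1.integrable_sq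
      ftc := fun a b => hw.2.ftc huc hw.1 a b
      per := fun t => by simp only [Circle.exp_add_two_pi] }
  refine ⟨Φ, H, hΦ, ?_⟩
  have hm : AEStronglyMeasurable (fun p => (1 / 4 : ℝ) * weakDeriv (logAngDeriv φ.1) p ^ 2
      - rexp (2 * logAngDeriv φ.1 p)) dtheta :=
    ((hw.1.1.pow 2).const_mul _).sub (Continuous.aestronglyMeasurable (by fun_prop))
  have hcont := H.cont
  simp only [EGstar, energy, eDensity]
  rw [integral_dtheta hm, intervalIntegral.integral_add
    (((H.int_sq 0 (2 * π)).const_mul _).sub (Continuous.intervalIntegrable (by fun_prop) _ _))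
    (by simp)]
  simp

/-! ### Balance points -/

theorem exp_add_pi (t : ℝ) : Circle.exp (t + π) = -Circle.exp t := by
  apply Circle.ext
  rw [Circle.coe_exp]
  push_cast
  rw [add_mul, Complex.exp_add, Complex.exp_pi_mul_I]
  simp

/-- The balance condition determines `Φ (t + π) - Φ t` only as `π` modulo `2π`; monotonicity and
injectivity of `φ` confine it to `(0, 2π)`. -/
theorem lift_balance_iff {φ : Equiv.Perm Circle} {Φ : ℝ → ℝ} (hm : StrictMono Φ)
    (hc : Continuous Φ) (hΦ : ∀ t, φ (Circle.exp t) = Circle.exp (Φ t)) (t : ℝ) :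
    φ (-Circle.exp t) = -φ (Circle.exp t) ↔ Φ (t + π) = Φ t + π := by
  rw [← exp_add_pi, hΦ, hΦ, ← exp_add_pi]
  refine ⟨fun h => ?_, fun h => by rw [h]⟩
  have hpi := Real.pi_pos
  have h1 : Φ t < Φ (t + π) := hm (by linarith)
  -- A full turn within a half circle would give a second point with the image of `t`.
  have h2 : Φ (t + π) < Φ t + 2 * π := by
    by_contra hcon
    obtain ⟨s, hs, e⟩ := intermediate_value_Icc (show t ≤ t + π by linarith) hc.continuousOn
      (show Φ t + 2 * π ∈ Icc (Φ t) (Φ (t + π)) from ⟨by linarith, not_lt.1 hcon⟩)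
    have h3 : φ (Circle.exp s) = φ (Circle.exp t) := by
      rw [hΦ, hΦ, e, Circle.exp_add_two_pi]
    have h4 := Circle.exp_injOn_Icc (show t + π - t < 2 * π by linarith) hs
      ⟨le_rfl, by linarith⟩ (φ.injective h3)
    rw [h4] at e
    linarith
  obtain ⟨m, hm⟩ := Circle.exp_eq_exp.1 h
  have hm0 : m = 0 := by
    have a1 : (-1 : ℝ) < m := by
      by_contra hcon
      nlinarith [not_lt.1 hcon]
    have a2 : (m : ℝ) < 1 := by
      by_contra hcon
      nlinarith [not_lt.1 hcon]
    have a1' : -1 < m := by exact_mod_cast a1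
    have a2' : m < 1 := by exact_mod_cast a2
    omega
  rw [hm, hm0]
  simp

theorem neg_mem_balancePoints {φ : Equiv.Perm Circle} {p : Circle} (h : p ∈ balancePoints φ) :
    -p ∈ balancePoints φ := by
  simp only [balancePoints, mem_ofPred_eq] at h ⊢
  rw [h, neg_neg, neg_neg]

/-- Balance points come in antipodal pairs, and four points do not fit into one pair `{P, -P}`.
Replacing `Q` by `-Q` if necessary puts it within the half circle following `P`. -/
theorem exists_two_balance {φ : Equiv.Perm Circle} (h : 4 ≤ nB φ) :
    ∃ p q : ℝ, p ∈ Icc 0 (2 * π) ∧ p < q ∧ q < p + π ∧ Circle.exp p ∈ balancePoints φ ∧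
      Circle.exp q ∈ balancePoints φ := by
  have hne : (balancePoints φ).Nonempty := by
    rw [nonempty_iff_ne_empty]
    intro h0
    simp [nB, h0] at h
  obtain ⟨P, hP⟩ := hne
  have hQ : ∃ Q ∈ balancePoints φ, Q ≠ P ∧ Q ≠ -P := by
    by_contra hcon
    push Not at hcon
    have hsub : balancePoints φ ⊆ {P, -P} := fun Q hQ => by
      by_cases h1 : Q = P
      · simp [h1]
      · simp [hcon Q hQ h1]
    have h1 := (h.trans (encard_le_encard hsub)).trans (encard_insert_le {-P} P)
    rw [encard_singleton] at h1
    exact absurd h1 (by decide)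
  obtain ⟨Q, hQ, hQ1, hQ2⟩ := hQ
  have hper : Function.Periodic Circle.exp (2 * π) := Circle.exp_add_two_pi
  obtain ⟨p', hp'⟩ := Circle.exp_surjective P
  obtain ⟨p, hp, ep⟩ := hper.exists_mem_Ico Real.two_pi_pos p' 0
  obtain ⟨q', hq'⟩ := Circle.exp_surjective Q
  obtain ⟨q, hq, eq⟩ := hper.exists_mem_Ico Real.two_pi_pos q' p
  rw [hp'] at ep
  rw [hq'] at eq
  have hpi := Real.pi_pos
  have hne1 : q ≠ p := by rintro rfl; exact hQ1 (eq.trans ep.symm)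
  have hne2 : q ≠ p + π := by
    rintro rfl
    rw [exp_add_pi, ← ep] at eq
    exact hQ2 eq
  rcases lt_or_gt_of_ne hne2 with h1 | h1
  · exact ⟨p, q, ⟨hp.1, by linarith [hp.2]⟩, lt_of_le_of_ne hq.1 hne1.symm, h1, ep ▸ hP, eq ▸ hQ⟩
  · refine ⟨p, q - π, ⟨hp.1, by linarith [hp.2]⟩, by linarith, by linarith [hq.2], ep ▸ hP, ?_⟩
    have : Circle.exp (q - π) = -Q := by
      have := exp_add_pi (q - π)
      rw [sub_add_cancel, ← eq] at this
      rw [this, neg_neg]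
    rw [this]
    exact neg_mem_balancePoints hQ

/-- Between two pairs of balance points there are points `x` where `φ'` takes the same value at
`x` and `-x`. -/
theorem exists_balance_rolle {φ : DiffPlus 1} (h : φ ∈ BDiff 4) :
    ∃ p q x y : ℝ, p ∈ Icc 0 (2 * π) ∧ p ≤ x ∧ x ≤ q ∧ q ≤ y ∧ y ≤ p + π ∧
      φ.1 (-Circle.exp p) = -φ.1 (Circle.exp p) ∧ φ.1 (-Circle.exp q) = -φ.1 (Circle.exp q) ∧
      angDeriv φ.1 (-Circle.exp x) = angDeriv φ.1 (Circle.exp x) ∧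
      angDeriv φ.1 (-Circle.exp y) = angDeriv φ.1 (Circle.exp y) := by
  obtain ⟨p, q, hp, hpq, hqp, hbp, hbq⟩ := exists_two_balance h
  obtain ⟨Φ, hd, hΦ⟩ := exists_lift (contMDiff_of_diffPlus φ)
  have hm : StrictMono Φ := strictMono_of_deriv_pos fun x => by
    rw [(hd x).deriv]; exact φ.2.2.2 _
  have hc : Continuous Φ := continuous_iff_continuousAt.2 fun t => (hd t).continuousAt
  have hbal := lift_balance_iff hm hc hΦ
  have b1 := (hbal p).1 hbp
  have b2 := (hbal q).1 hbq
  have b3 := (hbal (p + π)).1 (by rw [exp_add_pi]; exact neg_mem_balancePoints hbp)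
  -- This function takes the value `π` at `p`, `q` and `p + π`; Rolle's theorem on the two intervals
  -- gives `x` and `y`.
  have hD : ∀ t, HasDerivAt (fun t => Φ (t + π) - Φ t)
      (angDeriv φ.1 (-Circle.exp t) - angDeriv φ.1 (Circle.exp t)) t := fun t => by
    rw [← exp_add_pi]
    exact ((hd (t + π)).comp_add_const t π).sub (hd t)
  have hDc : Continuous fun t => Φ (t + π) - Φ t := by fun_prop
  obtain ⟨x, hx, ex⟩ := exists_hasDerivAt_eq_zero hpq hDc.continuousOn
    (by simp only [b1, b2]; ring) fun t _ => hD t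
  obtain ⟨y, hy, ey⟩ := exists_hasDerivAt_eq_zero hqp hDc.continuousOn
    (by simp only [b3, b2]; ring) fun t _ => hD t
  exact ⟨p, q, x, y, hp, hx.1.le, hx.2.le, hy.1.le, hy.2.le, hbp, hbq, sub_eq_zero.1 ex,
    sub_eq_zero.1 ey⟩

theorem tendstoUniformly_diffPlus (φ : DiffPlus 1) :
    TendstoUniformly (fun ψ : DiffPlus 1 => (ψ.1 : Circle → Circle)) φ.1 (𝓝 φ) ∧
      TendstoUniformly (fun ψ : DiffPlus 1 => angDeriv ψ.1) (angDeriv φ.1) (𝓝 φ) := by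
  have h1 : Tendsto (fun ψ : DiffPlus 1 => ((UniformFun.ofFun (ψ : Equiv.Perm Circle),
      UniformFun.ofFun (angDeriv ψ.1)) : UniformFun Circle Circle × UniformFun Circle ℝ)) (𝓝 φ)
      (𝓝 (UniformFun.ofFun (φ : Equiv.Perm Circle), UniformFun.ofFun (angDeriv φ.1))) :=
    continuous_induced_dom.tendsto φ
  rw [nhds_prod_eq] at h1
  exact ⟨UniformFun.tendsto_iff_tendstoUniformly.1 (tendsto_fst.comp h1),
    UniformFun.tendsto_iff_tendstoUniformly.1 (tendsto_snd.comp h1)⟩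

/-- A limit of diffeomorphisms with two pairs of balance points either has two pairs of balance
points, or a pair of balance points at which `φ'` takes the same value. -/
theorem balance_of_mem_closure {φ : DiffPlus 1} (hB : φ ∈ closure (BDiff 4)) :
    ∃ p : ℝ, φ.1 (-Circle.exp p) = -φ.1 (Circle.exp p) ∧
      ((∃ q, p < q ∧ q < p + π ∧ φ.1 (-Circle.exp q) = -φ.1 (Circle.exp q)) ∨
        angDeriv φ.1 (-Circle.exp p) = angDeriv φ.1 (Circle.exp p)) := by
  -- Along an ultrafilter every function with values in a compact interval converges, so no
  -- subsequences are needed. All four points lie in `[0, 3π]`.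
  obtain ⟨U, hU, hUφ⟩ := mem_closure_iff_ultrafilter.1 hB
  have hex : ∀ ψ : DiffPlus 1, ∃ p q x y : ℝ, ψ ∈ BDiff 4 → (p ∈ Icc 0 (2 * π) ∧ p ≤ x ∧ x ≤ q ∧
      q ≤ y ∧ y ≤ p + π ∧
      ψ.1 (-Circle.exp p) = -ψ.1 (Circle.exp p) ∧ ψ.1 (-Circle.exp q) = -ψ.1 (Circle.exp q) ∧
      angDeriv ψ.1 (-Circle.exp x) = angDeriv ψ.1 (Circle.exp x) ∧
      angDeriv ψ.1 (-Circle.exp y) = angDeriv ψ.1 (Circle.exp y)) := by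
    intro ψ
    by_cases h : ψ ∈ BDiff 4
    · obtain ⟨p, q, x, y, hh⟩ := exists_balance_rolle h
      exact ⟨p, q, x, y, fun _ => hh⟩
    · exact ⟨0, 0, 0, 0, fun h' => absurd h' h⟩
  choose p q x y hpq using hex
  have hev : ∀ᶠ ψ in (U : Filter (DiffPlus 1)), ψ ∈ BDiff 4 := hU
  have hlim : ∀ f : DiffPlus 1 → ℝ, (∀ᶠ ψ in (U : Filter (DiffPlus 1)), f ψ ∈ Icc 0 (3 * π)) →
      ∃ a, Tendsto f U (𝓝 a) := by
    intro f hf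
    obtain ⟨a, -, ha⟩ := (isCompact_Icc (a := (0 : ℝ)) (b := 3 * π)).ultrafilter_le_nhds'
      (U.map f) hf
    exact ⟨a, ha⟩
  have hpi := Real.pi_pos
  obtain ⟨a, ha⟩ := hlim p (hev.mono fun ψ h => by
    obtain ⟨h1, h2, h3, h4, h5, -⟩ := hpq ψ h
    exact ⟨h1.1, by linarith [h1.2]⟩)
  obtain ⟨b, hb⟩ := hlim q (hev.mono fun ψ h => by
    obtain ⟨h1, h2, h3, h4, h5, -⟩ := hpq ψ h
    exact ⟨by linarith [h1.1], by linarith [h1.2]⟩)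
  obtain ⟨c, hc⟩ := hlim x (hev.mono fun ψ h => by
    obtain ⟨h1, h2, h3, h4, h5, -⟩ := hpq ψ h
    exact ⟨by linarith [h1.1], by linarith [h1.2]⟩)
  obtain ⟨d, hd⟩ := hlim y (hev.mono fun ψ h => by
    obtain ⟨h1, h2, h3, h4, h5, -⟩ := hpq ψ h
    exact ⟨by linarith [h1.1], by linarith [h1.2]⟩)
  obtain ⟨u1, u2⟩ := tendstoUniformly_diffPlus φ
  have hφc : Continuous φ.1 := (contMDiff_of_diffPlus φ).continuous
  have hac := (continuous_angDeriv φ)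
  have e1 : ∀ {g : DiffPlus 1 → ℝ} {l : ℝ}, Tendsto g U (𝓝 l) →
      Tendsto (fun ψ => Circle.exp (g ψ)) U (𝓝 (Circle.exp l)) := fun h =>
    (Circle.exp.continuous.tendsto _).comp h
  have e2 : ∀ {g : DiffPlus 1 → ℝ} {l : ℝ}, Tendsto g U (𝓝 l) →
      Tendsto (fun ψ => -Circle.exp (g ψ)) U (𝓝 (-Circle.exp l)) := fun {g l} h => by
    have := e1 (h.add_const π)
    simpa only [exp_add_pi] using this
  -- Uniform convergence of `φ` and `φ'` allows evaluation at moving points.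
  have t1 : ∀ {g : DiffPlus 1 → Circle} {l : Circle}, Tendsto g U (𝓝 l) →
      Tendsto (fun ψ : DiffPlus 1 => ψ.1 (g ψ)) U (𝓝 (φ.1 l)) := fun h =>
    tendsto_comp_of_locally_uniform_limit hφc.continuousAt h fun V hV =>
      ⟨univ, univ_mem, (u1 V hV).filter_mono hUφ |>.mono fun ψ hψ z _ => hψ z⟩
  have t2 : ∀ {g : DiffPlus 1 → Circle} {l : Circle}, Tendsto g U (𝓝 l) →
      Tendsto (fun ψ : DiffPlus 1 => angDeriv ψ.1 (g ψ)) U (𝓝 (angDeriv φ.1 l)) := fun h =>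
    tendsto_comp_of_locally_uniform_limit hac.continuousAt h fun V hV =>
      ⟨univ, univ_mem, (u2 V hV).filter_mono hUφ |>.mono fun ψ hψ z _ => hψ z⟩
  have hneg : Continuous fun z : Circle => -z := by
    exact (Continuous.neg continuous_subtype_val).subtype_mk _
  have ba : φ.1 (-Circle.exp a) = -φ.1 (Circle.exp a) :=
    tendsto_nhds_unique_of_eventuallyEq (t1 (e2 ha)) ((hneg.tendsto _).comp (t1 (e1 ha)))
      (hev.mono fun ψ h => (hpq ψ h).2.2.2.2.2.1)
  have bb : φ.1 (-Circle.exp b) = -φ.1 (Circle.exp b) :=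
    tendsto_nhds_unique_of_eventuallyEq (t1 (e2 hb)) ((hneg.tendsto _).comp (t1 (e1 hb)))
      (hev.mono fun ψ h => (hpq ψ h).2.2.2.2.2.2.1)
  have dc : angDeriv φ.1 (-Circle.exp c) = angDeriv φ.1 (Circle.exp c) :=
    tendsto_nhds_unique_of_eventuallyEq (t2 (e2 hc)) (t2 (e1 hc))
      (hev.mono fun ψ h => (hpq ψ h).2.2.2.2.2.2.2.1)
  have dd : angDeriv φ.1 (-Circle.exp d) = angDeriv φ.1 (Circle.exp d) :=
    tendsto_nhds_unique_of_eventuallyEq (t2 (e2 hd)) (t2 (e1 hd))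
      (hev.mono fun ψ h => (hpq ψ h).2.2.2.2.2.2.2.2)
  have o1 : a ≤ c := le_of_tendsto_of_tendsto ha hc (hev.mono fun ψ h => (hpq ψ h).2.1)
  have o2 : c ≤ b := le_of_tendsto_of_tendsto hc hb (hev.mono fun ψ h => (hpq ψ h).2.2.1)
  have o3 : b ≤ d := le_of_tendsto_of_tendsto hb hd (hev.mono fun ψ h => (hpq ψ h).2.2.2.1)
  have o4 : d ≤ a + π := le_of_tendsto_of_tendsto hd (ha.add_const π)
    (hev.mono fun ψ h => (hpq ψ h).2.2.2.2.1)
  refine ⟨a, ba, ?_⟩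
  -- If `b = a`, the Rolle point `c` is squeezed onto `a`; if `b = a + π`, then `d` is squeezed onto
  -- `a + π`. Either way `φ'` agrees at `a` and its antipode.
  rcases (o1.trans o2).eq_or_lt with h | h
  · right
    rwa [show c = a by linarith] at dc
  rcases (o3.trans o4).eq_or_lt with h' | h'
  · right
    rw [show d = a + π by linarith, exp_add_pi, neg_neg] at dd
    exact dd.symm
  · exact Or.inl ⟨b, h, h', bb⟩

/-! ### Möbius maps and shears -/

/-- Points of the circle are compared as rays, so Möbius maps and shears can be handled as linear
maps without their normalising factors. -/
theorem circle_eq_of_smul_eq {z w : Circle} {r s : ℝ} (hr : 0 < r) (hs : 0 < s)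
    (h : (r : ℂ) * z = (s : ℂ) * w) : z = w := by
  have h1 := congrArg norm h
  simp only [norm_mul, Complex.norm_real, Circle.norm_coe, mul_one,
    Real.norm_of_nonneg hr.le, Real.norm_of_nonneg hs.le] at h1
  rw [h1] at h
  exact Circle.ext (mul_left_cancel₀ (Complex.ofReal_ne_zero.2 hs.ne') h)

theorem coe_circle_exp (t : ℝ) : (Circle.exp t : ℂ) = ⟨cos t, sin t⟩ := by
  rw [Circle.coe_exp]
  exact Complex.ext (Complex.exp_ofReal_mul_I_re t) (Complex.exp_ofReal_mul_I_im t)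

theorem linAct_mul (L M : Matrix.SpecialLinearGroup (Fin 2) ℝ) (z : ℂ) :
    linAct (L * M) z = linAct L (linAct M z) := by
  simp only [linAct, Matrix.SpecialLinearGroup.coe_mul, Matrix.mul_apply, Fin.sum_univ_two]
  apply Complex.ext <;> simp only <;> ring

theorem linAct_one (z : ℂ) : linAct 1 z = z := by
  simp [linAct]

theorem linAct_smul (L : Matrix.SpecialLinearGroup (Fin 2) ℝ) (r : ℝ) (z : ℂ) :
    linAct L (r * z) = r * linAct L z := by
  simp only [linAct]
  apply Complex.ext <;> simp <;> ring

theorem linAct_ne_zero (L : Matrix.SpecialLinearGroup (Fin 2) ℝ) {z : ℂ} (hz : z ≠ 0) :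
    linAct L z ≠ 0 := by
  intro h
  apply hz
  have h1 := linAct_mul L⁻¹ L z
  rw [inv_mul_cancel, linAct_one, h] at h1
  rw [h1]
  simp only [linAct, Complex.zero_re, Complex.zero_im, mul_zero, add_zero]
  rfl

/-- The Möbius map of the circle defined by a matrix. -/
noncomputable def mobMap (L : Matrix.SpecialLinearGroup (Fin 2) ℝ) (p : Circle) : Circle :=
  ⟨linAct L p / (‖linAct L p‖ : ℂ), mem_sphere_zero_iff_norm.2 <| by
    rw [norm_div, Complex.norm_real, norm_norm]
    exact div_self (norm_ne_zero_iff.2 (linAct_ne_zero L (Circle.coe_ne_zero p)))⟩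

theorem coe_mobMap (L : Matrix.SpecialLinearGroup (Fin 2) ℝ) (p : Circle) :
    (mobMap L p : ℂ) = linAct L p / (‖linAct L p‖ : ℂ) := by
  rfl

theorem mobMap_smul (L : Matrix.SpecialLinearGroup (Fin 2) ℝ) (p : Circle) :
    ((‖linAct L p‖ : ℝ) : ℂ) * mobMap L p = linAct L p := by
  rw [coe_mobMap]
  have : (‖linAct L p‖ : ℂ) ≠ 0 := Complex.ofReal_ne_zero.2
    (norm_ne_zero_iff.2 (linAct_ne_zero L (Circle.coe_ne_zero p)))
  field_simp

theorem mobMap_mobMap (L M : Matrix.SpecialLinearGroup (Fin 2) ℝ) (h : L * M = 1) (p : Circle) :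
    mobMap L (mobMap M p) = p := by
  have n : ∀ (K : Matrix.SpecialLinearGroup (Fin 2) ℝ) (q : Circle), 0 < ‖linAct K q‖ :=
    fun K q => norm_pos_iff.2 (linAct_ne_zero K (Circle.coe_ne_zero q))
  refine circle_eq_of_smul_eq (mul_pos (n M p) (n L (mobMap M p))) one_pos ?_
  rw [Complex.ofReal_mul, mul_assoc, mobMap_smul, ← linAct_smul, mobMap_smul, ← linAct_mul, h,
    linAct_one]
  simp

/-- The Möbius map of the circle defined by a matrix, as a permutation. -/
noncomputable def mobPerm (L : Matrix.SpecialLinearGroup (Fin 2) ℝ) : Equiv.Perm Circle where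
  toFun := mobMap L
  invFun := mobMap L⁻¹
  left_inv p := mobMap_mobMap _ _ (inv_mul_cancel L) p
  right_inv p := mobMap_mobMap _ _ (mul_inv_cancel L) p

/-- Division by the root of the determinant lands in `SL(2, ℝ)` and does not change the action on
rays. -/
theorem exists_matrix {a b c d : ℝ} (h : 0 < a * d - b * c) :
    ∃ L : Matrix.SpecialLinearGroup (Fin 2) ℝ, ∀ z : ℂ,
      (√(a * d - b * c) : ℂ) * linAct L z = ⟨a * z.re + b * z.im, c * z.re + d * z.im⟩ := by
  set δ := √(a * d - b * c) with hδ
  have hδ0 : δ ≠ 0 := (Real.sqrt_pos.2 h).ne'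
  have hδ2 : δ * δ = a * d - b * c := Real.mul_self_sqrt h.le
  refine ⟨⟨!![a / δ, b / δ; c / δ, d / δ], ?_⟩, fun z => ?_⟩
  · rw [Matrix.det_fin_two_of, div_mul_div_comm, div_mul_div_comm, hδ2, ← sub_div]
    exact div_self h.ne'
  · simp only [linAct]
    apply Complex.ext <;> simp <;> field_simp

/-- A permutation that acts on rays like a matrix of positive determinant is Möbius. -/
theorem mem_mob_of_rays {φ : Equiv.Perm Circle} {a b c d : ℝ} (h : 0 < a * d - b * c)
    (hφ : ∀ t, ∃ r : ℝ, 0 < r ∧ (r : ℂ) * φ (Circle.exp t)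
      = ⟨a * cos t + b * sin t, c * cos t + d * sin t⟩) : φ ∈ Mob := by
  obtain ⟨L, hL⟩ := exists_matrix h
  refine ⟨L, fun p => ?_⟩
  obtain ⟨t, rfl⟩ := Circle.exp_surjective p
  obtain ⟨r, hr, e⟩ := hφ t
  rw [← coe_mobMap]
  congr 1
  have n : 0 < ‖linAct L (Circle.exp t)‖ :=
    norm_pos_iff.2 (linAct_ne_zero L (Circle.coe_ne_zero _))
  refine circle_eq_of_smul_eq hr (mul_pos (Real.sqrt_pos.2 h) n) ?_
  rw [Complex.ofReal_mul, mul_assoc, mobMap_smul, hL, e, coe_circle_exp]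

/-- Matrices of positive determinant define Möbius maps. -/
theorem exists_mob_of_matrix {a b c d : ℝ} (h : 0 < a * d - b * c) :
    ∃ φ ∈ Mob, ∀ t, ∃ r : ℝ, 0 < r ∧ (r : ℂ) * φ (Circle.exp t)
      = ⟨a * cos t + b * sin t, c * cos t + d * sin t⟩ := by
  obtain ⟨L, hL⟩ := exists_matrix h
  refine ⟨mobPerm L, ⟨L, fun p => coe_mobMap L p⟩, fun t => ?_⟩
  have n : 0 < ‖linAct L (Circle.exp t)‖ :=
    norm_pos_iff.2 (linAct_ne_zero L (Circle.coe_ne_zero _))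
  refine ⟨_, mul_pos (Real.sqrt_pos.2 h) n, ?_⟩
  rw [Complex.ofReal_mul, mul_assoc]
  have e : mobPerm L (Circle.exp t) = mobMap L (Circle.exp t) := rfl
  rw [e, mobMap_smul, hL, coe_circle_exp]

theorem rays_of_mem_mob {φ : Equiv.Perm Circle} (h : φ ∈ Mob) :
    ∃ a b c d : ℝ, a * d - b * c = 1 ∧ ∀ t, ∃ r : ℝ, 0 < r ∧ (r : ℂ) * φ (Circle.exp t)
      = ⟨a * cos t + b * sin t, c * cos t + d * sin t⟩ := by
  obtain ⟨L, hL⟩ := h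
  refine ⟨L 0 0, L 0 1, L 1 0, L 1 1, ?_, fun t => ?_⟩
  · rw [← Matrix.det_fin_two]; exact L.2
  · have n : 0 < ‖linAct L (Circle.exp t)‖ :=
      norm_pos_iff.2 (linAct_ne_zero L (Circle.coe_ne_zero _))
    refine ⟨_, n, ?_⟩
    rw [hL, ← coe_mobMap, mobMap_smul, linAct, coe_circle_exp]

theorem mem_mob_of_rotation {φ ψ : Equiv.Perm Circle} (hψ : ψ ∈ Mob) (r : Circle)
    (h : ∀ p, φ p = r * ψ p) : φ ∈ Mob := by
  obtain ⟨a, b, c, d, hdet, hr⟩ := rays_of_mem_mob hψ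
  obtain ⟨s, rfl⟩ := Circle.exp_surjective r
  refine mem_mob_of_rays (a := cos s * a - sin s * c) (b := cos s * b - sin s * d)
    (c := sin s * a + cos s * c) (d := sin s * b + cos s * d) ?_ fun t => ?_
  · have := Real.sin_sq_add_cos_sq s
    have e : (cos s * a - sin s * c) * (sin s * b + cos s * d)
        - (cos s * b - sin s * d) * (sin s * a + cos s * c)
        = (sin s ^ 2 + cos s ^ 2) * (a * d - b * c) := by ring
    rw [e, this, hdet]; norm_num
  · obtain ⟨x, hx, e⟩ := hr t
    refine ⟨x, hx, ?_⟩
    rw [h, Circle.coe_mul, mul_left_comm, e, coe_circle_exp]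
    apply Complex.ext <;> simp <;> ring

/-! ### The map `psi τ` as a piecewise linear shear -/

theorem exp_theta (p : Circle) : Circle.exp (theta p) = p := by
  rw [theta, toIcoMod, Circle.periodic_exp.sub_zsmul_eq]
  exact Circle.exp_arg p

theorem theta_mem_Ioo_iff (p : Circle) :
    theta p ∈ Ioo (π / 2) (3 * π / 2) ↔ (p : ℂ).re < 0 := by
  have h1 : (p : ℂ).re = cos (theta p) := by
    conv_lhs => rw [← exp_theta p, coe_circle_exp]
  have h2 : theta p ∈ Ico 0 (0 + 2 * π) := toIcoMod_mem_Ico Real.two_pi_pos 0 _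
  have hpi := Real.pi_pos
  rw [h1]
  constructor
  · intro h
    exact cos_neg_of_pi_div_two_lt_of_lt h.1 (by linarith [h.2])
  · intro h
    by_contra hcon
    rw [mem_Ioo, not_and_or, not_lt, not_lt] at hcon
    rcases hcon with h3 | h3
    · have := cos_nonneg_of_mem_Icc (x := theta p) ⟨by linarith [h2.1], h3⟩
      linarith
    · have := cos_nonneg_of_mem_Icc (x := theta p - 2 * π)
        ⟨by linarith, by linarith [h2.2]⟩
      rw [Real.cos_sub_two_pi] at this
      linarith

theorem psi_of_nonneg (τ : ℝ) {p : Circle} (h : 0 ≤ (p : ℂ).re) : psi τ p = p := by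
  rw [psi, if_neg]
  rw [theta_mem_Ioo_iff]
  exact not_lt.2 h

/-- On the left half circle, the map `psi τ` is a shear. -/
theorem psi_of_neg (τ : ℝ) {p : Circle} (h : (p : ℂ).re < 0) :
    ∃ r : ℝ, 0 < r ∧ (r : ℂ) * psi τ p = ⟨(p : ℂ).re, (p : ℂ).im - τ * (p : ℂ).re⟩ := by
  have hmem := (theta_mem_Ioo_iff p).2 h
  have h1 : (p : ℂ) = ⟨cos (theta p), sin (theta p)⟩ := by
    conv_lhs => rw [← exp_theta p, coe_circle_exp]
  rw [psi, if_pos hmem]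
  set θ := theta p
  rw [h1] at h ⊢
  simp only at h ⊢
  set w := τ + Real.cot (θ - π / 2) with hw
  -- Since `cot (θ - π/2) = -tan θ`, the image direction is `(-1, w)`, and `-cos θ` times it is the
  -- sheared vector.
  have hw' : w = τ - sin θ / cos θ := by
    rw [hw, Real.cot_eq_cos_div_sin, Real.cos_sub_pi_div_two, Real.sin_sub_pi_div_two, div_neg]
    ring
  have hc : 0 < cos (arctan w) := Real.cos_arctan_pos w
  refine ⟨-cos θ / cos (arctan w), div_pos (by linarith) hc, ?_⟩
  have hs : sin (arctan w) = w * cos (arctan w) := by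
    conv_rhs => rw [← Real.tan_arctan w, Real.tan_arctan w]
    rw [← Real.tan_mul_cos hc.ne', Real.tan_arctan]
  rw [coe_circle_exp, Real.cos_add_pi_div_two, Real.sin_add_pi_div_two, arccot,
    Real.sin_pi_div_two_sub, Real.cos_pi_div_two_sub, hs]
  apply Complex.ext
  · simp only [Complex.mul_re, Complex.ofReal_re, Complex.ofReal_im, zero_mul, sub_zero]
    field_simp
  · simp only [Complex.mul_im, Complex.ofReal_re, Complex.ofReal_im, zero_mul, add_zero]
    rw [hw']
    have := h.ne
    field_simp
    ring

theorem psi_zero (p : Circle) : psi 0 p = p := by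
  rcases lt_or_ge (p : ℂ).re 0 with h | h
  · obtain ⟨r, hr, e⟩ := psi_of_neg 0 h
    refine circle_eq_of_smul_eq hr one_pos ?_
    rw [e]
    simp
  · exact psi_of_nonneg 0 h

/-! ### The equality cases -/

theorem exp_sub_add (a b : ℝ) :
    Circle.exp a = Circle.exp (b - π / 2) * Circle.exp (a - b + π / 2) := by
  rw [← Circle.exp_add]; congr 1; ring

namespace CircleLift

variable {Φ u v : ℝ → ℝ} (H : CircleLift Φ u v) {φ : Equiv.Perm Circle}
  (hΦ : ∀ t, φ (Circle.exp t) = Circle.exp (Φ t))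

include H hΦ

/-- In the basis `e^{iΦ p}`, `e^{iΦ q}` the coordinates of `e^{iΦ t}` are, up to constants, `sin (Φ
t - Φ q)` and `sin (Φ t - Φ p)`. By `h` these are a common positive factor `Y` times linear
functions of `e^{it}`. -/
theorem mem_mob_of_simple {p q l : ℝ} (hp : Φ (p + π) = Φ p + π) (hq : Φ (q + π) = Φ q + π)
    (h1 : p < q) (h2 : q < p + π) (hl : 0 < l)
    (h : ∀ t, sin (Φ t - Φ p) * sin (t - q) = l * (sin (Φ t - Φ q) * sin (t - p))) :
    φ ∈ Mob := by
  have m1 := H.strictMono h1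
  have m2 := H.strictMono h2
  rw [hp] at m2
  have s1 : 0 < sin (q - p) := sin_pos_of_pos_of_lt_pi (by linarith) (by linarith)
  have s2 : 0 < sin (Φ q - Φ p) := sin_pos_of_pos_of_lt_pi (by linarith) (by linarith)
  have hY : ∀ t, ∃ Y, 0 < Y ∧ sin (Φ t - Φ p) = l * Y * sin (t - p) ∧
      sin (Φ t - Φ q) = Y * sin (t - q) := by
    intro t
    -- At `q` and its antipode the natural quotient is `0 / 0`, and `Y` is taken from the relation
    -- at `p` instead.
    by_cases ht : sin (t - q) = 0
    · have e := H.sin_comp_eq_zero hq ht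
      have htp : sin (t - p) ≠ 0 := by
        intro h0
        have e1 : sin (q - p) = sin (t - p) * cos (t - q) - cos (t - p) * sin (t - q) := by
          rw [← Real.sin_sub]; congr 1; ring
        rw [e1, h0, ht] at s1
        simp at s1
      refine ⟨sin (Φ t - Φ p) / sin (t - p) / l, div_pos (H.sin_div_sin_pos hp htp) hl, ?_, ?_⟩
      · field_simp
      · rw [e, ht, mul_zero]
    · refine ⟨sin (Φ t - Φ q) / sin (t - q), H.sin_div_sin_pos hq ht, ?_, ?_⟩
      · have := h t
        field_simp
        linarith
      · field_simp
  refine mem_mob_of_rays (a := -l * sin p * cos (Φ q) + sin q * cos (Φ p))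
    (b := l * cos p * cos (Φ q) - cos q * cos (Φ p))
    (c := -l * sin p * sin (Φ q) + sin q * sin (Φ p))
    (d := l * cos p * sin (Φ q) - cos q * sin (Φ p)) ?_ fun t => ?_
  · have := mul_pos hl (mul_pos s1 s2)
    rw [Real.sin_sub, Real.sin_sub] at this
    linarith
  · obtain ⟨Y, hY0, e1, e2⟩ := hY t
    refine ⟨sin (Φ q - Φ p) / Y, div_pos s2 hY0, ?_⟩
    have e3 : sin (Φ q - Φ p) * cos (Φ t)
        = sin (Φ t - Φ p) * cos (Φ q) - sin (Φ t - Φ q) * cos (Φ p) := by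
      simp only [Real.sin_sub]; ring
    have e4 : sin (Φ q - Φ p) * sin (Φ t)
        = sin (Φ t - Φ p) * sin (Φ q) - sin (Φ t - Φ q) * sin (Φ p) := by
      simp only [Real.sin_sub]; ring
    rw [e1, e2, Real.sin_sub t, Real.sin_sub t] at e3 e4
    rw [hΦ, coe_circle_exp]
    apply Complex.ext
    · simp only [Complex.mul_re, Complex.ofReal_re, Complex.ofReal_im, zero_mul, sub_zero]
      rw [div_mul_eq_mul_div, e3]
      field_simp
      ring
    · simp only [Complex.mul_im, Complex.ofReal_re, Complex.ofReal_im, zero_mul, add_zero]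
      rw [div_mul_eq_mul_div, e4]
      field_simp
      ring

/-- A rotation turns `Φ p` to `π / 2`. The matrix realises the cotangent relation with constant
`c₂`, sending `e^{it}` to the ray of `(-sin (t - p), κ cos (t - p) + c₂ sin (t - p))`. The first
half circle goes to the left half plane, where the shear replaces `c₂` by `c₁`; the second is left
alone by `psi`. -/
theorem exists_shear_of_cot {p κ c₁ c₂ : ℝ} (hp : Φ (p + π) = Φ p + π) (hκ : 0 < κ)
    (h1 : ∀ t ∈ Ioo p (p + π), cos (Φ t - Φ p) / sin (Φ t - Φ p)
      = κ * (cos (t - p) / sin (t - p)) + c₁)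
    (h2 : ∀ t ∈ Ioo (p + π) (p + 2 * π), cos (Φ t - Φ p) / sin (Φ t - Φ p)
      = κ * (cos (t - p) / sin (t - p)) + c₂) :
    ∃ (r : Circle) (ψ : Equiv.Perm Circle), ψ ∈ Mob ∧ ∀ P, φ P = r * psi (c₁ - c₂) (ψ P) := by
  obtain ⟨ψ, hψ, hr⟩ := exists_mob_of_matrix (a := sin p) (b := -cos p)
    (c := κ * cos p - c₂ * sin p) (d := κ * sin p + c₂ * cos p) (by
      have := Real.sin_sq_add_cos_sq p
      have e : sin p * (κ * sin p + c₂ * cos p) - -cos p * (κ * cos p - c₂ * sin p)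
        = κ * (sin p ^ 2 + cos p ^ 2) := by ring
      rw [e, this, mul_one]; exact hκ)
  refine ⟨Circle.exp (Φ p - π / 2), ψ, hψ, fun P => ?_⟩
  obtain ⟨t', rfl⟩ := Circle.exp_surjective P
  have hper : Function.Periodic Circle.exp (2 * π) := Circle.exp_add_two_pi
  obtain ⟨t, ht, et⟩ := hper.exists_mem_Ico Real.two_pi_pos t' p
  rw [et, hΦ, exp_sub_add (Φ t) (Φ p)]
  congr 1
  obtain ⟨r, hr0, er⟩ := hr t
  have er' : (r : ℂ) * ψ (Circle.exp t)
      = ⟨-sin (t - p), κ * cos (t - p) + c₂ * sin (t - p)⟩ := by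
    rw [er]
    apply Complex.ext <;> simp only [Real.sin_sub, Real.cos_sub] <;> ring
  have er1 : r * (ψ (Circle.exp t) : ℂ).re = -sin (t - p) := by
    simpa using congrArg Complex.re er'
  have er2 : r * (ψ (Circle.exp t) : ℂ).im = κ * cos (t - p) + c₂ * sin (t - p) := by
    simpa using congrArg Complex.im er'
  have ev : (Circle.exp (Φ t - Φ p + π / 2) : ℂ) = ⟨-sin (Φ t - Φ p), cos (Φ t - Φ p)⟩ := by
    rw [coe_circle_exp, Real.cos_add_pi_div_two, Real.sin_add_pi_div_two]
  have hpi := Real.pi_pos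
  have hre : 0 ≤ -sin (t - p) → 0 ≤ (ψ (Circle.exp t) : ℂ).re := fun h => by
    rw [← er1] at h
    exact nonneg_of_mul_nonneg_right h hr0
  by_cases ht1 : t = p
  · rw [psi_of_nonneg _ (hre (by simp [ht1]))]
    refine circle_eq_of_smul_eq hκ hr0 ?_
    rw [er', ev, ht1]
    apply Complex.ext <;> simp
  by_cases ht2 : t = p + π
  · rw [psi_of_nonneg _ (hre (by simp [ht2]))]
    refine circle_eq_of_smul_eq hκ hr0 ?_
    rw [er', ev, ht2, hp]
    apply Complex.ext <;> simp
  have hpt : p < t := lt_of_le_of_ne ht.1 (Ne.symm ht1)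
  have hs0 : sin (t - p) ≠ 0 := sin_sub_ne_zero_of_mem (by linarith) ht.2 ht1 ht2
  have hX := H.sin_div_sin_pos hp hs0
  have hX' := (sin_ne_zero_of_div_pos hX).1
  rcases lt_or_gt_of_ne ht2 with h | h
  · have hsin : 0 < sin (t - p) := sin_pos_of_pos_of_lt_pi (by linarith) (by linarith)
    have hneg : (ψ (Circle.exp t) : ℂ).re < 0 := by
      by_contra hcon
      have := mul_nonneg hr0.le (not_lt.1 hcon)
      linarith
    obtain ⟨r', hr', e'⟩ := psi_of_neg (c₁ - c₂) hneg
    refine circle_eq_of_smul_eq one_pos (mul_pos (mul_pos hX hr0) hr') ?_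
    rw [Complex.ofReal_mul, mul_assoc, e', ev]
    have hc := h1 t ⟨hpt, h⟩
    have hc' : cos (Φ t - Φ p) = (κ * (cos (t - p) / sin (t - p)) + c₁) * sin (Φ t - Φ p) := by
      rw [← hc]; field_simp
    have e3 : ∀ x y : ℝ, ((sin (Φ t - Φ p) / sin (t - p) * r : ℝ) : ℂ) * ⟨x, y⟩
        = ⟨sin (Φ t - Φ p) / sin (t - p) * (r * x), sin (Φ t - Φ p) / sin (t - p) * (r * y)⟩ := by
      intro x y
      apply Complex.ext
      · simp only [Complex.mul_re, Complex.ofReal_re, Complex.ofReal_im, zero_mul, sub_zero]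
        ring
      · simp only [Complex.mul_im, Complex.ofReal_re, Complex.ofReal_im, zero_mul, add_zero]
        ring
    rw [e3, mul_sub, mul_left_comm r, er1, er2, hc']
    apply Complex.ext
    · simp; field_simp
    · simp; field_simp; ring
  · have hsin : sin (t - p) < 0 := by
      have := sin_pos_of_pos_of_lt_pi (x := t - p - π) (by linarith) (by linarith [ht.2])
      rw [Real.sin_sub_pi] at this
      linarith
    rw [psi_of_nonneg _ (hre (by linarith))]
    refine circle_eq_of_smul_eq one_pos (mul_pos hX hr0) ?_
    rw [Complex.ofReal_mul, mul_assoc, er', ev]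
    have hc := h2 t ⟨h, ht.2⟩
    have hc' : cos (Φ t - Φ p) = (κ * (cos (t - p) / sin (t - p)) + c₂) * sin (Φ t - Φ p) := by
      rw [← hc]; field_simp
    rw [hc']
    apply Complex.ext
    · simp only [Complex.mul_re, Complex.ofReal_re, Complex.ofReal_im,
        Complex.ofReal_one, one_mul, zero_mul, sub_zero]
      field_simp
    · simp only [Complex.mul_im, Complex.ofReal_re, Complex.ofReal_im,
        Complex.ofReal_one, one_mul, zero_mul, add_zero]
      field_simp

/-- The point `e^{ip}` which `ψ` sends to the vertical axis is a balance point, because `psi τ`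
fixes the ends of its half circle. Reading off the rays on each side of `p` recovers affine
cotangent relations with a common slope, so `energy_eq_zero_of_cot` applies. -/
theorem energy_eq_zero_of_shear {r : Circle} {τ : ℝ} {ψ : Equiv.Perm Circle} (hψ : ψ ∈ Mob)
    (h : ∀ P, φ P = r * psi τ (ψ P)) :
    ∫ t in (0 : ℝ)..(2 * π), eDensity u v t = 0 := by
  obtain ⟨a, b, c, d, hdet, hr⟩ := rays_of_mem_mob hψ
  -- polar form of the first row
  obtain ⟨ρ, p, hρ, ha, hb⟩ : ∃ ρ p : ℝ, 0 < ρ ∧ a = ρ * sin p ∧ b = -(ρ * cos p) := by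
    have hz : (⟨-b, a⟩ : ℂ) ≠ 0 := by
      intro h0
      have e1 : -b = 0 := congrArg Complex.re h0
      have e2 : a = 0 := congrArg Complex.im h0
      rw [e2, neg_eq_zero.1 e1] at hdet
      norm_num at hdet
    refine ⟨‖(⟨-b, a⟩ : ℂ)‖, Complex.arg ⟨-b, a⟩, norm_pos_iff.2 hz, ?_, ?_⟩
    · rw [Complex.norm_mul_sin_arg]
    · rw [Complex.norm_mul_cos_arg]; simp
  set γ := c * cos p + d * sin p with hγ
  set δ := d * cos p - c * sin p with hδ
  have hγ1 : ρ * γ = 1 := by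
    rw [← hdet, ha, hb, hγ]; ring
  have hγ0 : 0 < γ := by
    by_contra hcon
    nlinarith [not_lt.1 hcon]
  have hr' : ∀ t, ∃ s : ℝ, 0 < s ∧ s * (ψ (Circle.exp t) : ℂ).re = -(ρ * sin (t - p)) ∧
      s * (ψ (Circle.exp t) : ℂ).im = γ * cos (t - p) + δ * sin (t - p) := by
    intro t
    obtain ⟨s, hs, e⟩ := hr t
    have hsc := Real.sin_sq_add_cos_sq p
    refine ⟨s, hs, ?_, ?_⟩
    · have e1 : s * (ψ (Circle.exp t) : ℂ).re = a * cos t + b * sin t := by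
        simpa using congrArg Complex.re e
      rw [e1, ha, hb, Real.sin_sub]; ring
    · have e1 : s * (ψ (Circle.exp t) : ℂ).im = c * cos t + d * sin t := by
        simpa using congrArg Complex.im e
      rw [e1, hγ, hδ, Real.sin_sub, Real.cos_sub]
      linear_combination (-(c * cos t + d * sin t)) * hsc
  have hpi := Real.pi_pos
  -- the values of `psi τ ∘ ψ`
  have hnonneg : ∀ t, sin (t - p) ≤ 0 → ∃ s : ℝ, 0 < s ∧ (s : ℂ) * psi τ (ψ (Circle.exp t))
      = ⟨-(ρ * sin (t - p)), γ * cos (t - p) + δ * sin (t - p)⟩ := by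
    intro t ht
    obtain ⟨s, hs, e1, e2⟩ := hr' t
    have hre : 0 ≤ (ψ (Circle.exp t) : ℂ).re := by
      refine nonneg_of_mul_nonneg_right (a := s) ?_ hs
      rw [e1]; nlinarith
    refine ⟨s, hs, ?_⟩
    rw [psi_of_nonneg τ hre, ← e1, ← e2]
    apply Complex.ext <;> simp
  have hneg : ∀ t, 0 < sin (t - p) → ∃ s : ℝ, 0 < s ∧ (s : ℂ) * psi τ (ψ (Circle.exp t))
      = ⟨-(ρ * sin (t - p)), γ * cos (t - p) + (δ + τ * ρ) * sin (t - p)⟩ := by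
    intro t ht
    obtain ⟨s, hs, e1, e2⟩ := hr' t
    have hre : (ψ (Circle.exp t) : ℂ).re < 0 := by
      by_contra hcon
      have := mul_nonneg hs.le (not_lt.1 hcon)
      have := mul_pos hρ ht
      linarith
    obtain ⟨s', hs', e'⟩ := psi_of_neg τ hre
    refine ⟨s * s', mul_pos hs hs', ?_⟩
    rw [Complex.ofReal_mul, mul_assoc, e']
    apply Complex.ext
    · simpa using e1
    · simp only [Complex.mul_im, Complex.ofReal_re, Complex.ofReal_im, zero_mul, add_zero]
      rw [mul_sub, e2, mul_left_comm, e1]; ring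
  -- the base points
  have b1 : psi τ (ψ (Circle.exp p)) = Circle.exp (π / 2) := by
    obtain ⟨s, hs, e⟩ := hnonneg p (by simp)
    refine circle_eq_of_smul_eq hs hγ0 ?_
    rw [e, coe_circle_exp]
    apply Complex.ext <;> simp
  have b2 : psi τ (ψ (Circle.exp (p + π))) = -Circle.exp (π / 2) := by
    obtain ⟨s, hs, e⟩ := hnonneg (p + π) (by simp)
    rw [← exp_add_pi]
    refine circle_eq_of_smul_eq hs hγ0 ?_
    rw [e, coe_circle_exp]
    apply Complex.ext <;> simp
  have hrp : r = Circle.exp (Φ p - π / 2) := by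
    have := h (Circle.exp p)
    rw [hΦ, b1] at this
    rw [← mul_left_inj (Circle.exp (π / 2)), ← this, ← Circle.exp_add]
    congr 1; ring
  have hp : Φ (p + π) = Φ p + π := by
    refine (lift_balance_iff H.strictMono H.continuous hΦ p).1 ?_
    rw [← exp_add_pi, h, h, b1, b2]
    apply Circle.ext
    simp
  have hval : ∀ t, psi τ (ψ (Circle.exp t)) = Circle.exp (Φ t - Φ p + π / 2) := by
    intro t
    have := h (Circle.exp t)
    rw [hΦ, hrp, exp_sub_add (Φ t) (Φ p)] at this
    exact (mul_left_cancel this).symm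
  have hcot : ∀ t e : ℝ, sin (t - p) ≠ 0 → (∃ s : ℝ, 0 < s ∧
      (s : ℂ) * psi τ (ψ (Circle.exp t)) = ⟨-(ρ * sin (t - p)), γ * cos (t - p)
        + e * sin (t - p)⟩) →
      cos (Φ t - Φ p) / sin (Φ t - Φ p) = γ / ρ * (cos (t - p) / sin (t - p)) + e / ρ := by
    rintro t e ht ⟨s, hs, es⟩
    rw [hval, coe_circle_exp, Real.cos_add_pi_div_two, Real.sin_add_pi_div_two] at es
    have e1 : s * sin (Φ t - Φ p) = ρ * sin (t - p) := by
      simpa using congrArg Complex.re es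
    have e2 : s * cos (Φ t - Φ p) = γ * cos (t - p) + e * sin (t - p) := by
      simpa using congrArg Complex.im es
    have e3 : cos (Φ t - Φ p) / sin (Φ t - Φ p)
        = (s * cos (Φ t - Φ p)) / (s * sin (Φ t - Φ p)) := by
      rw [mul_div_mul_left _ _ hs.ne']
    rw [e3, e1, e2]
    field_simp
  refine H.energy_eq_zero_of_cot hp (κ := γ / ρ) (c₁ := (δ + τ * ρ) / ρ) (c₂ := δ / ρ)
    (fun t ht => ?_) (fun t ht => ?_)
  · have hsin : 0 < sin (t - p) :=
      sin_pos_of_pos_of_lt_pi (by linarith [ht.1]) (by linarith [ht.2])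
    exact hcot t _ hsin.ne' (hneg t hsin)
  · have hsin : sin (t - p) < 0 := by
      have := sin_pos_of_pos_of_lt_pi (x := t - p - π) (by linarith [ht.1]) (by linarith [ht.2])
      rw [Real.sin_sub_pi] at this
      linarith
    exact hcot t _ hsin.ne (hnonneg t hsin.le)

end CircleLift

theorem differentiableAt_logAngDeriv {φ : Equiv.Perm Circle} (h : φ ∈ DiffPlus 2) (t : ℝ) :
    DifferentiableAt ℝ (fun t => logAngDeriv φ (Circle.exp t)) t := by
  have h1 : ContMDiff (𝓡 1) (𝓡 1) ((1 : ℕ∞ω) + 1) φ := by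
    have := h.1
    convert! this using 1
  exact ((contDiff_angDeriv_exp h1).differentiable one_ne_zero t).log (h.2.2 _).ne'

end OvalsBL

/-! ### The main theorem -/

theorem mainTheorem3 (φ : DiffPlus 1) (hH : φ ∈ HDiff) (hB : φ ∈ closure (BDiff 4)) :
    0 ≤ EGstar φ.1 ∧
    (EGstar φ.1 = 0 ↔
      ∃ (r : Circle) (τ : ℝ) (φ' : Equiv.Perm Circle), φ' ∈ Mob ∧
        ∀ p : Circle, φ.1 p = r * psi τ (φ' p)) ∧
    ((φ.1 ∈ DiffPlus 2 ∨ φ ∈ BDiff 4) → (EGstar φ.1 = 0 ↔ φ.1 ∈ Mob)) := by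
  obtain ⟨Φ, H, hΦ, hE⟩ := exists_circleLift hH
  rw [hE]
  set E := ∫ t in (0 : ℝ)..(2 * π), eDensity (fun t => logAngDeriv φ.1 (Circle.exp t))
        (fun t => weakDeriv (logAngDeriv φ.1) (Circle.exp t)) t
  have hbal := lift_balance_iff H.strictMono H.continuous hΦ
  have hshear : ∀ (r : Circle) (τ : ℝ) (ψ : Equiv.Perm Circle), ψ ∈ Mob →
      (∀ p, φ.1 p = r * psi τ (ψ p)) → E = 0 := fun r τ ψ hψ h => H.energy_eq_zero_of_shear hΦ hψ h
  have hform : φ.1 ∈ Mob → ∃ (r : Circle) (τ : ℝ) (ψ : Equiv.Perm Circle), ψ ∈ Mob ∧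
      ∀ p : Circle, φ.1 p = r * psi τ (ψ p) := fun h =>
    ⟨1, 0, φ.1, h, fun p => by rw [psi_zero, one_mul]⟩
  have hmob : φ.1 ∈ Mob → E = 0 := fun h => by
    obtain ⟨r, τ, ψ, h1, h2⟩ := hform h
    exact hshear r τ ψ h1 h2
  have hsimple : ∀ p q, p < q → q < p + π → φ.1 (-Circle.exp p) = -φ.1 (Circle.exp p) →
      φ.1 (-Circle.exp q) = -φ.1 (Circle.exp q) → 0 ≤ E ∧ (E = 0 → φ.1 ∈ Mob) := fun p q h1 h2 hp hq =>
    ⟨(H.energy_simple ((hbal p).1 hp) ((hbal q).1 hq) h1 h2).1, fun h0 => by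
      obtain ⟨l, hl, hl'⟩ := (H.energy_simple ((hbal p).1 hp) ((hbal q).1 hq) h1 h2).2 h0
      exact H.mem_mob_of_simple hΦ ((hbal p).1 hp) ((hbal q).1 hq) h1 h2 hl hl'⟩
  -- Independent of the case split below: a member of `BDiff 4` may also fall into the double case,
  -- where its own two pairs must be used.
  have hBD : φ ∈ BDiff 4 → E = 0 → φ.1 ∈ Mob := by
    intro h
    obtain ⟨p, q, -, h1, h2, hp, hq⟩ := exists_two_balance h
    exact (hsimple p q h1 h2 hp hq).2
  obtain ⟨p, hp, hcase⟩ := balance_of_mem_closure hB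
  rcases hcase with ⟨q, h1, h2, hq⟩ | hu
  · obtain ⟨e1, e2⟩ := hsimple p q h1 h2 hp hq
    exact ⟨e1, ⟨fun h => hform (e2 h), fun ⟨r, τ, ψ, h3, h4⟩ => hshear r τ ψ h3 h4⟩,
      fun _ => ⟨e2, hmob⟩⟩
  · have hp' := (hbal p).1 hp
    have hu' : logAngDeriv φ.1 (Circle.exp (p + π)) = logAngDeriv φ.1 (Circle.exp p) := by
      rw [exp_add_pi, logAngDeriv, logAngDeriv, hu]
    obtain ⟨e1, e2⟩ := H.energy_double hp' hu'
    have hs1 : ∀ t ∈ Ioo p (p + π), sin (t - p) ≠ 0 := fun t ht =>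
      sin_sub_ne_zero_of_mem (by linarith [ht.1, Real.pi_pos]) (by linarith [ht.2, Real.pi_pos])
        ht.1.ne' ht.2.ne
    have hs2 : ∀ t ∈ Ioo (p + π) (p + 2 * π), sin (t - p) ≠ 0 := fun t ht =>
      sin_sub_ne_zero_of_mem (by linarith [ht.1, Real.pi_pos]) (by linarith [ht.2, Real.pi_pos])
        (by linarith [ht.1, Real.pi_pos]) ht.1.ne'
    refine ⟨e1, ⟨fun h => ?_, fun ⟨r, τ, ψ, h3, h4⟩ => hshear r τ ψ h3 h4⟩, fun h12 => ⟨fun h => ?_,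
      hmob⟩⟩
    · have hf := e2.1 h
      obtain ⟨c₁, h1⟩ := H.exists_cot_of_sharp hp' hs1 fun t _ => hf t
      obtain ⟨c₂, h2⟩ := H.exists_cot_of_sharp hp' hs2 fun t _ => hf t
      obtain ⟨r, ψ, h3, h4⟩ := H.exists_shear_of_cot hΦ hp' (exp_pos _) h1 h2
      exact ⟨r, _, ψ, h3, h4⟩
    · rcases h12 with hC | hC
      · have hf := e2.1 h
        obtain ⟨c₁, h1⟩ := H.exists_cot_of_sharp hp' hs1 fun t _ => hf t
        obtain ⟨c₂, h2⟩ := H.exists_cot_of_sharp hp' hs2 fun t _ => hf t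
        -- For `φ` of class `C²`, `u` is differentiable at `p`, so the shear parameter `c₁ - c₂`
        -- vanishes and `psi 0` is the identity.
        have hc := H.cot_const_unique (differentiableAt_logAngDeriv hC p) hf h1 h2
        obtain ⟨r, ψ, h3, h4⟩ := H.exists_shear_of_cot hΦ hp' (exp_pos _) h1 h2
        refine mem_mob_of_rotation h3 r fun P => ?_
        rw [h4, hc, sub_self, psi_zero]
      · exact hBD hC h
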